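/- Let $N\ge 2$, let $X=(X_1,\dots,X_m)$ be locally Lipschitz vector fields on $\mathbb R^N$, and let $\Omega\subset\mathbb R^N$ be open and bounded. Let $U\subset\mathbb R^N$ be open with either $U=\Omega$ or $\overline\Omega\subset U$. An absolutely continuous path $\gamma:[0,T]\to U$ is called $X$-subunit if, for a.e. $t$, $\dot\gamma(t)=\sum_j\theta_j(t)X_j(\gamma(t))$ with $\sum_j\theta_j(t)^2\le 1$. Assume that any two points of $U$ are joined by an $X$-subunit path in $U$, let $d_X(x,y)$ be the infimum of the times $T>0$ for which there is an $X$-subunit path $\gamma:[0,T]\to U$ from $x$ to $y$, and let $B_r(x)=\{y\in U: d_X(x,y)<r\}$ for $x\in U$, $r>0$. Assume that 1. for every $x\in U$, $d_X(x,y)\to 0$ as $|y-x|\to 0$, $y\in U$; 2. there is $Q>2$ with $0<|B_{2r}(x)|\le 2^Q|B_r(x)|$ for all $x\in U$, $r>0$; 3. there are $C_P,\nu>0$ such that, for all $x\in U$, $r>0$ and all $u\in C^1_c(\mathbb R^N)$, $$\frac1{|B_r(x)|}\int_{B_r(x)}|u-u_{B_r(x)}|\,dy\le C_P\,r\,\frac1{|B_{\nu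 r}(x)|}\int_{B_{\nu r}(x)}|Xu|\,dy,$$ where $Xu=(X_1u,\dots,X_mu)$ and $u_{B}$ is the mean of $u$ over $B$. Let $W^{1,2}_0(\Omega,X)$ be the closure of $C_c^\infty(\Omega)$: $u\in L^2(\Omega)$ belongs to it, with $X$-gradient $Xu\in L^2(\Omega)^m$, if there are $\varphi_n\in C_c^\infty(\Omega)$ with $\varphi_n\to u$ and $X\varphi_n\to Xu$ in $L^2(\Omega)$. For a measurable $m\times m$ matrix field $A$ on $\Omega$, not necessarily symmetric, and a function $f$ on $\Omega$, a weak solution of $$X^*(A\,Xu)=f\ \text{ in }\Omega,\qquad u=0\ \text{ on }\partial\Omega$$ is a function $u\in W^{1,2}_0(\Omega,X)$ such that, for all $v\in W^{1,2}_0(\Omega,X)$, $A\,Xu\cdot Xv$ is integrable on $\Omega$ and $\int_\Omega A\,Xu\cdot Xv=\int_\Omega f v$. Let $\frac{2Q}{Q+2}\le p<\frac Q2$, $p^{**}=\frac{pQ}{Q-2p}$ and $\alpha>0$. Then there is a constant $C$, depending only on $X,U,\Omega,Q,p$ and $\alpha$, such that the following holds for every $\beta>\alpha$, every measurable $A$ with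 $$\alpha|\eta|^2\le A(x)\eta\cdot\eta\le\beta|\eta|^2\quad\text{for a.e. }x\in\Omega\text{ and all }\eta\in\mathbb R^m,$$ and every $f\in L^p(\Omega)$: every weak solution $u$ belongs to $L^{p^{**}}(\Omega)$, and $$\|u\|_{L^{p^{**}}(\Omega)}\le C\,\|f\|_{L^p(\Omega)}.$$ -/

import Mathlib

open MeasureTheory Filter Topology
open scoped ENNReal NNReal ContDiff

namespace XElliptic

/-- Euclidean space `ℝ^n`. -/
abbrev E (n : ℕ) : Type := EuclideanSpace ℝ (Fin n)

/-- A family `X = (X₁, …, X_m)` of vector fields on `ℝ^N`; `X j x` is the coefficient vector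
`(c_{j1}(x), …, c_{jN}(x))`. -/
abbrev Fields (N m : ℕ) : Type := Fin m → E N → E N

/-- `γ : [0, T] → U` is an `X`-subunit path: it is absolutely continuous, takes its values in `U`,
and `γ'(t) = ∑ θ_j(t) X_j(γ(t))` with `∑ θ_j(t)² ≤ 1` for almost every `t ∈ [0, T]`. -/
def IsSubunit {N m : ℕ} (X : Fields N m) (U : Set (E N)) (T : ℝ) (γ : ℝ → E N) : Prop :=
  AbsolutelyContinuousOnInterval γ 0 T ∧
  (∀ t ∈ Set.Icc 0 T, γ t ∈ U) ∧
  ∃ θ : ℝ → Fin m → ℝ, ∀ᵐ t ∂(volume.restrict (Set.Icc 0 T)),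
    ∑ j, θ t j ^ 2 ≤ 1 ∧ HasDerivAt γ (∑ j, θ t j • X j (γ t)) t

/-- The times `T > 0` in which `y` can be reached from `x` along an `X`-subunit path in `U`. -/
def travelTimes {N m : ℕ} (X : Fields N m) (U : Set (E N)) (x y : E N) : Set ℝ :=
  {T | 0 < T ∧ ∃ γ : ℝ → E N, IsSubunit X U T γ ∧ γ 0 = x ∧ γ T = y}

/-- `U` is `X`-connected: any two points of `U` are joined by an `X`-subunit path in `U`. -/
def XConnected {N m : ℕ} (X : Fields N m) (U : Set (E N)) : Prop :=
  ∀ x ∈ U, ∀ y ∈ U, (travelTimes X U x y).Nonempty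

/-- The control (Carnot–Carathéodory) distance of `U`. It is used only on `X`-connected sets `U`,
where the infimum is over a nonempty set of positive numbers. -/
noncomputable def dX {N m : ℕ} (X : Fields N m) (U : Set (E N)) (x y : E N) : ℝ :=
  sInf (travelTimes X U x y)

/-- The open ball of the metric space `(U, d_X)`. -/
def ballX {N m : ℕ} (X : Fields N m) (U : Set (E N)) (x : E N) (r : ℝ) : Set (E N) :=
  {y | y ∈ U ∧ dX X U x y < r}

/-- The `X`-gradient `Xu = (X₁u, …, X_m u)` of a `C¹` function. -/
noncomputable def gradX {N m : ℕ} (X : Fields N m) (u : E N → ℝ) (x : E N) : E m :=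
  WithLp.toLp 2 fun j => fderiv ℝ u x (X j x)

/-- The structural assumptions on the fields `X` over the open set `U`, with doubling exponent `Q`.
In the Poincaré inequality the test functions are the restrictions of compactly supported `C¹`
functions on `ℝ^N`; when the closed ball is compact these are all `C¹` functions on it. -/
structure Admissible {N m : ℕ} (X : Fields N m) (U : Set (E N)) (Q : ℝ) : Prop where
  lipschitz : ∀ j, LocallyLipschitz (X j)
  connected : XConnected X U
  euclidean : ∀ x ∈ U, Tendsto (fun y => dX X U x y) (𝓝[U] x) (𝓝 0)
  two_lt : 2 < Q
  doubling : ∀ x ∈ U, ∀ r : ℝ, 0 < r →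
    0 < volume (ballX X U x (2 * r)) ∧
    volume (ballX X U x (2 * r)) ≤ ENNReal.ofReal ((2 : ℝ) ^ Q) * volume (ballX X U x r)
  poincare : ∃ CP ν : ℝ, 0 < CP ∧ 0 < ν ∧ ∀ x ∈ U, ∀ r : ℝ, 0 < r →
    ∀ u : E N → ℝ, ContDiff ℝ 1 u → HasCompactSupport u →
      ⨍ y in ballX X U x r, |u y - ⨍ z in ballX X U x r, u z| ≤
        CP * r * ⨍ y in ballX X U x (ν * r), ‖gradX X u y‖

/-- `φ ∈ C_c^∞(Ω)`. -/
def IsTest {N : ℕ} (Ω : Set (E N)) (φ : E N → ℝ) : Prop :=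
  ContDiff ℝ ∞ φ ∧ HasCompactSupport φ ∧ tsupport φ ⊆ Ω

/-- `u ∈ W_0^{1,q}(Ω, X)` with `X`-gradient `g`: there are `φ_n ∈ C_c^∞(Ω)` with `φ_n → u` and
`X φ_n → g` in `L^q(Ω)`. -/
def IsW0 {N m : ℕ} (X : Fields N m) (Ω : Set (E N)) (q : ℝ≥0∞) (u : E N → ℝ) (g : E N → E m) :
    Prop :=
  MemLp u q (volume.restrict Ω) ∧ MemLp g q (volume.restrict Ω) ∧
  ∃ φ : ℕ → E N → ℝ, (∀ n, IsTest Ω (φ n)) ∧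
    Tendsto (fun n => eLpNorm (fun x => φ n x - u x) q (volume.restrict Ω)) atTop (𝓝 0) ∧
    Tendsto (fun n => eLpNorm (fun x => gradX X (φ n) x - g x) q (volume.restrict Ω)) atTop (𝓝 0)

/-- `M ξ · η`. -/
def bilin {m : ℕ} (M : Matrix (Fin m) (Fin m) ℝ) (ξ η : E m) : ℝ :=
  ∑ i, (∑ j, M i j * ξ j) * η i

/-- `A` is a measurable matrix field on `Ω` with `α|η|² ≤ A(x)η·η ≤ β|η|²` for all `η ∈ ℝ^m`.
No symmetry is required. -/
def IsElliptic {N m : ℕ} (Ω : Set (E N)) (α β : ℝ) (A : E N → Matrix (Fin m) (Fin m) ℝ) : Prop :=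
  (∀ i j, AEMeasurable (fun x => A x i j) (volume.restrict Ω)) ∧
  ∀ᵐ x ∂(volume.restrict Ω), ∀ η : E m,
    α * ‖η‖ ^ 2 ≤ bilin (A x) η η ∧ bilin (A x) η η ≤ β * ‖η‖ ^ 2

/-- `u` is a weak solution of `X^*(A Xu) = f` in `Ω`, `u = 0` on `∂Ω`: `u ∈ W_0^{1,2}(Ω, X)` and
`∫ A Xu · Xv = ∫ f v` for all `v ∈ W_0^{1,2}(Ω, X)`. That the left integral exists is part of the
requirement, because the ellipticity bounds do not control the skew part of `A`. -/
def IsWeakSolution {N m : ℕ} (X : Fields N m) (Ω : Set (E N))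
    (A : E N → Matrix (Fin m) (Fin m) ℝ) (f u : E N → ℝ) : Prop :=
  ∃ g : E N → E m, IsW0 X Ω 2 u g ∧
    ∀ (v : E N → ℝ) (h : E N → E m), IsW0 X Ω 2 v h →
      Integrable (fun x => bilin (A x) (g x) (h x)) (volume.restrict Ω) ∧
      ∫ x in Ω, bilin (A x) (g x) (h x) = ∫ x in Ω, f x * v x

end XElliptic

open MeasureTheory Filter Topology
open scoped ENNReal NNReal ContDiff

namespace XElliptic

/-! ### Absolutely continuous curves with values in a normed space -/

/-! The proof combines a Sobolev inequality `‖φ‖_{2Q/(Q-2)} ≤ S ‖Xφ‖_2` for test functions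
(`Admissible.exists_eLpNorm_le`) with a power of the solution as test function
(`IsWeakSolution.memLp_and_eLpNorm_le`).

Sobolev. Along dyadic control balls shrinking to `x`, Poincaré and doubling bound the distance of `φ
x` from its mean over `B_1(x)` by `∑ 2^{-k} A_k`, where `A_k` is the mean of `|Xφ|` over `B_{ν
2^{-k}}(x)`. Each `A_k` is at most a maximal function `M`, and by Cauchy–Schwarz and doubling also
at most a multiple of `‖Xφ‖_2 2^{kQ/2}`. Hedberg's splitting of the sum gives `M^{1-2/Q}
‖Xφ‖_2^{2/Q}`, and the `L²` bound for `M` (Vitali covering and layer cake) finishes. The mean over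
`B_1(x)` is where the zero boundary values enter, through the Friedrichs inequality `∫|φ| ≤ C
∫|Xφ|`.

Friedrichs. A set of positive measure is needed on which all test functions vanish. If `closure Ω ⊆
U`, a large control ball contains an open piece outside `closure Ω`, and Poincaré suffices. If `U =
Ω`, control balls never see the exterior. A subunit path then runs from a fixed Euclidean ball in
`Ω` to a point near the exterior. Euler schemes following it, for globally Lipschitz extensions of
the fields, are uniformly bi-Lipschitz and carry a subset of the ball onto an exterior set. As `φ`
vanishes at the end, its mean on that subset is bounded by integrating `|Xφ|` along the orbits. The
uniformity comes from the boundedness of the control distance on `Ω`, a consequence of doubling and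
finite volume.

Equation. Formally one tests with `u|u|^{4σ}` and applies Sobolev to `u|u|^{2σ}`. The gradient of
the test function is a multiple of `Xu`, so the left side is bounded below in terms of `α` alone.
With `r = p**` and `(1+2σ)·2Q/(Q-2) = r`, Hölder gives `I^{1/r+1/p'} ≤ C ‖f‖_p I^{1/p'}` for `I =
∫|u|^r`, and a factor cancels. Smooth truncations of linear growth make the test function admissible
and `I` finite. -/

lemma absolutelyContinuousOnInterval_clm_comp {F : Type*} [NormedAddCommGroup F] [NormedSpace ℝ F]
    {γ : ℝ → F} {a b : ℝ} (h : AbsolutelyContinuousOnInterval γ a b) (l : F →L[ℝ] ℝ) :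
    AbsolutelyContinuousOnInterval (fun t => l (γ t)) a b := by
  rw [absolutelyContinuousOnInterval_iff] at h ⊢
  intro ε hε
  obtain ⟨δ, hδ, H⟩ := h (ε / (‖l‖ + 1)) (by positivity)
  refine ⟨δ, hδ, fun I hI hs => ?_⟩
  have h1 := H I hI hs
  rw [lt_div_iff₀ (by positivity)] at h1
  refine lt_of_le_of_lt ?_ h1
  rw [Finset.sum_mul]
  refine Finset.sum_le_sum fun i _ => ?_
  rw [dist_eq_norm, dist_eq_norm, ← map_sub]
  refine (l.le_opNorm _).trans ?_
  nlinarith [norm_nonneg (γ (I.2 i).1 - γ (I.2 i).2)]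

/-- The mean velocity of an absolutely continuous curve lies in every closed convex set that
contains almost all velocities. -/
lemma AbsolutelyContinuousOnInterval.slope_mem {F : Type*} [NormedAddCommGroup F]
    [NormedSpace ℝ F] {γ : ℝ → F} {a b : ℝ} (hab : a < b)
    (h : AbsolutelyContinuousOnInterval γ a b) {S : Set F} (hS : Convex ℝ S) (hSc : IsClosed S)
    (hd : ∀ᵐ t, t ∈ Set.Icc a b → ∃ v ∈ S, HasDerivAt γ v t) :
    (b - a)⁻¹ • (γ b - γ a) ∈ S := by
  by_contra hn
  -- Separate the mean velocity from `S` by a functional `l`: the scalar function `l ∘ γ` has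
  -- derivative below `c` almost everywhere, yet mean slope above `c`.
  obtain ⟨l, c, h1, h2⟩ := geometric_hahn_banach_closed_point hS hSc hn
  have hl := absolutelyContinuousOnInterval_clm_comp h l
  have hint := AbsolutelyContinuousOnInterval.integral_deriv_eq_sub hl
  have hle : ∫ x in a..b, deriv (fun t => l (γ t)) x ≤ ∫ x in a..b, c := by
    refine intervalIntegral.integral_mono_ae_restrict hab.le
      (AbsolutelyContinuousOnInterval.intervalIntegrable_deriv hl) (by simp) ?_
    rw [EventuallyLE, ae_restrict_iff' measurableSet_Icc]
    filter_upwards [hd] with t ht htm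
    obtain ⟨v, hv, hvd⟩ := ht htm
    have h3 : HasDerivAt (fun t => l (γ t)) (l v) t := l.hasFDerivAt.comp_hasDerivAt t hvd
    rw [h3.deriv]
    exact (h1 v hv).le
  rw [hint] at hle
  simp only [intervalIntegral.integral_const, smul_eq_mul] at hle
  rw [map_smul, map_sub, smul_eq_mul, ← div_eq_inv_mul, lt_div_iff₀ (by linarith)] at h2
  linarith

/-! ### Subunit paths -/

lemma norm_sum_smul_le {m : ℕ} {F : Type*} [NormedAddCommGroup F] [NormedSpace ℝ F]
    {θ : Fin m → ℝ} (hθ : ∑ j, θ j ^ 2 ≤ 1) (v : Fin m → F) :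
    ‖∑ j, θ j • v j‖ ≤ ∑ j, ‖v j‖ := by
  refine (norm_sum_le _ _).trans (Finset.sum_le_sum fun j _ => ?_)
  rw [norm_smul]
  have h1 : θ j ^ 2 ≤ 1 :=
    (Finset.single_le_sum (fun i _ => sq_nonneg (θ i)) (Finset.mem_univ j)).trans hθ
  have h2 : ‖θ j‖ ≤ 1 := by
    rw [Real.norm_eq_abs]; exact abs_le_one_iff_mul_self_le_one.2 (by nlinarith)
  nlinarith [norm_nonneg (v j)]

variable {N m : ℕ} {X : Fields N m} {U : Set (E N)}

lemma IsSubunit.continuousOn {T : ℝ} (hT : 0 ≤ T) {γ : ℝ → E N} (h : IsSubunit X U T γ) :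
    ContinuousOn γ (Set.Icc 0 T) := by
  simpa [Set.uIcc_of_le hT] using AbsolutelyContinuousOnInterval.continuousOn h.1

/-- On a time interval spent in a set where the fields are bounded, a subunit path is Lipschitz. -/
lemma IsSubunit.norm_sub_le {T : ℝ} {γ : ℝ → E N} (h : IsSubunit X U T γ) {a b : ℝ}
    (ha : 0 ≤ a) (hab : a ≤ b) (hb : b ≤ T) {M : ℝ}
    (hM : ∀ t ∈ Set.Icc a b, ∑ j, ‖X j (γ t)‖ ≤ M) : ‖γ b - γ a‖ ≤ M * (b - a) := by
  rcases hab.eq_or_lt with rfl | hab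
  · simp
  obtain ⟨hac, -, θ, hθ⟩ := h
  have hsub : Set.uIcc a b ⊆ Set.uIcc 0 T := by
    rw [Set.uIcc_of_le hab.le, Set.uIcc_of_le (by linarith)]; exact Set.Icc_subset_Icc ha hb
  have := AbsolutelyContinuousOnInterval.slope_mem hab
    (AbsolutelyContinuousOnInterval.mono hac hsub)
    (convex_closedBall (0 : E N) M) Metric.isClosed_closedBall (by
      rw [ae_restrict_iff' measurableSet_Icc] at hθ
      filter_upwards [hθ] with t ht htm
      obtain ⟨h1, h2⟩ := ht ⟨ha.trans htm.1, htm.2.trans hb⟩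
      exact ⟨_, by simpa using (norm_sum_smul_le h1 _).trans (hM t htm), h2⟩)
  rw [mem_closedBall_zero_iff, norm_smul, norm_inv, Real.norm_of_nonneg (by linarith),
    ← div_eq_inv_mul, div_le_iff₀ (by linarith)] at this
  exact this

lemma continuous_sum_norm (hX : ∀ j, LocallyLipschitz (X j)) :
    Continuous fun x => ∑ j, ‖X j x‖ :=
  continuous_finsetSum _ fun j _ => (hX j).continuous.norm

/-- The fields are bounded on the compact trace of the path. Reversal and concatenation then reduce
to Lipschitz estimates instead of absolute continuity. -/
lemma IsSubunit.exists_lipschitzOnWith (hX : ∀ j, LocallyLipschitz (X j)) {T : ℝ} (hT : 0 ≤ T)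
    {γ : ℝ → E N} (h : IsSubunit X U T γ) : ∃ K, LipschitzOnWith K γ (Set.Icc 0 T) := by
  have hc : ContinuousOn (fun t => ∑ j, ‖X j (γ t)‖) (Set.Icc 0 T) :=
    (continuous_sum_norm hX).comp_continuousOn (h.continuousOn hT)
  obtain ⟨M, hM⟩ := isCompact_Icc.bddAbove_image hc
  have hM' : ∀ t ∈ Set.Icc 0 T, ∑ j, ‖X j (γ t)‖ ≤ M := fun t ht => hM ⟨t, ht, rfl⟩
  have hM0 : 0 ≤ M := (by positivity : 0 ≤ ∑ j, ‖X j (γ 0)‖).trans (hM' 0 ⟨le_rfl, hT⟩)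
  refine ⟨M.toNNReal, LipschitzOnWith.of_dist_le_mul fun s hs t ht => ?_⟩
  rw [Real.coe_toNNReal _ hM0]
  wlog hst : s ≤ t generalizing s t
  · rw [dist_comm, dist_comm s]; exact this t ht s hs (le_of_not_ge hst)
  rw [dist_comm, dist_comm s, dist_eq_norm, Real.dist_eq, abs_of_nonneg (by linarith)]
  exact h.norm_sub_le hs.1 hst ht.2 fun r hr => hM' r ⟨hs.1.trans hr.1, hr.2.trans ht.2⟩

lemma isSubunit_const {x : E N} (hx : x ∈ U) (T : ℝ) : IsSubunit X U T fun _ => x := by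
  refine ⟨(LipschitzWith.const x).lipschitzOnWith.absolutelyContinuousOnInterval (K := 0),
    fun _ _ => hx, fun _ _ => 0, ae_of_all _ fun t => ⟨by simp, ?_⟩⟩
  simpa using hasDerivAt_const t x

lemma IsSubunit.reverse (hX : ∀ j, LocallyLipschitz (X j)) {T : ℝ} (hT : 0 ≤ T) {γ : ℝ → E N}
    (h : IsSubunit X U T γ) : IsSubunit X U T fun t => γ (T - t) := by
  obtain ⟨K, hK⟩ := h.exists_lipschitzOnWith hX hT
  obtain ⟨-, hU, θ, hθ⟩ := h
  have hmaps : ∀ t ∈ Set.Icc 0 T, T - t ∈ Set.Icc 0 T := fun t ht =>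
    ⟨by linarith [ht.2], by linarith [ht.1]⟩
  refine ⟨LipschitzOnWith.absolutelyContinuousOnInterval (K := K) ?_, fun t ht => hU _ (hmaps t ht),
    fun t j => -θ (T - t) j, ?_⟩
  · rw [Set.uIcc_of_le hT]
    refine LipschitzOnWith.of_dist_le_mul fun s hs t ht => ?_
    refine (hK.dist_le_mul _ (hmaps s hs) _ (hmaps t ht)).trans_eq ?_
    rw [Real.dist_eq, Real.dist_eq, abs_sub_comm s t]
    congr 2
    ring
  · rw [ae_restrict_iff' measurableSet_Icc] at hθ ⊢
    have := (Measure.measurePreserving_sub_left volume T).quasiMeasurePreserving.ae hθ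
    filter_upwards [this] with t ht htm
    obtain ⟨h1, h2⟩ := ht (hmaps t htm)
    refine ⟨by simpa using h1, ?_⟩
    have := h2.scomp t ((hasDerivAt_id t).const_sub T)
    simpa [Function.comp_def] using this

lemma IsSubunit.concat (hX : ∀ j, LocallyLipschitz (X j)) {S T : ℝ} (hS : 0 ≤ S) (hT : 0 ≤ T)
    {γ η : ℝ → E N} (h : IsSubunit X U S γ) (h' : IsSubunit X U T η) (hγη : γ S = η 0) :
    IsSubunit X U (S + T) fun t => if t ≤ S then γ t else η (t - S) := by
  obtain ⟨K, hK⟩ := h.exists_lipschitzOnWith hX hS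
  obtain ⟨K', hK'⟩ := h'.exists_lipschitzOnWith hX hT
  obtain ⟨-, hU, θ, hθ⟩ := h
  obtain ⟨-, hU', θ', hθ'⟩ := h'
  refine ⟨LipschitzOnWith.absolutelyContinuousOnInterval (K := max K K') ?_, fun t ht => ?_,
    fun t => if t ≤ S then θ t else θ' (t - S), ?_⟩
  · rw [Set.uIcc_of_le (by linarith)]
    refine LipschitzOnWith.of_dist_le_mul fun s hs t ht => ?_
    wlog hst : s ≤ t generalizing s t
    · rw [dist_comm, dist_comm s]; exact this t ht s hs (le_of_not_ge hst)
    have hd : dist s t = t - s := by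
      rw [dist_comm, Real.dist_eq, abs_of_nonneg (by linarith)]
    have hl : (K : ℝ) ≤ (max K K' : ℝ≥0) := by exact_mod_cast le_max_left K K'
    have hr : (K' : ℝ) ≤ (max K K' : ℝ≥0) := by exact_mod_cast le_max_right K K'
    rw [hd]
    split_ifs with h1 h2 h2
    · refine (hK.dist_le_mul s ⟨hs.1, h1⟩ t ⟨ht.1, h2⟩).trans ?_
      rw [hd]; exact mul_le_mul_of_nonneg_right hl (by linarith)
    · refine (dist_triangle _ (γ S) _).trans ?_
      have e1 := hK.dist_le_mul s ⟨hs.1, h1⟩ S ⟨hS, le_rfl⟩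
      have e2 := hK'.dist_le_mul 0 ⟨le_rfl, hT⟩ (t - S) ⟨by linarith, by linarith [ht.2]⟩
      rw [dist_comm s, Real.dist_eq, abs_of_nonneg (by linarith)] at e1
      rw [dist_comm (0 : ℝ), Real.dist_eq, abs_of_nonneg (by linarith)] at e2
      rw [hγη] at e1 ⊢
      nlinarith
    · linarith
    · refine (hK'.dist_le_mul (s - S) ⟨by linarith, by linarith [hs.2]⟩ (t - S)
        ⟨by linarith, by linarith [ht.2]⟩).trans ?_
      rw [dist_comm, Real.dist_eq, abs_of_nonneg (by linarith)]
      nlinarith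
  · dsimp only
    split_ifs with h1
    · exact hU t ⟨ht.1, h1⟩
    · exact hU' _ ⟨by linarith, by linarith [ht.2]⟩
  · rw [ae_restrict_iff' measurableSet_Icc] at hθ hθ' ⊢
    have := (measurePreserving_sub_right volume S).quasiMeasurePreserving.ae hθ'
    filter_upwards [hθ, this, compl_mem_ae_iff.2 (measure_singleton S)] with t h1 h2 hne htm
    rcases lt_or_gt_of_ne hne with hlt | hgt
    · obtain ⟨h3, h4⟩ := h1 ⟨htm.1, hlt.le⟩
      simp only [hlt.le, if_true]
      refine ⟨h3, h4.congr_of_eventuallyEq ?_⟩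
      filter_upwards [Iio_mem_nhds hlt] with r hr
      simp [le_of_lt (Set.mem_Iio.1 hr)]
    · obtain ⟨h3, h4⟩ := h2 ⟨by linarith, by linarith [htm.2]⟩
      simp only [not_le.2 hgt, if_false]
      refine ⟨h3, ?_⟩
      have h5 := h4.scomp t ((hasDerivAt_id t).sub_const S)
      simp only [one_smul] at h5
      refine h5.congr_of_eventuallyEq ?_
      filter_upwards [Ioi_mem_nhds hgt] with r hr
      simp [not_le.2 (Set.mem_Ioi.1 hr)]

/-! ### The control distance -/

lemma bddBelow_travelTimes (x y : E N) : BddBelow (travelTimes X U x y) := ⟨0, fun _ h => h.1.le⟩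

lemma dX_nonneg (x y : E N) : 0 ≤ dX X U x y := Real.sInf_nonneg fun _ h => h.1.le

lemma dX_self {x : E N} (hx : x ∈ U) : dX X U x x = 0 := by
  refine le_antisymm (le_of_forall_pos_le_add fun ε hε => ?_) (dX_nonneg x x)
  rw [zero_add]
  exact csInf_le (bddBelow_travelTimes x x) ⟨hε, _, isSubunit_const hx ε, rfl, rfl⟩

lemma travelTimes_symm (hX : ∀ j, LocallyLipschitz (X j)) (x y : E N) :
    travelTimes X U x y = travelTimes X U y x := by
  have key : ∀ x y : E N, travelTimes X U x y ⊆ travelTimes X U y x := by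
    rintro x y T ⟨hT, γ, hγ, h0, h1⟩
    exact ⟨hT, _, hγ.reverse hX hT.le, by simpa using h1, by simpa using h0⟩
  exact (key x y).antisymm (key y x)

lemma dX_comm (hX : ∀ j, LocallyLipschitz (X j)) (x y : E N) : dX X U x y = dX X U y x := by
  rw [dX, dX, travelTimes_symm hX]

lemma dX_triangle (hX : ∀ j, LocallyLipschitz (X j)) (hc : XConnected X U) {x y z : E N}
    (hx : x ∈ U) (hy : y ∈ U) (hz : z ∈ U) : dX X U x z ≤ dX X U x y + dX X U y z := by
  refine le_of_forall_pos_le_add fun ε hε => ?_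
  obtain ⟨S, ⟨hS0, γ, hγ, a0, a1⟩, hS⟩ :=
    exists_lt_of_csInf_lt (hc x hx y hy) (lt_add_of_pos_right (dX X U x y) (half_pos hε))
  obtain ⟨T, ⟨hT0, η, hη, b0, b1⟩, hT⟩ :=
    exists_lt_of_csInf_lt (hc y hy z hz) (lt_add_of_pos_right (dX X U y z) (half_pos hε))
  have : S + T ∈ travelTimes X U x z :=
    ⟨by positivity, _, hγ.concat hX hS0.le hT0.le hη (a1.trans b0.symm), by simp [hS0.le, a0],
      by simp [not_le.2 hT0, b1]⟩
  have := csInf_le (bddBelow_travelTimes x z) this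
  change dX X U x z ≤ _ at this
  linarith

/-- Short subunit paths stay close to their starting point in the Euclidean distance. -/
lemma exists_ballX_subset_ball (hX : ∀ j, LocallyLipschitz (X j)) (hc : XConnected X U) {x : E N}
    (hx : x ∈ U) {ε : ℝ} (hε : 0 < ε) : ∃ r > 0, ballX X U x r ⊆ Metric.ball x ε := by
  obtain ⟨M, hM⟩ := (isCompact_closedBall x ε).bddAbove_image (continuous_sum_norm hX).continuousOn
  have hM' : ∀ y ∈ Metric.closedBall x ε, ∑ j, ‖X j y‖ ≤ max M 1 := fun y hy =>
    (hM ⟨y, hy, rfl⟩).trans (le_max_left _ _)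
  have hM0 : 0 < max M 1 := lt_max_of_lt_right one_pos
  -- Inside the Euclidean ball the speed is at most `max M 1`, so leaving it takes time at least `ε
  -- / max M 1`; the `1` keeps the denominator positive.
  refine ⟨ε / max M 1, by positivity, fun y ⟨hyU, hy⟩ => ?_⟩
  obtain ⟨T, ⟨hT0, γ, hγ, h0, h1⟩, hT⟩ := exists_lt_of_csInf_lt (hc x hx y hyU) hy
  by_contra hyb
  -- The infimum of `Z` is the first exit time; up to it the path stays in the closed ball, where
  -- the speed bound holds.
  set Z : Set ℝ := {t ∈ Set.Icc 0 T | ε ≤ dist (γ t) x} with hZ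
  have hZne : Z.Nonempty := ⟨T, ⟨hT0.le, le_rfl⟩, by
    rw [h1]; exact not_lt.1 hyb⟩
  have hcont := hγ.continuousOn hT0.le
  have hdist : ContinuousOn (fun t => dist (γ t) x) (Set.Icc 0 T) :=
    (continuous_id.dist continuous_const).comp_continuousOn hcont
  have hZc : IsClosed Z := by
    have := hdist.preimage_isClosed_of_isClosed
      isClosed_Icc (isClosed_Ici (a := ε))
    exact this
  have hZb : BddBelow Z := ⟨0, fun t ht => ht.1.1⟩
  obtain ⟨hs1, hs2⟩ := hZc.csInf_mem hZne hZb
  set s := sInf Z with hs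
  have hlt : ∀ t, 0 ≤ t → t < s → dist (γ t) x < ε := fun t ht0 hts => by
    by_contra hcon
    exact not_lt.2 (csInf_le hZb ⟨⟨ht0, hts.le.trans hs1.2⟩, not_lt.1 hcon⟩) hts
  have hs0 : 0 < s := by
    refine lt_of_le_of_ne hs1.1 fun h => ?_
    rw [← h, h0, dist_self] at hs2
    linarith
  have hle : dist (γ s) x ≤ ε := by
    have hcw : ContinuousWithinAt (fun t => dist (γ t) x) (Set.Ico 0 s) s :=
      (hdist s hs1).mono
        fun t ht => ⟨ht.1, ht.2.le.trans hs1.2⟩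
    have : (𝓝[Set.Ico 0 s] s).NeBot := by
      rw [← mem_closure_iff_nhdsWithin_neBot, closure_Ico hs0.ne]; exact ⟨hs0.le, le_rfl⟩
    exact le_of_tendsto hcw (eventually_nhdsWithin_of_forall fun t ht => (hlt t ht.1 ht.2).le)
  have hin : ∀ t ∈ Set.Icc 0 s, ∑ j, ‖X j (γ t)‖ ≤ max M 1 := fun t ht => by
    refine hM' _ ?_
    rcases ht.2.eq_or_lt with h | h
    · rw [h]; exact hle
    · exact (hlt t ht.1 h).le
  have := hγ.norm_sub_le le_rfl hs0.le hs1.2 hin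
  rw [h0, ← dist_eq_norm, sub_zero] at this
  rw [lt_div_iff₀ hM0] at hT
  nlinarith [hs1.2]

lemma ballX_mono {x : E N} {r s : ℝ} (h : r ≤ s) : ballX X U x r ⊆ ballX X U x s :=
  fun _ hy => ⟨hy.1, hy.2.trans_le h⟩

lemma mem_ballX_self {x : E N} (hx : x ∈ U) {r : ℝ} (hr : 0 < r) : x ∈ ballX X U x r :=
  ⟨hx, by rwa [dX_self hx]⟩

lemma iUnion_ballX {x : E N} : ⋃ n : ℕ, ballX X U x n = U := by
  ext y
  simp only [Set.mem_iUnion]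
  exact ⟨fun ⟨_, h⟩ => h.1, fun h => (exists_nat_gt (dX X U x y)).imp fun n hn => ⟨h, hn⟩⟩

/-! ### Topology and volume of the control balls. -/

namespace Admissible

variable {Q : ℝ}

lemma ballX_subset (hX : Admissible X U Q) {x y : E N} (hx : x ∈ U) (hy : y ∈ U) {r s : ℝ}
    (h : dX X U y x + r ≤ s) : ballX X U x r ⊆ ballX X U y s := fun z hz =>
  ⟨hz.1, by linarith [dX_triangle hX.lipschitz hX.connected hy hx hz.1, hz.2]⟩

/-- By the triangle inequality `|d(a,b) - d(x,y)| ≤ d(x,a) + d(y,b)`, and both terms tend to zero by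
the comparison with the Euclidean topology. -/
lemma continuousOn_dX (hX : Admissible X U Q) :
    ContinuousOn (fun p : E N × E N => dX X U p.1 p.2) (U ×ˢ U) := by
  rintro ⟨x, y⟩ ⟨hx, hy⟩
  simp only at hx hy
  have h1 : Tendsto (fun p : E N × E N => dX X U x p.1) (𝓝[U ×ˢ U] (x, y)) (𝓝 0) := by
    refine (hX.euclidean x hx).comp ?_
    rw [nhdsWithin_prod_eq]; exact tendsto_fst
  have h2 : Tendsto (fun p : E N × E N => dX X U y p.2) (𝓝[U ×ˢ U] (x, y)) (𝓝 0) := by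
    refine (hX.euclidean y hy).comp ?_
    rw [nhdsWithin_prod_eq]; exact tendsto_snd
  have h3 := h1.add h2
  rw [add_zero] at h3
  refine tendsto_iff_dist_tendsto_zero.2 (squeeze_zero' (.of_forall fun _ => dist_nonneg) ?_ h3)
  filter_upwards [self_mem_nhdsWithin] with ⟨a, b⟩ ⟨ha, hb⟩
  simp only at ha hb ⊢
  have t := @dX_triangle N m X U hX.lipschitz hX.connected
  have c := @dX_comm N m X U hX.lipschitz
  rw [Real.dist_eq, abs_le]
  constructor
  · linarith [t hx ha hy, t ha hb hy, c b y]
  · linarith [t ha hx hb, t hx hy hb, c a x]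

lemma isOpen_setOf_dX_lt (hX : Admissible X U Q) (hU : IsOpen U) (r : ℝ) :
    IsOpen {p : E N × E N | p.1 ∈ U ∧ p.2 ∈ U ∧ dX X U p.1 p.2 < r} := by
  have := hX.continuousOn_dX.isOpen_inter_preimage (hU.prod hU) (isOpen_Iio (a := r))
  convert this using 1
  ext p
  simp [and_assoc]

lemma isOpen_ballX (hX : Admissible X U Q) (hU : IsOpen U) {x : E N} (hx : x ∈ U) (r : ℝ) :
    IsOpen (ballX X U x r) := by
  have := (hX.isOpen_setOf_dX_lt hU r).preimage (Continuous.prodMk_right x)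
  convert this using 1
  ext y
  simp [ballX, hx]

lemma volume_ballX_pos (hX : Admissible X U Q) {x : E N} (hx : x ∈ U) {r : ℝ} (hr : 0 < r) :
    0 < volume (ballX X U x r) := by
  have := (hX.doubling x hx (r / 2) (by positivity)).1
  rwa [mul_div_cancel₀ _ two_ne_zero] at this

lemma volume_ballX_two_pow_mul_le (hX : Admissible X U Q) {x : E N} (hx : x ∈ U) {r : ℝ}
    (hr : 0 < r) (k : ℕ) :
    volume (ballX X U x (2 ^ k * r)) ≤ ENNReal.ofReal ((2 : ℝ) ^ Q) ^ k * volume (ballX X U x r) := by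
  induction k with
  | zero => simp
  | succ k ih =>
    rw [pow_succ', mul_assoc, pow_succ', mul_assoc]
    exact (hX.doubling x hx _ (by positivity)).2.trans (by gcongr)

/-- A small control ball lies in a Euclidean ball, and doubling carries finiteness to every radius.
-/
lemma volume_ballX_lt_top (hX : Admissible X U Q) {x : E N} (hx : x ∈ U) (r : ℝ) :
    volume (ballX X U x r) < ⊤ := by
  obtain ⟨ρ, hρ, hsub⟩ := exists_ballX_subset_ball hX.lipschitz hX.connected hx one_pos
  obtain ⟨k, hk⟩ := pow_unbounded_of_one_lt (r / ρ) one_lt_two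
  rw [div_lt_iff₀ hρ] at hk
  refine (measure_mono (ballX_mono hk.le)).trans_lt
    ((hX.volume_ballX_two_pow_mul_le hx hρ k).trans_lt (ENNReal.mul_lt_top (by simp) ?_))
  exact (measure_mono hsub).trans_lt measure_ball_lt_top

lemma volume_real_ballX_pos (hX : Admissible X U Q) {x : E N} (hx : x ∈ U) {r : ℝ} (hr : 0 < r) :
    0 < volume.real (ballX X U x r) :=
  ENNReal.toReal_pos (hX.volume_ballX_pos hx hr).ne' (hX.volume_ballX_lt_top hx r).ne

lemma volume_real_ballX_two_pow_mul_le (hX : Admissible X U Q) {x : E N} (hx : x ∈ U) {r : ℝ}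
    (hr : 0 < r) (k : ℕ) :
    volume.real (ballX X U x (2 ^ k * r)) ≤ ((2 : ℝ) ^ Q) ^ k * volume.real (ballX X U x r) := by
  have := ENNReal.toReal_mono (ENNReal.mul_lt_top (by simp) (hX.volume_ballX_lt_top hx r)).ne
    (hX.volume_ballX_two_pow_mul_le hx hr k)
  rwa [ENNReal.toReal_mul, ENNReal.toReal_pow, ENNReal.toReal_ofReal (by positivity)] at this

end Admissible

end XElliptic

namespace XElliptic

/-! ### The maximal function along a sequence of radii -/

variable {N m : ℕ} {X : Fields N m} {U : Set (E N)}

/-- The mean of `g` over the control ball of centre `x` and radius `r`. -/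
noncomputable def ballAverage (X : Fields N m) (U : Set (E N)) (g : E N → ℝ≥0∞) (r : ℝ) (x : E N) :
    ℝ≥0∞ :=
  (∫⁻ y in ballX X U x r, g y) / volume (ballX X U x r)

/-- The maximal function of `g` along the radii `ρ k`. -/
noncomputable def maximal (X : Fields N m) (U : Set (E N)) (ρ : ℕ → ℝ) (g : E N → ℝ≥0∞) (x : E N) :
    ℝ≥0∞ :=
  ⨆ k, ballAverage X U g (ρ k) x

namespace Admissible

variable {Q : ℝ}

lemma measurableSet_ballX (hX : Admissible X U Q) (hU : IsOpen U) {x : E N} (hx : x ∈ U) (r : ℝ) :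
    MeasurableSet (ballX X U x r) := (hX.isOpen_ballX hU hx r).measurableSet

/-- The relation `d_X(x, y) < r` is open in both variables jointly, so Tonelli's theorem gives
measurability in the centre. It is relative to `U` because `d_X` is controlled only there. -/
lemma aemeasurable_lintegral_ballX (hX : Admissible X U Q) (hU : IsOpen U) {g : E N → ℝ≥0∞}
    (hg : Measurable g) (r : ℝ) :
    AEMeasurable (fun x => ∫⁻ y in ballX X U x r, g y) (volume.restrict U) := by
  set S := {p : E N × E N | p.1 ∈ U ∧ p.2 ∈ U ∧ dX X U p.1 p.2 < r}
  have hS : MeasurableSet S := (hX.isOpen_setOf_dX_lt hU r).measurableSet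
  have hm : Measurable fun x => ∫⁻ y, S.indicator (fun p => g p.2) (x, y) :=
    ((hg.comp measurable_snd).indicator hS).lintegral_prod_right'
  refine ⟨_, hm, ?_⟩
  refine (ae_restrict_iff' hU.measurableSet).2 (ae_of_all _ fun x hx => ?_)
  dsimp only
  rw [← lintegral_indicator (hX.measurableSet_ballX hU hx r)]
  refine lintegral_congr fun y => ?_
  by_cases h : y ∈ ballX X U x r
  · rw [Set.indicator_of_mem h, Set.indicator_of_mem (show (x, y) ∈ S from ⟨hx, h.1, h.2⟩)]
  · rw [Set.indicator_of_notMem h, Set.indicator_of_notMem fun h' : (x, y) ∈ S => h h'.2]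

lemma aemeasurable_maximal (hX : Admissible X U Q) (hU : IsOpen U) {g : E N → ℝ≥0∞}
    (hg : Measurable g) (ρ : ℕ → ℝ) : AEMeasurable (maximal X U ρ g) (volume.restrict U) := by
  refine AEMeasurable.iSup fun k => (hX.aemeasurable_lintegral_ballX hU hg _).div ?_
  simpa using hX.aemeasurable_lintegral_ballX hU (g := fun _ => 1) measurable_const (ρ k)

lemma ballAverage_add_le (g h : E N → ℝ≥0∞) (hg : Measurable g) (r : ℝ) (x : E N) :
    ballAverage X U (fun y => g y + h y) r x = ballAverage X U g r x + ballAverage X U h r x := by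
  rw [ballAverage, lintegral_add_left hg, ENNReal.add_div]; rfl

lemma ballAverage_le_of_le {g : E N → ℝ≥0∞} {c : ℝ≥0∞} (h : ∀ y, g y ≤ c)
    (r : ℝ) (x : E N) : ballAverage X U g r x ≤ c := by
  refine ENNReal.div_le_of_le_mul ?_
  calc ∫⁻ y in ballX X U x r, g y ≤ ∫⁻ y in ballX X U x r, c := lintegral_mono h
    _ = c * volume (ballX X U x r) := by simp

/-- The weak type `(1,1)` estimate. -/
lemma volume_lt_maximal_le (hX : Admissible X U Q) (hU : IsOpen U) {ρ : ℕ → ℝ} {R : ℝ}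
    (hρ : ∀ k, 0 < ρ k) (hρR : ∀ k, ρ k ≤ R) (g : E N → ℝ≥0∞) {l : ℝ≥0∞} (hl : l ≠ 0)
    (hl' : l ≠ ⊤) :
    volume {x ∈ U | l < maximal X U ρ g x} ≤
      ENNReal.ofReal ((2 : ℝ) ^ Q) ^ 3 / l * ∫⁻ y in U, g y := by
  set B : E N × ℕ → Set (E N) := fun a => ballX X U a.1 (ρ a.2)
  set t : Set (E N × ℕ) := {a | a.1 ∈ U ∧ l * volume (B a) ≤ ∫⁻ y in B a, g y} with ht
  have htU : ∀ a ∈ t, a.1 ∈ U := fun a ha => ha.1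
  -- Each ball of `t` meets a selected ball of at least half its radius. Its centre is therefore
  -- within `ρ + 2ρ < 2^3 ρ` of the selected centre, which costs three doublings.
  obtain ⟨u, hut, hdis, hcov⟩ := Vitali.exists_disjoint_subfamily_covering_enlargement B t
    (fun a => ρ a.2) 2 one_lt_two (fun a _ => (hρ _).le) R (fun a _ => hρR _)
    (fun a ha => ⟨a.1, mem_ballX_self (htU a ha) (hρ _)⟩)
  have hmeas : ∀ a ∈ u, MeasurableSet (B a) := fun a ha =>
    hX.measurableSet_ballX hU (htU a (hut ha)) _
  have hu : u.Countable := hdis.countable_of_isOpen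
    (fun a ha => hX.isOpen_ballX hU (htU a (hut ha)) _)
    (fun a ha => ⟨a.1, mem_ballX_self (htU a (hut ha)) (hρ _)⟩)
  have hsub : {x ∈ U | l < maximal X U ρ g x} ⊆ ⋃ b ∈ u, ballX X U b.1 (2 ^ 3 * ρ b.2) := by
    rintro x ⟨hxU, hx⟩
    obtain ⟨k, hk⟩ := lt_iSup_iff.1 hx
    have hxt : (x, k) ∈ t := by
      refine ⟨hxU, ?_⟩
      exact (ENNReal.le_div_iff_mul_le (.inl (hX.volume_ballX_pos hxU (hρ k)).ne')
        (.inl (hX.volume_ballX_lt_top hxU _).ne)).1 hk.le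
    obtain ⟨b, hb, ⟨w, hw1, hw2⟩, hδ⟩ := hcov _ hxt
    simp only at hδ
    refine Set.mem_biUnion hb ⟨hxU, ?_⟩
    have hbU := htU b (hut hb)
    have h1 := dX_triangle hX.lipschitz hX.connected hbU hw1.1 hxU
    rw [dX_comm hX.lipschitz w x] at h1
    have h2 := hw1.2
    have h3 := hw2.2
    simp only at h2 h3
    nlinarith [hρ b.2]
  calc volume {x ∈ U | l < maximal X U ρ g x}
      ≤ volume (⋃ b ∈ u, ballX X U b.1 (2 ^ 3 * ρ b.2)) := measure_mono hsub
    _ ≤ ∑' b : u, volume (ballX X U b.1.1 (2 ^ 3 * ρ b.1.2)) := measure_biUnion_le _ hu _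
    _ ≤ ∑' b : u, ENNReal.ofReal ((2 : ℝ) ^ Q) ^ 3 / l * ∫⁻ y in B b, g y := by
        refine ENNReal.tsum_le_tsum fun b => ?_
        have hb := hut b.2
        refine (hX.volume_ballX_two_pow_mul_le hb.1 (hρ _) 3).trans ?_
        rw [ENNReal.div_eq_inv_mul, mul_comm _ (_ ^ 3), mul_assoc]
        gcongr
        rw [← ENNReal.div_eq_inv_mul, ENNReal.le_div_iff_mul_le (.inl hl) (.inl hl'), mul_comm]
        exact hb.2
    _ = ENNReal.ofReal ((2 : ℝ) ^ Q) ^ 3 / l * ∫⁻ y in ⋃ b ∈ u, B b, g y := by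
        rw [ENNReal.tsum_mul_left, lintegral_biUnion hu hmeas hdis]
    _ ≤ _ := by
        gcongr
        exact Set.iUnion₂_subset fun b _ y hy => hy.1

/-- The strong type `(2,2)` estimate. -/
lemma lintegral_maximal_sq_le (hX : Admissible X U Q) (hU : IsOpen U) {ρ : ℕ → ℝ} {R : ℝ}
    (hρ : ∀ k, 0 < ρ k) (hρR : ∀ k, ρ k ≤ R) {g : E N → ℝ≥0∞} (hg : Measurable g) {c : ℝ≥0∞}
    (hc : c ≠ ⊤) (hgc : ∀ y, g y ≤ c) :
    ∫⁻ x in U, maximal X U ρ g x ^ 2 ≤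
      8 * ENNReal.ofReal ((2 : ℝ) ^ Q) ^ 3 * ∫⁻ x in U, g x ^ 2 := by
  set A := ENNReal.ofReal ((2 : ℝ) ^ Q) ^ 3 with hA
  set M := maximal X U ρ g with hM
  have hMc : ∀ x, M x ≤ c := fun x => iSup_le fun k => ballAverage_le_of_le hgc _ _
  have hMt : ∀ x, M x ≠ ⊤ := fun x => ne_top_of_le_ne_top hc (hMc x)
  have hgt : ∀ x, g x ≠ ⊤ := fun x => ne_top_of_le_ne_top hc (hgc x)
  have hMm := hX.aemeasurable_maximal hU hg ρ
  have h1 : ∫⁻ x in U, M x ^ 2 = ∫⁻ x in U, ENNReal.ofReal ((M x).toReal ^ (2 : ℝ)) := by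
    refine lintegral_congr fun x => ?_
    rw [Real.rpow_two, ENNReal.ofReal_pow ENNReal.toReal_nonneg, ENNReal.ofReal_toReal (hMt x)]
  rw [h1, lintegral_rpow_eq_lintegral_meas_lt_mul _ (ae_of_all _ fun x => ENNReal.toReal_nonneg)
    hMm.ennreal_toReal two_pos]
  -- The part of `g` above height `s / 2`; the rest contributes at most `s / 2` to the maximal
  -- function, so the weak estimate at level `s / 2` need only be applied to `gt s`.
  set gt : ℝ → E N → ℝ≥0∞ := fun s => {y | ENNReal.ofReal (s / 2) < g y}.indicator g with hgt_def
  have hlev : ∀ s ∈ Set.Ioi (0 : ℝ), (volume.restrict U) {a | s < (M a).toReal} *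
      ENNReal.ofReal (s ^ ((2 : ℝ) - 1)) ≤ 2 * A * ∫⁻ y in U, gt s y := by
    intro s hs
    have hs : 0 < s := hs
    have hs2 : ENNReal.ofReal (s / 2) ≠ 0 := by simpa using hs
    have hsub : {a | s < (M a).toReal} ∩ U ⊆
        {x ∈ U | ENNReal.ofReal (s / 2) < maximal X U ρ (gt s) x} := by
      rintro x ⟨hx, hxU⟩
      refine ⟨hxU, ?_⟩
      have hx' : ENNReal.ofReal s < M x := (ENNReal.ofReal_lt_iff_lt_toReal hs.le (hMt x)).2 hx
      have hle : M x ≤ ENNReal.ofReal (s / 2) + maximal X U ρ (gt s) x := by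
        refine iSup_le fun k => ?_
        calc ballAverage X U g (ρ k) x
            ≤ ballAverage X U (fun y => ENNReal.ofReal (s / 2) + gt s y) (ρ k) x := by
              refine ENNReal.div_le_div_right (lintegral_mono fun y => ?_) _
              by_cases hy : ENNReal.ofReal (s / 2) < g y
              · simp [hgt_def, hy]
              · simp [hgt_def, hy, not_lt.1 hy]
          _ ≤ ENNReal.ofReal (s / 2) + ballAverage X U (gt s) (ρ k) x := by
              rw [ballAverage_add_le _ _ measurable_const]
              gcongr
              exact ballAverage_le_of_le (fun _ => le_rfl) _ _
          _ ≤ _ := by gcongr; exact le_iSup (fun k => ballAverage X U (gt s) (ρ k) x) k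
      have h2 : ENNReal.ofReal s = ENNReal.ofReal (s / 2) + ENNReal.ofReal (s / 2) := by
        rw [← ENNReal.ofReal_add (by positivity) (by positivity), add_halves]
      rw [h2] at hx'
      exact (ENNReal.add_lt_add_iff_left ENNReal.ofReal_ne_top).1 (hx'.trans_le hle)
    have hvol := (measure_mono hsub).trans
      (hX.volume_lt_maximal_le hU hρ hρR (gt s) hs2 ENNReal.ofReal_ne_top)
    rw [Measure.restrict_apply' hU.measurableSet]
    calc volume ({a | s < (M a).toReal} ∩ U) * ENNReal.ofReal (s ^ ((2 : ℝ) - 1))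
        ≤ (A / ENNReal.ofReal (s / 2) * ∫⁻ y in U, gt s y) * (2 * ENNReal.ofReal (s / 2)) := by
          gcongr
          rw [show (2 : ℝ) - 1 = 1 by norm_num, Real.rpow_one,
            show (2 : ℝ≥0∞) = ENNReal.ofReal 2 by simp, ← ENNReal.ofReal_mul two_pos.le]
          gcongr; linarith
      _ = 2 * (A / ENNReal.ofReal (s / 2) * ENNReal.ofReal (s / 2)) * ∫⁻ y in U, gt s y := by ring
      _ = _ := by rw [ENNReal.div_mul_cancel hs2 ENNReal.ofReal_ne_top]
  have hmeas : Measurable fun p : ℝ × E N => gt p.1 p.2 := by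
    have : MeasurableSet {p : ℝ × E N | ENNReal.ofReal (p.1 / 2) < g p.2} :=
      measurableSet_lt (by fun_prop) (hg.comp measurable_snd)
    exact (hg.comp measurable_snd).indicator this
  calc ENNReal.ofReal 2 * ∫⁻ s in Set.Ioi (0 : ℝ), (volume.restrict U) {a | s < (M a).toReal} *
        ENNReal.ofReal (s ^ ((2 : ℝ) - 1))
      ≤ ENNReal.ofReal 2 * ∫⁻ s in Set.Ioi (0 : ℝ), 2 * A * ∫⁻ y in U, gt s y := by
        gcongr 1
        exact setLIntegral_mono' measurableSet_Ioi hlev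
    _ = 4 * A * ∫⁻ s in Set.Ioi (0 : ℝ), ∫⁻ y in U, gt s y := by
        rw [lintegral_const_mul' _ _ (by simp [hA, ENNReal.mul_eq_top]), ← mul_assoc]
        congr 1
        rw [← mul_assoc]; congr 1
        simp; norm_num
    _ = 4 * A * ∫⁻ y in U, ∫⁻ s in Set.Ioi (0 : ℝ), gt s y := by
        rw [lintegral_lintegral_swap hmeas.aemeasurable]
    -- For fixed `y` the integrand equals `g y` for `s < 2 g y` and vanishes beyond, so the
    -- `s`-integral is at most `2 (g y)²`.
    _ ≤ 4 * A * ∫⁻ y in U, 2 * g y ^ 2 := by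
        gcongr with y
        have hle : ∀ s, (Set.Ioi (0 : ℝ)).indicator (fun s => gt s y) s ≤
            (Set.Ioo 0 (2 * (g y).toReal)).indicator (fun _ => g y) s := by
          intro s
          by_cases h0 : 0 < s
          · rw [Set.indicator_of_mem (show s ∈ Set.Ioi (0 : ℝ) from h0)]
            by_cases h : ENNReal.ofReal (s / 2) < g y
            · have : s < 2 * (g y).toReal := by
                have := (ENNReal.ofReal_lt_iff_lt_toReal (by positivity) (hgt y)).1 h
                linarith
              rw [Set.indicator_of_mem (show s ∈ Set.Ioo 0 (2 * (g y).toReal) from ⟨h0, this⟩)]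
              exact Set.indicator_le_self _ _ _
            · simp [hgt_def, Set.indicator, h]
          · simp [Set.indicator, h0]
        rw [← lintegral_indicator measurableSet_Ioi]
        refine (lintegral_mono hle).trans_eq ?_
        rw [lintegral_indicator measurableSet_Ioo, setLIntegral_const, Real.volume_Ioo, sub_zero,
          ENNReal.ofReal_mul two_pos.le, ENNReal.ofReal_toReal (hgt y)]
        simp; ring
    _ = _ := by
        rw [lintegral_const_mul' _ _ (by simp), ← mul_assoc]
        congr 1; ring

end Admissible

end XElliptic

namespace XElliptic

variable {N m : ℕ} {X : Fields N m} {U Ω : Set (E N)} {Q : ℝ}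

/-! ### The horizontal gradient of a test function -/

lemma gradX_eq_zero_of_notMem_tsupport {φ : E N → ℝ} {x : E N} (hx : x ∉ tsupport φ) :
    gradX X φ x = 0 := by
  have : fderiv ℝ φ x = 0 := by
    by_contra h
    exact hx (support_fderiv_subset ℝ h)
  ext j
  simp [gradX, this]

lemma continuous_gradX (hX : ∀ j, LocallyLipschitz (X j)) {φ : E N → ℝ} (hφ : ContDiff ℝ 1 φ) :
    Continuous (gradX X φ) := by
  have h1 : Continuous (fderiv ℝ φ) := hφ.continuous_fderiv one_ne_zero
  refine (PiLp.continuous_toLp 2 _).comp (continuous_pi fun j => ?_)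
  exact h1.clm_apply (hX j).continuous

namespace IsTest

variable {φ : E N → ℝ}

lemma contDiff_one (h : IsTest Ω φ) : ContDiff ℝ 1 φ := h.1.of_le (by exact_mod_cast le_top)

lemma hasCompactSupport_gradX (h : IsTest Ω φ) : HasCompactSupport (gradX X φ) :=
  HasCompactSupport.intro h.2.1 fun _ hx => gradX_eq_zero_of_notMem_tsupport hx

lemma integrable (h : IsTest Ω φ) : Integrable φ :=
  h.1.continuous.integrable_of_hasCompactSupport h.2.1

lemma integrable_norm_gradX (hX : ∀ j, LocallyLipschitz (X j)) (h : IsTest Ω φ) :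
    Integrable fun x => ‖gradX X φ x‖ :=
  ((continuous_gradX hX h.contDiff_one).integrable_of_hasCompactSupport
    h.hasCompactSupport_gradX).norm

lemma eq_zero_of_notMem (h : IsTest Ω φ) {x : E N} (hx : x ∉ Ω) : φ x = 0 :=
  image_eq_zero_of_notMem_tsupport fun h' => hx (h.2.2 h')

lemma gradX_eq_zero_of_notMem (h : IsTest Ω φ) {x : E N} (hx : x ∉ Ω) : gradX X φ x = 0 :=
  gradX_eq_zero_of_notMem_tsupport fun h' => hx (h.2.2 h')

end IsTest

namespace Admissible

/-! ### Boundedness of `Ω` in the control distance -/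

/-- If `B_n(x)` fills almost all of `U`, no point can be far away: a ball around such a point would
be disjoint from `B_n(x)`, yet by doubling would carry a fixed fraction of its volume. -/
lemma exists_dX_lt_of_volume_lt_top (hX : Admissible X U Q) (hU : IsOpen U) (hfin : volume U < ⊤)
    {x : E N} (hx : x ∈ U) : ∃ D > 0, ∀ y ∈ U, dX X U x y < D := by
  -- Two doublings lead from `B_{ρ/2}(y)` to `B_{2ρ}(y)`, which contains `B_n(x)` when `ρ = d_X(x,
  -- y) ≥ 2n`.
  set a : ℝ := ((2 : ℝ) ^ Q) ^ 2 with ha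
  have ha0 : 0 < a := by positivity
  have hU0 : 0 < volume.real U :=
    ENNReal.toReal_pos (hU.measure_pos volume ⟨x, hx⟩).ne' hfin.ne
  have hlim : Tendsto (fun n : ℕ => volume.real (ballX X U x n)) atTop (𝓝 (volume.real U)) := by
    have hmono : Monotone fun n : ℕ => ballX X U x n := fun i j hij =>
      ballX_mono (by exact_mod_cast hij)
    have := tendsto_measure_iUnion_atTop (μ := volume) hmono
    rw [iUnion_ballX] at this
    exact (ENNReal.tendsto_toReal hfin.ne).comp this
  have hlt : volume.real U * (a / (a + 1)) < volume.real U :=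
    mul_lt_of_lt_one_right hU0 (by rw [div_lt_one (by positivity)]; linarith)
  obtain ⟨n, hn, hn1⟩ := ((hlim.eventually (lt_mem_nhds hlt)).and (eventually_ge_atTop 1)).exists
  have hn1' : (1 : ℝ) ≤ n := by exact_mod_cast hn1
  refine ⟨2 * n, by positivity, fun y hy => ?_⟩
  by_contra hcon
  set ρ := dX X U x y with hρ
  have hρn : 2 * (n : ℝ) ≤ ρ := not_lt.1 hcon
  have hρ0 : 0 < ρ / 2 := by linarith
  have h1 : volume.real (ballX X U x n) ≤ a * volume.real (ballX X U y (ρ / 2)) := by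
    refine le_trans ?_ (hX.volume_real_ballX_two_pow_mul_le hy hρ0 2)
    refine ENNReal.toReal_mono (hX.volume_ballX_lt_top hy _).ne (measure_mono ?_)
    refine hX.ballX_subset hx hy ?_
    rw [dX_comm hX.lipschitz y x]
    linarith
  have hdisj : Disjoint (ballX X U x n) (ballX X U y (ρ / 2)) := by
    refine Set.disjoint_left.2 fun w hw hw' => ?_
    have := dX_triangle hX.lipschitz hX.connected hx hw.1 hy
    rw [dX_comm hX.lipschitz w y] at this
    linarith [hw.2, hw'.2]
  have h2 : volume.real (ballX X U x n) + volume.real (ballX X U y (ρ / 2)) ≤ volume.real U := by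
    rw [← measureReal_union hdisj (hX.measurableSet_ballX hU hy _)
      (hX.volume_ballX_lt_top hx _).ne (hX.volume_ballX_lt_top hy _).ne]
    exact measureReal_mono (Set.union_subset (fun _ h => h.1) fun _ h => h.1) hfin.ne
  -- `h1` and `h2` give `|B_n(x)| (1 + 1/a) ≤ |U|`, against the choice of `n`.
  rw [mul_div_assoc', div_lt_iff₀ (by positivity)] at hn
  nlinarith

lemma exists_dX_lt_of_isCompact (hX : Admissible X U Q) {K : Set (E N)} (hK : IsCompact K)
    (hKU : K ⊆ U) {x : E N} (hx : x ∈ U) : ∃ D > 0, ∀ y ∈ K, dX X U x y < D := by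
  have hc : ContinuousOn (fun y => dX X U x y) K := by
    have : ContinuousOn (fun y : E N => ((x, y) : E N × E N)) K := by fun_prop
    exact hX.continuousOn_dX.comp this fun y hy => ⟨hx, hKU hy⟩
  obtain ⟨D, hD⟩ := hK.bddAbove_image hc
  exact ⟨max D 0 + 1, by positivity, fun y hy => by
    linarith [hD ⟨y, hy, rfl⟩, le_max_left D 0]⟩

lemma exists_dX_lt (hX : Admissible X U Q) (hU : IsOpen U) (hΩ : Bornology.IsBounded Ω)
    (hΩU : U = Ω ∨ closure Ω ⊆ U) {x : E N} (hx : x ∈ U) :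
    ∃ D > 0, ∀ y ∈ Ω, dX X U x y < D := by
  rcases hΩU with rfl | h
  · exact hX.exists_dX_lt_of_volume_lt_top hU hΩ.measure_lt_top hx
  · obtain ⟨D, hD, H⟩ := hX.exists_dX_lt_of_isCompact hΩ.isCompact_closure h hx
    exact ⟨D, hD, fun y hy => H y (subset_closure hy)⟩

/-! ### The Friedrichs inequality -/

/-- For one fixed ball the normalising volumes can be absorbed in the constant, and the gradient
integral is enlarged to the whole space. -/
lemma exists_integral_sub_average_le (hX : Admissible X U Q) {x : E N}
    (hx : x ∈ U) {R : ℝ} (hR : 0 < R) : ∃ C ≥ 0, ∀ φ : E N → ℝ, IsTest Ω φ →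
      ∫ y in ballX X U x R, |φ y - ⨍ z in ballX X U x R, φ z| ≤ C * ∫ y, ‖gradX X φ y‖ := by
  obtain ⟨CP, ν, hCP, hν, H⟩ := hX.poincare
  have hB := hX.volume_real_ballX_pos hx hR
  have hB' := hX.volume_real_ballX_pos hx (mul_pos hν hR)
  refine ⟨volume.real (ballX X U x R) * (CP * R * (volume.real (ballX X U x (ν * R)))⁻¹),
    by positivity, fun φ hφ => ?_⟩
  have h := H x hx R hR φ hφ.contDiff_one hφ.2.1
  rw [setAverage_eq, setAverage_eq volume _ (ballX X U x (ν * R)), smul_eq_mul, smul_eq_mul,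
    inv_mul_le_iff₀ hB] at h
  refine h.trans ?_
  rw [mul_assoc (volume.real _) (CP * R * _), mul_assoc (CP * R)]
  gcongr
  · exact Eventually.of_forall fun y => norm_nonneg _
  · exact hφ.integrable_norm_gradX hX.lipschitz
  · exact Measure.restrict_le_self

/-- A bound for the mean of the test functions over a control ball containing `Ω` gives the
Friedrichs inequality. -/
lemma friedrichs_of_average (hX : Admissible X U Q) {x : E N} (hx : x ∈ U) {R : ℝ}
    (hΩR : Ω ⊆ ballX X U x R) {C₁ C₂ : ℝ} (hC₁ : 0 ≤ C₁) (hC₂ : 0 ≤ C₂)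
    (H₁ : ∀ φ : E N → ℝ, IsTest Ω φ →
      ∫ y in ballX X U x R, |φ y - ⨍ z in ballX X U x R, φ z| ≤ C₁ * ∫ y, ‖gradX X φ y‖)
    (H₂ : ∀ φ : E N → ℝ, IsTest Ω φ →
      |⨍ z in ballX X U x R, φ z| ≤ C₂ * ∫ y, ‖gradX X φ y‖) :
    ∃ C ≥ 0, ∀ φ : E N → ℝ, IsTest Ω φ → ∫ y, |φ y| ≤ C * ∫ y, ‖gradX X φ y‖ := by
  set B := ballX X U x R
  have hBt := hX.volume_ballX_lt_top hx R
  refine ⟨C₁ + volume.real B * C₂, by positivity, fun φ hφ => ?_⟩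
  set c := ⨍ z in B, φ z
  have hint : IntegrableOn (fun y => |φ y - c|) B :=
    (hφ.integrable.integrableOn.sub (integrableOn_const hBt.ne)).abs
  calc ∫ y, |φ y| = ∫ y in B, |φ y| := by
        refine (setIntegral_eq_integral_of_forall_compl_eq_zero fun y hy => ?_).symm
        rw [hφ.eq_zero_of_notMem fun h => hy (hΩR h), abs_zero]
    _ ≤ ∫ y in B, (|φ y - c| + |c|) := by
        refine integral_mono hφ.integrable.integrableOn.abs
          (hint.add (integrableOn_const hBt.ne)) fun y => ?_
        simpa using abs_add_le (φ y - c) c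
    _ = (∫ y in B, |φ y - c|) + volume.real B * |c| := by
        rw [integral_add hint (integrableOn_const hBt.ne), setIntegral_const, smul_eq_mul]
    _ ≤ C₁ * (∫ y, ‖gradX X φ y‖) + volume.real B * (C₂ * ∫ y, ‖gradX X φ y‖) := by
        gcongr
        · exact H₁ φ hφ
        · exact H₂ φ hφ
    _ = _ := by ring

/-- The mean of `φ` over `B` is controlled by the oscillation if `φ` is small in mean on a subset
`W` of positive measure. -/
lemma abs_average_mul_le {φ : E N → ℝ} (hφ : Integrable φ) {B W : Set (E N)} (hB : volume B ≠ ⊤)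
    (hWB : W ⊆ B) (c : ℝ) :
    |c| * volume.real W ≤ (∫ y in W, |φ y|) + ∫ y in B, |φ y - c| := by
  have hWt : volume W ≠ ⊤ := ne_top_of_le_ne_top hB (measure_mono hWB)
  have hint : IntegrableOn (fun y => |φ y - c|) B :=
    (hφ.integrableOn.sub (integrableOn_const hB)).abs
  calc |c| * volume.real W = ∫ y in W, |c| := by rw [setIntegral_const, smul_eq_mul, mul_comm]
    _ ≤ ∫ y in W, (|φ y| + |φ y - c|) := by
        refine integral_mono (integrableOn_const hWt)
          (hφ.integrableOn.abs.add (hint.mono_set hWB)) fun y => ?_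
        have := abs_sub_abs_le_abs_sub c (φ y)
        rw [abs_sub_comm] at this
        dsimp only
        linarith
    _ = (∫ y in W, |φ y|) + ∫ y in W, |φ y - c| :=
        integral_add hφ.integrableOn.abs (hint.mono_set hWB)
    _ ≤ _ := by
        gcongr
        exact Eventually.of_forall fun y => abs_nonneg _

/-- A control ball containing `Ω` also contains an open set disjoint from `closure Ω`. Test
functions vanish there, so their mean is bounded by their oscillation. -/
lemma friedrichs_of_closure_subset (hX : Admissible X U Q) (hU : IsOpen U) (hN : N ≠ 0)
    (hΩ : Bornology.IsBounded Ω) (hΩU : closure Ω ⊆ U) {x : E N} (hx : x ∈ Ω) :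
    ∃ C ≥ 0, ∀ φ : E N → ℝ, IsTest Ω φ → ∫ y, |φ y| ≤ C * ∫ y, ‖gradX X φ y‖ := by
  have : Nonempty (Fin N) := ⟨⟨0, Nat.pos_of_ne_zero hN⟩⟩
  have hxU : x ∈ U := hΩU (subset_closure hx)
  obtain ⟨D, hD, hDΩ⟩ := hX.exists_dX_lt hU hΩ (.inr hΩU) hxU
  -- Otherwise `U = closure Ω` would be open and closed, hence all of `ℝ^N`, and bounded.
  obtain ⟨z, hzU, hz⟩ : ∃ z ∈ U, z ∉ closure Ω := by
    by_contra! hcon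
    have hcl : IsClopen U := by
      rw [Set.Subset.antisymm hcon hΩU] at hU ⊢
      exact ⟨isClosed_closure, hU⟩
    have huniv : U = Set.univ := hcl.eq_univ ⟨x, hxU⟩
    have hb : Bornology.IsBounded (Set.univ : Set (E N)) :=
      (huniv ▸ hΩ.closure.subset hcon :)
    exact NoncompactSpace.noncompact_univ (X := E N)
      (Metric.isCompact_of_isClosed_isBounded isClosed_univ hb)
  set R := max D (dX X U x z + 1)
  have hR : 0 < R := lt_max_of_lt_left hD
  set B := ballX X U x R with hBdef
  have hΩB : Ω ⊆ B := fun y hy => ⟨hΩU (subset_closure hy), (hDΩ y hy).trans_le (le_max_left _ _)⟩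
  have hzB : z ∈ B := ⟨hzU, lt_max_of_lt_right (lt_add_one _)⟩
  set W := B \ closure Ω with hW
  have hWo : IsOpen W := (hX.isOpen_ballX hU hxU R).sdiff isClosed_closure
  have hBt := hX.volume_ballX_lt_top hxU R
  have hWpos : 0 < volume.real W := ENNReal.toReal_pos
    (hWo.measure_pos volume ⟨z, hzB, hz⟩).ne' (ne_top_of_le_ne_top hBt.ne (measure_mono Set.sdiff_subset))
  obtain ⟨C₁, hC₁, H₁⟩ := hX.exists_integral_sub_average_le (Ω := Ω) hxU hR
  refine hX.friedrichs_of_average hxU hΩB hC₁ (C₂ := C₁ / volume.real W) (by positivity) H₁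
    fun φ hφ => ?_
  have h0 : ∫ y in W, |φ y| = 0 := by
    refine setIntegral_eq_zero_of_forall_eq_zero fun y hy => ?_
    rw [hφ.eq_zero_of_notMem fun h => hy.2 (subset_closure h), abs_zero]
  have := abs_average_mul_le (W := W) hφ.integrable hBt.ne Set.sdiff_subset
    (⨍ z in B, φ z)
  rw [div_mul_eq_mul_div, le_div_iff₀ hWpos]
  refine this.trans ?_
  rw [h0, zero_add]
  exact H₁ φ hφ

end Admissible

end XElliptic

namespace XElliptic

/-! ### Lebesgue measure and Lipschitz maps -/

section Lipschitz

variable {N : ℕ}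

/-- Hausdorff measure has direct bounds under Lipschitz and antilipschitz maps. Passing to it
replaces a Jacobian computation for the Euler maps, which are only Lipschitz. -/
lemma exists_volume_eq_smul_hausdorffMeasure :
    ∃ c : ℝ≥0, (volume : Measure (E N)) = c • (μH[N] : Measure (E N)) :=
  ⟨_, Measure.isAddLeftInvariant_eq_smul _ _⟩

lemma volume_preimage_le_of_antilipschitzWith {G : E N → E N} {K : ℝ≥0}
    (hG : AntilipschitzWith K G) (s : Set (E N)) :
    volume (G ⁻¹' s) ≤ (K : ℝ≥0∞) ^ N * volume s := by
  obtain ⟨c, hc⟩ := exists_volume_eq_smul_hausdorffMeasure (N := N)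
  have := hG.hausdorffMeasure_preimage_le (d := N) (by positivity) s
  rw [ENNReal.rpow_natCast] at this
  rw [hc, Measure.smul_apply, Measure.smul_apply, ENNReal.smul_def, ENNReal.smul_def, smul_eq_mul,
    smul_eq_mul, mul_left_comm]
  gcongr

lemma volume_image_le_of_lipschitzWith {G : E N → E N} {K : ℝ≥0}
    (hG : LipschitzWith K G) (s : Set (E N)) :
    volume (G '' s) ≤ (K : ℝ≥0∞) ^ N * volume s := by
  obtain ⟨c, hc⟩ := exists_volume_eq_smul_hausdorffMeasure (N := N)
  have := hG.hausdorffMeasure_image_le (d := N) (by positivity) s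
  rw [ENNReal.rpow_natCast] at this
  rw [hc, Measure.smul_apply, Measure.smul_apply, ENNReal.smul_def, ENNReal.smul_def, smul_eq_mul,
    smul_eq_mul, mul_left_comm]
  gcongr

lemma integrable_and_integral_comp_le {G : E N → E N} {K : ℝ≥0} (hG : AntilipschitzWith K G)
    (hGc : Continuous G) {g : E N → ℝ} (hg : Integrable g) (hg0 : ∀ y, 0 ≤ g y) :
    Integrable (fun x => g (G x)) ∧ ∫ x, g (G x) ≤ (K : ℝ) ^ N * ∫ x, g x := by
  have hle : Measure.map G volume ≤ (K ^ N : ℝ≥0) • (volume : Measure (E N)) := by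
    refine Measure.le_iff.2 fun s hs => ?_
    rw [Measure.map_apply hGc.measurable hs, Measure.smul_apply, ENNReal.smul_def, smul_eq_mul]
    simpa using volume_preimage_le_of_antilipschitzWith hG s
  have hgs : Integrable g ((K ^ N : ℝ≥0) • (volume : Measure (E N))) := hg.smul_measure_nnreal
  have hgm := hgs.mono_measure hle
  refine ⟨hgm.comp_measurable hGc.measurable, ?_⟩
  rw [← integral_map hGc.aemeasurable hgm.aestronglyMeasurable]
  refine (integral_mono_measure hle (ae_of_all _ hg0) hgs).trans_eq ?_
  rw [integral_smul_nnreal_measure, NNReal.smul_def, smul_eq_mul, NNReal.coe_pow]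

end Lipschitz

/-! ### Euler schemes for controlled fields -/

variable {N m : ℕ}

/-- The field `∑ θ_j Y_j`. -/
noncomputable def control (Y : Fields N m) (θ : Fin m → ℝ) (x : E N) : E N := ∑ j, θ j • Y j x

/-- The flow of the Euler scheme with step `h` and control `θ k` in the `k`-th step. -/
noncomputable def eulerFlow (Y : Fields N m) (h : ℝ) (θ : ℕ → Fin m → ℝ) : ℕ → E N → E N
  | 0, x => x
  | k + 1, x => eulerFlow Y h θ k x + h • control Y (θ k) (eulerFlow Y h θ k x)

section Euler

variable {Y : Fields N m} {K : ℝ≥0}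

lemma norm_control_sub_le (hY : ∀ j, LipschitzWith K (Y j)) {θ : Fin m → ℝ}
    (hθ : ∑ j, θ j ^ 2 ≤ 1) (x y : E N) :
    ‖control Y θ x - control Y θ y‖ ≤ m * K * ‖x - y‖ := by
  rw [control, control, ← Finset.sum_sub_distrib]
  simp_rw [← smul_sub]
  refine (norm_sum_smul_le hθ _).trans ?_
  refine (Finset.sum_le_sum fun j _ => (hY j).norm_sub_le x y).trans_eq ?_
  simp [mul_assoc]

lemma norm_eulerStep_sub_le (hY : ∀ j, LipschitzWith K (Y j)) {θ : Fin m → ℝ}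
    (hθ : ∑ j, θ j ^ 2 ≤ 1) {h : ℝ} (hh : 0 ≤ h) (x y : E N) :
    ‖(x + h • control Y θ x) - (y + h • control Y θ y)‖ ≤ (1 + 2 * (h * (m * K))) * ‖x - y‖ := by
  have h1 : (x + h • control Y θ x) - (y + h • control Y θ y) =
      (x - y) + h • (control Y θ x - control Y θ y) := by rw [smul_sub]; abel
  rw [h1]
  refine (norm_add_le _ _).trans ?_
  rw [norm_smul, Real.norm_of_nonneg hh]
  have := mul_le_mul_of_nonneg_left (norm_control_sub_le hY hθ x y) hh
  have h2 : 0 ≤ h * (m * K * ‖x - y‖) := by positivity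
  nlinarith

/-- With `a = h m K ≤ 1/2` one has `(1 - a)‖x - y‖ ≤ ‖image difference‖` and `(1 + 2a)(1 - a) ≥ 1`.
This is the origin of the factor 2, kept in the forward estimate so that both directions share one
constant. -/
lemma norm_sub_le_eulerStep (hY : ∀ j, LipschitzWith K (Y j)) {θ : Fin m → ℝ}
    (hθ : ∑ j, θ j ^ 2 ≤ 1) {h : ℝ} (hh : 0 ≤ h) (hK : h * (m * K) ≤ 1 / 2) (x y : E N) :
    ‖x - y‖ ≤ (1 + 2 * (h * (m * K))) * ‖(x + h • control Y θ x) - (y + h • control Y θ y)‖ := by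
  have h1 : x - y = ((x + h • control Y θ x) - (y + h • control Y θ y)) -
      h • (control Y θ x - control Y θ y) := by rw [smul_sub]; abel
  set v := (x + h • control Y θ x) - (y + h • control Y θ y)
  have h2 : ‖x - y‖ ≤ ‖v‖ + h * (m * K) * ‖x - y‖ := by
    calc ‖x - y‖ = ‖v - h • (control Y θ x - control Y θ y)‖ := by rw [← h1]
      _ ≤ ‖v‖ + ‖h • (control Y θ x - control Y θ y)‖ := norm_sub_le _ _
      _ ≤ _ := by
        rw [norm_smul, Real.norm_of_nonneg hh, mul_assoc h]
        gcongr
        exact norm_control_sub_le hY hθ x y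
  set a := h * (m * K)
  have ha : 0 ≤ a := by positivity
  have h3 : (1 - a) * ‖x - y‖ ≤ ‖v‖ := by linarith
  have h4 : 1 ≤ (1 + 2 * a) * (1 - a) := by nlinarith
  calc ‖x - y‖ ≤ ((1 + 2 * a) * (1 - a)) * ‖x - y‖ := le_mul_of_one_le_left (norm_nonneg _) h4
    _ = (1 + 2 * a) * ((1 - a) * ‖x - y‖) := by ring
    _ ≤ _ := by gcongr

/-- Solving `x = y - h • control Y θ x` is a fixed point problem for a contraction of ratio `1/2`.
Surjectivity lets a target set be recovered as the image of its preimage. -/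
lemma surjective_eulerStep (hY : ∀ j, LipschitzWith K (Y j)) {θ : Fin m → ℝ}
    (hθ : ∑ j, θ j ^ 2 ≤ 1) {h : ℝ} (hh : 0 ≤ h) (hK : h * (m * K) ≤ 1 / 2) :
    Function.Surjective fun x => x + h • control Y θ x := by
  intro y
  have hc : ContractingWith (1 / 2 : ℝ≥0) fun x => y - h • control Y θ x := by
    refine ⟨by rw [← NNReal.coe_lt_coe]; norm_num, LipschitzWith.of_dist_le_mul fun a b => ?_⟩
    rw [dist_eq_norm, dist_eq_norm, sub_sub_sub_cancel_left, ← smul_sub, norm_smul,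
      Real.norm_of_nonneg hh, norm_sub_rev]
    push_cast
    calc h * ‖control Y θ a - control Y θ b‖ ≤ h * (m * K * ‖a - b‖) := by
          gcongr; exact norm_control_sub_le hY hθ a b
      _ = (h * (m * K)) * ‖a - b‖ := by ring
      _ ≤ _ := by gcongr
  exact ⟨hc.fixedPoint, (sub_eq_iff_eq_add.1 hc.fixedPoint_isFixedPt).symm⟩

variable {θ : ℕ → Fin m → ℝ} {h : ℝ}

lemma norm_eulerFlow_sub_le (hY : ∀ j, LipschitzWith K (Y j)) (hθ : ∀ k, ∑ j, θ k j ^ 2 ≤ 1)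
    (hh : 0 ≤ h) (k : ℕ) (x y : E N) : ‖eulerFlow Y h θ k x - eulerFlow Y h θ k y‖ ≤
      (1 + 2 * (h * (m * K))) ^ k * ‖x - y‖ := by
  induction k with
  | zero => simp [eulerFlow]
  | succ k ih =>
    refine (norm_eulerStep_sub_le hY (hθ k) hh _ _).trans ?_
    rw [pow_succ', mul_assoc]
    gcongr

lemma norm_sub_le_eulerFlow (hY : ∀ j, LipschitzWith K (Y j)) (hθ : ∀ k, ∑ j, θ k j ^ 2 ≤ 1)
    (hh : 0 ≤ h) (hK : h * (m * K) ≤ 1 / 2) (k : ℕ) (x y : E N) : ‖x - y‖ ≤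
      (1 + 2 * (h * (m * K))) ^ k * ‖eulerFlow Y h θ k x - eulerFlow Y h θ k y‖ := by
  induction k with
  | zero => simp [eulerFlow]
  | succ k ih =>
    refine ih.trans ?_
    rw [pow_succ, mul_assoc]
    gcongr
    exact norm_sub_le_eulerStep hY (hθ k) hh hK _ _

lemma surjective_eulerFlow (hY : ∀ j, LipschitzWith K (Y j)) (hθ : ∀ k, ∑ j, θ k j ^ 2 ≤ 1)
    (hh : 0 ≤ h) (hK : h * (m * K) ≤ 1 / 2) (k : ℕ) :
    Function.Surjective (eulerFlow Y h θ k) := by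
  induction k with
  | zero => exact fun y => ⟨y, rfl⟩
  | succ k ih => exact (surjective_eulerStep hY (hθ k) hh hK).comp ih

lemma continuous_eulerFlow (hY : ∀ j, LipschitzWith K (Y j)) (hθ : ∀ k, ∑ j, θ k j ^ 2 ≤ 1)
    (hh : 0 ≤ h) (k : ℕ) : Continuous (eulerFlow Y h θ k) :=
  (LipschitzWith.of_dist_le_mul (K := ((1 + 2 * (h * (m * K))) ^ k).toNNReal) fun x y => by
    rw [Real.coe_toNNReal _ (by positivity), dist_eq_norm, dist_eq_norm]
    exact norm_eulerFlow_sub_le hY hθ hh k x y).continuous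

open scoped Pointwise in
/-- A short piece of a subunit path is a step with a constant control up to a quadratic error. -/
lemma IsSubunit.exists_control {X : Fields N m} {U : Set (E N)} (hY : ∀ j, LipschitzWith K (Y j))
    (hXY : ∀ j, Set.EqOn (X j) (Y j) U) {M : ℝ} (hM : ∀ x ∈ U, ∑ j, ‖X j x‖ ≤ M) {T : ℝ}
    {γ : ℝ → E N} (hγ : IsSubunit X U T γ) {t : ℝ} (hh : 0 < h) (ht : 0 ≤ t) (htT : t + h ≤ T) :
    ∃ ϑ : Fin m → ℝ, ∑ j, ϑ j ^ 2 ≤ 1 ∧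
      ‖γ (t + h) - (γ t + h • control Y ϑ (γ t))‖ ≤ m * K * M * h ^ 2 := by
  have hmem : ∀ s ∈ Set.Icc t (t + h), γ s ∈ U := fun s hs =>
    hγ.2.1 s ⟨ht.trans hs.1, hs.2.trans htT⟩
  have hM0 : 0 ≤ M := (by positivity : 0 ≤ ∑ j, ‖X j (γ t)‖).trans
    (hM _ (hmem t ⟨le_rfl, by linarith⟩))
  let L : E m →ₗ[ℝ] E N :=
    { toFun := fun ϑ => ∑ j, ϑ j • Y j (γ t)
      map_add' := fun a b => by simp [add_smul, Finset.sum_add_distrib]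
      map_smul' := fun c a => by simp [mul_smul, Finset.smul_sum] }
  -- The velocities available at the frozen point `γ t`, thickened by the change of the field along
  -- the piece: `γ` moves by at most `M h`, and controlled fields are `m K`-Lipschitz. The set is
  -- closed and convex, so it contains the mean velocity.
  set S : Set (E N) := L '' Metric.closedBall 0 1 + Metric.closedBall (0 : E N) (m * K * M * h) with hS
  have hSconv : Convex ℝ S :=
    ((convex_closedBall _ _).linear_image L).add (convex_closedBall _ _)
  have hSclosed : IsClosed S :=
    (((isCompact_closedBall (0 : E m) 1).image L.continuous_of_finiteDimensional).add
      (isCompact_closedBall _ _)).isClosed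
  have hmean : (t + h - t)⁻¹ • (γ (t + h) - γ t) ∈ S := by
    have hsub : Set.uIcc t (t + h) ⊆ Set.uIcc 0 T := by
      rw [Set.uIcc_of_le (by linarith), Set.uIcc_of_le (by linarith)]
      exact Set.Icc_subset_Icc ht htT
    refine AbsolutelyContinuousOnInterval.slope_mem (by linarith)
      (AbsolutelyContinuousOnInterval.mono hγ.1 hsub) hSconv hSclosed ?_
    obtain ⟨η, hη⟩ := hγ.2.2
    rw [ae_restrict_iff' measurableSet_Icc] at hη
    filter_upwards [hη] with s hs hsm
    obtain ⟨h1, h2⟩ := hs ⟨ht.trans hsm.1, hsm.2.trans htT⟩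
    refine ⟨_, ?_, h2⟩
    have heq : ∑ j, η s j • X j (γ s) = control Y (η s) (γ s) :=
      Finset.sum_congr rfl fun j _ => by rw [hXY j (hmem s hsm)]
    rw [heq, hS, Set.mem_add]
    refine ⟨control Y (η s) (γ t), ⟨WithLp.toLp 2 (η s), ?_, rfl⟩,
      control Y (η s) (γ s) - control Y (η s) (γ t), ?_, by abel⟩
    · rw [mem_closedBall_zero_iff, EuclideanSpace.norm_eq]
      simpa using h1
    · rw [mem_closedBall_zero_iff]
      refine (norm_control_sub_le hY h1 _ _).trans ?_
      rw [mul_assoc _ M]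
      gcongr
      refine (hγ.norm_sub_le ht hsm.1 (hsm.2.trans htT) fun r hr =>
        hM _ (hmem r ⟨hr.1, hr.2.trans hsm.2⟩)).trans ?_
      gcongr
      linarith [hsm.2]
  rw [add_sub_cancel_left, hS, Set.mem_add] at hmean
  obtain ⟨-, ⟨ϑ, hϑ, rfl⟩, w, hw, hsum⟩ := hmean
  refine ⟨ϑ, ?_, ?_⟩
  · rw [mem_closedBall_zero_iff, EuclideanSpace.norm_eq] at hϑ
    simpa using hϑ
  · have hL : L ϑ = control Y ϑ (γ t) := rfl
    have : γ (t + h) - (γ t + h • control Y ϑ (γ t)) = h • w := by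
      rw [← sub_sub, ← smul_inv_smul₀ hh.ne' (γ (t + h) - γ t), ← hsum, hL, smul_add]
      abel
    rw [this, norm_smul, Real.norm_of_nonneg hh.le]
    rw [mem_closedBall_zero_iff] at hw
    nlinarith

/-- A subunit path is followed by an Euler scheme with constant controls on each step. -/
lemma IsSubunit.exists_eulerFlow {X : Fields N m} {U : Set (E N)}
    (hY : ∀ j, LipschitzWith K (Y j))
    (hXY : ∀ j, Set.EqOn (X j) (Y j) U) {M : ℝ} (hM : ∀ x ∈ U, ∑ j, ‖X j x‖ ≤ M) {T : ℝ}
    {γ : ℝ → E N} (hγ : IsSubunit X U T γ) (hh : 0 < h) {n : ℕ} (hn : n * h ≤ T) :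
    ∃ θ : ℕ → Fin m → ℝ, (∀ k, ∑ j, θ k j ^ 2 ≤ 1) ∧ ∀ k ≤ n,
      ‖eulerFlow Y h θ k (γ 0) - γ (k * h)‖ ≤
        k * (1 + 2 * (h * (m * K))) ^ k * (m * K * M * h ^ 2) := by
  have hex : ∀ k : ℕ, ∃ ϑ : Fin m → ℝ, ∑ j, ϑ j ^ 2 ≤ 1 ∧ (k < n →
      ‖γ (k * h + h) - (γ (k * h) + h • control Y ϑ (γ (k * h)))‖ ≤ m * K * M * h ^ 2) := by
    intro k
    by_cases hk : k < n
    · have hk' : (k : ℝ) + 1 ≤ n := by exact_mod_cast hk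
      obtain ⟨ϑ, h1, h2⟩ := hγ.exists_control hY hXY hM (t := k * h) hh (by positivity)
        (by nlinarith)
      exact ⟨ϑ, h1, fun _ => h2⟩
    · exact ⟨0, by simp, fun h => absurd h hk⟩
  choose θ hθ hstep using hex
  refine ⟨θ, hθ, fun k hk => ?_⟩
  have hM0 : 0 ≤ M := (by positivity : 0 ≤ ∑ j, ‖X j (γ 0)‖).trans
    (hM _ (hγ.2.1 0 ⟨le_rfl, (by positivity : 0 ≤ n * h).trans hn⟩))
  induction k with
  | zero => simp [eulerFlow]
  | succ k ih =>
    have hk' : k < n := hk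
    specialize ih hk'.le
    set A := 1 + 2 * (h * (m * K)) with hA
    have hA1 : 1 ≤ A := by rw [hA]; exact le_add_of_nonneg_right (by positivity)
    have hA2 : 1 ≤ A ^ (k + 1) := one_le_pow₀ hA1
    set e := m * K * M * h ^ 2 with he
    have he0 : 0 ≤ e := by positivity
    have h1 := norm_eulerStep_sub_le hY (hθ k) hh.le (eulerFlow Y h θ k (γ 0)) (γ (k * h))
    rw [← hA] at h1
    have h2 := hstep k hk'
    have hcast : ((k + 1 : ℕ) : ℝ) * h = k * h + h := by push_cast; ring
    rw [hcast]
    -- The old error is magnified by one Euler step and the local error of the new step is added.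
    calc ‖eulerFlow Y h θ (k + 1) (γ 0) - γ (k * h + h)‖
        ≤ ‖eulerFlow Y h θ (k + 1) (γ 0) - (γ (k * h) + h • control Y (θ k) (γ (k * h)))‖ +
          ‖(γ (k * h) + h • control Y (θ k) (γ (k * h))) - γ (k * h + h)‖ :=
          norm_sub_le_norm_sub_add_norm_sub _ _ _
      _ ≤ A * (k * A ^ k * e) + e := by
          refine add_le_add (h1.trans (by gcongr)) ?_
          rwa [norm_sub_rev]
      _ ≤ _ := by
          push_cast
          have : A * (k * A ^ k * e) = k * A ^ (k + 1) * e := by ring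
          rw [this]
          nlinarith

end Euler

end XElliptic

namespace XElliptic

variable {N m : ℕ} {X : Fields N m} {U Ω : Set (E N)} {Q : ℝ}

/-! ### Transport of test functions along Euler schemes -/

lemma IsTest.exists_taylor_bound {φ : E N → ℝ} (hφ : IsTest Ω φ) :
    ∃ L ≥ 0, ∀ x v, |φ (x + v) - φ x - fderiv ℝ φ x v| ≤ L * ‖v‖ ^ 2 := by
  have h1 : ContDiff ℝ 1 (fderiv ℝ φ) := 
    (contDiff_infty.1 hφ.1 2).fderiv_right (by norm_num)
  obtain ⟨L, hL⟩ := h1.lipschitzWith_of_hasCompactSupport (hφ.2.1.fderiv ℝ) one_ne_zero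
  refine ⟨L, L.2, fun x v => ?_⟩
  have hd : ∀ z, HasFDerivAt φ (fderiv ℝ φ z) z := fun z =>
    (hφ.contDiff_one.differentiable one_ne_zero z).hasFDerivAt
  have := (convex_closedBall x ‖v‖).norm_image_sub_le_of_norm_hasFDerivWithin_le' (f := φ)
    (φ := fderiv ℝ φ x) (C := L * ‖v‖) (fun z _ => (hd z).hasFDerivWithinAt) (fun z hz => by
      refine (hL.norm_sub_le z x).trans ?_
      rw [mem_closedBall_iff_norm] at hz
      gcongr) (Metric.mem_closedBall_self (norm_nonneg v)) (y := x + v) (by simp)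
  simpa [add_sub_cancel_left, mul_assoc, sq] using this

/-- Cauchy–Schwarz in the control variables on `Ω`. Off `Ω` the derivative of `φ` vanishes, so it
does not matter that the extended fields differ from `X` there. -/
lemma IsTest.abs_fderiv_control_le {Y : Fields N m} (hXY : ∀ j, Set.EqOn (X j) (Y j) Ω)
    {φ : E N → ℝ} (hφ : IsTest Ω φ) {ϑ : Fin m → ℝ} (hϑ : ∑ j, ϑ j ^ 2 ≤ 1) (x : E N) :
    |fderiv ℝ φ x (control Y ϑ x)| ≤ ‖gradX X φ x‖ := by
  by_cases hx : x ∈ Ω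
  · refine abs_le_of_sq_le_sq ?_ (norm_nonneg _)
    have h1 : fderiv ℝ φ x (control Y ϑ x) = ∑ j, ϑ j * fderiv ℝ φ x (X j x) := by
      rw [control, map_sum]
      exact Finset.sum_congr rfl fun j _ => by rw [map_smul, hXY j hx, smul_eq_mul]
    rw [h1, EuclideanSpace.norm_sq_eq]
    refine (Finset.sum_mul_sq_le_sq_mul_sq _ _ _).trans ?_
    have h2 : ∑ j, fderiv ℝ φ x (X j x) ^ 2 = ∑ j, ‖gradX X φ x j‖ ^ 2 := by
      simp [gradX]
    rw [h2]
    exact mul_le_of_le_one_left (by positivity) hϑ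
  · have : fderiv ℝ φ x = 0 := by
      by_contra h
      exact hx (hφ.2.2 (support_fderiv_subset ℝ h))
    simp [this]

/-- Telescoping along the orbit: each increment is a derivative in a controlled direction plus a
second-order Taylor error. -/
lemma IsTest.abs_sub_eulerFlow_le {Y : Fields N m} (hXY : ∀ j, Set.EqOn (X j) (Y j) Ω)
    {φ : E N → ℝ} (hφ : IsTest Ω φ) {θ : ℕ → Fin m → ℝ} (hθ : ∀ k, ∑ j, θ k j ^ 2 ≤ 1) {h : ℝ}
    (hh : 0 ≤ h) {L S : ℝ} (hL0 : 0 ≤ L)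
    (hL : ∀ x v, |φ (x + v) - φ x - fderiv ℝ φ x v| ≤ L * ‖v‖ ^ 2) {x : E N} {n : ℕ}
    (hS : ∀ k < n, ‖control Y (θ k) (eulerFlow Y h θ k x)‖ ≤ S) :
    |φ (eulerFlow Y h θ n x) - φ x| ≤
      h * (∑ k ∈ Finset.range n, ‖gradX X φ (eulerFlow Y h θ k x)‖) + n * (L * h ^ 2 * S ^ 2) := by
  induction n with
  | zero => simp [eulerFlow]
  | succ n ih =>
    specialize ih fun k hk => hS k (hk.trans n.lt_succ_self)
    set p := eulerFlow Y h θ n x with hp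
    have h1 := hL p (h • control Y (θ n) p)
    rw [map_smul, smul_eq_mul, norm_smul, Real.norm_of_nonneg hh, mul_pow] at h1
    have h2 := mul_le_mul_of_nonneg_left (hφ.abs_fderiv_control_le hXY (hθ n) p) hh
    have h3 : ‖control Y (θ n) p‖ ^ 2 ≤ S ^ 2 :=
      pow_le_pow_left₀ (norm_nonneg _) (hS n n.lt_succ_self) 2
    have h3' := mul_le_mul_of_nonneg_left h3 (by positivity : 0 ≤ L * h ^ 2)
    have h4 : eulerFlow Y h θ (n + 1) x = p + h • control Y (θ n) p := rfl
    rw [h4, Finset.sum_range_succ, ← hp]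
    push_cast
    rw [abs_le] at *
    have h5 := abs_le.1 (le_refl |fderiv ℝ φ p (control Y (θ n) p)|)
    have h6 := mul_le_mul_of_nonneg_left h5.1 hh
    have h7 := mul_le_mul_of_nonneg_left h5.2 hh
    have h8 := mul_le_mul_of_nonneg_left (hφ.abs_fderiv_control_le hXY (hθ n) p) hh
    constructor <;> nlinarith

/-- Transport along a subunit path from a ball in `Ω` to a set outside `Ω` controls the means of
the test functions. -/
lemma IsSubunit.abs_mul_volume_le {Y : Fields N m} {K : ℝ≥0} (hY : ∀ j, LipschitzWith K (Y j))
    (hXY : ∀ j, Set.EqOn (X j) (Y j) Ω) {M : ℝ} (hM : ∀ x ∈ Ω, ∑ j, ‖X j x‖ ≤ M)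
    (hX : ∀ j, LocallyLipschitz (X j)) (hΩ : volume Ω ≠ ⊤)
    {D T δ κ : ℝ} {γ : ℝ → E N} (hγ : IsSubunit X Ω T γ) (hT : 0 < T) (hTD : T ≤ D)
    (hκ : κ = Real.exp (2 * D * (m * K))) (hδ : 0 < δ)
    (hball : Metric.ball (γ 0) δ ⊆ Ω) {V : Set (E N)} (hVo : IsOpen V)
    (hV : V ⊆ Metric.ball (γ T) (δ / (2 * κ))) (hVΩ : Disjoint V Ω) {φ : E N → ℝ}
    (hφ : IsTest Ω φ) (c : ℝ) :
    |c| * volume.real V ≤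
      κ ^ N * (D * κ ^ N * (∫ y, ‖gradX X φ y‖) + ∫ y in Ω, |φ y - c|) := by
  have hD : 0 < D := hT.trans_le hTD
  set Λ : ℝ := m * K with hΛ
  have hΛ0 : 0 ≤ Λ := by positivity
  have hκ1 : 1 ≤ κ := by rw [hκ]; exact Real.one_le_exp (by positivity)
  have hκ0 : 0 < κ := by linarith
  have hM0 : 0 ≤ M := (by positivity : 0 ≤ ∑ j, ‖X j (γ 0)‖).trans
    (hM _ (hγ.2.1 0 ⟨le_rfl, hT.le⟩))
  obtain ⟨L, hL0, hL⟩ := hφ.exists_taylor_bound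
  -- Orbits starting in the `δ`-ball will stay within `2κδ` of the path, on which the speed is at
  -- most `M`; `S` is the resulting speed bound.
  set S : ℝ := M + 2 * Λ * κ * δ with hS
  have hS0 : 0 ≤ S := by positivity
  set I := ∫ y, ‖gradX X φ y‖ with hI
  set J := ∫ y in Ω, |φ y - c| with hJ
  set h : ℕ → ℝ := fun n => T / n with hh
  have hh0 : Tendsto h atTop (𝓝 0) := tendsto_const_div_atTop_nhds_zero_nat T
  -- With `n` steps of size `T / n` the estimate holds up to a term proportional to `h n`, which
  -- disappears in the limit.
  have key : ∀ᶠ n in atTop, |c| * volume.real V ≤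
      κ ^ N * ((D * κ ^ N * I + T * (L * h n * S ^ 2) * volume.real Ω) + J) := by
    -- `e1` makes every Euler step invertible; `e2` makes the endpoint error, magnified by `κ`,
    -- smaller than `δ / 2`.
    have e1 : ∀ᶠ n in atTop, h n * Λ ≤ 1 / 2 :=
      ((hh0.mul_const Λ).eventually (ge_mem_nhds (by norm_num)))
    have e2 : ∀ᶠ n in atTop, κ * (T * κ * (Λ * M)) * h n < δ / 2 :=
      (hh0.const_mul (κ * (T * κ * (Λ * M)))).eventually (gt_mem_nhds (by simpa using hδ))
    filter_upwards [e1, e2, eventually_ge_atTop 1] with n h1 h2 hn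
    have hn0 : (0 : ℝ) < n := by exact_mod_cast hn
    have hhn : 0 < h n := div_pos hT hn0
    have hnh : n * h n = T := mul_div_cancel₀ T hn0.ne'
    obtain ⟨θ, hθ, hclose⟩ := hγ.exists_eulerFlow hY hXY hM hhn hnh.le
    set G := eulerFlow Y (h n) θ with hG
    have hpow : ∀ k ≤ n, (1 + 2 * (h n * Λ)) ^ k ≤ κ := by
      intro k hk
      have hk' : (k : ℝ) ≤ n := by exact_mod_cast hk
      have : 1 + 2 * (h n * Λ) ≤ Real.exp (2 * (h n * Λ)) := by
        linarith [Real.add_one_le_exp (2 * (h n * Λ))]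
      calc (1 + 2 * (h n * Λ)) ^ k ≤ Real.exp (2 * (h n * Λ)) ^ k :=
            pow_le_pow_left₀ (by positivity) this k
        _ = Real.exp (2 * (k * h n) * Λ) := by rw [← Real.exp_nat_mul]; ring_nf
        _ ≤ κ := by
            rw [hκ]; gcongr
            exact (mul_le_mul_of_nonneg_right hk' hhn.le).trans (hnh.le.trans hTD)
    have hclose' : ∀ k ≤ n, ‖G k (γ 0) - γ (k * h n)‖ ≤ T * κ * (Λ * M) * h n := by
      intro k hk
      have hk' : (k : ℝ) ≤ n := by exact_mod_cast hk
      refine (hclose k hk).trans ?_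
      calc k * (1 + 2 * (h n * Λ)) ^ k * (Λ * M * h n ^ 2)
          ≤ n * κ * (Λ * M * h n ^ 2) := by gcongr; exact hpow k hk
        _ = (n * h n) * κ * (Λ * M) * h n := by ring
        _ = _ := by rw [hnh]
    have hanti : ∀ k ≤ n, ∀ x y, ‖x - y‖ ≤ κ * ‖G k x - G k y‖ := fun k hk x y =>
      (norm_sub_le_eulerFlow hY hθ hhn.le h1 k x y).trans
        (mul_le_mul_of_nonneg_right (hpow k hk) (norm_nonneg _))
    have hlip : ∀ k ≤ n, ∀ x y, ‖G k x - G k y‖ ≤ κ * ‖x - y‖ := fun k hk x y =>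
      (norm_eulerFlow_sub_le hY hθ hhn.le k x y).trans
        (mul_le_mul_of_nonneg_right (hpow k hk) (norm_nonneg _))
    have hcont : ∀ k, Continuous (G k) := fun k => continuous_eulerFlow hY hθ hhn.le k
    have hanti' : ∀ k ≤ n, AntilipschitzWith κ.toNNReal (G k) := fun k hk =>
      AntilipschitzWith.of_le_mul_dist fun x y => by
        rw [Real.coe_toNNReal _ hκ0.le, dist_eq_norm, dist_eq_norm]; exact hanti k hk x y
    have hlip' : LipschitzWith κ.toNNReal (G n) := LipschitzWith.of_dist_le_mul fun x y => by
        rw [Real.coe_toNNReal _ hκ0.le, dist_eq_norm, dist_eq_norm]; exact hlip n le_rfl x y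
    -- The starting points carried into `V`. The backward Lipschitz bound `κ` keeps them in the
    -- initial ball, and the forward bound prevents `W` from being much smaller than `V`.
    set W := G n ⁻¹' V with hW
    have hWball : W ⊆ Metric.ball (γ 0) δ := by
      intro w hw
      have hv : G n w ∈ Metric.ball (γ T) (δ / (2 * κ)) := hV hw
      rw [mem_ball_iff_norm] at hv ⊢
      have hc := hclose' n le_rfl
      rw [hnh] at hc
      have h3 : ‖G n w - G n (γ 0)‖ ≤ ‖G n w - γ T‖ + ‖G n (γ 0) - γ T‖ := by
        rw [norm_sub_rev (G n (γ 0))]; exact norm_sub_le_norm_sub_add_norm_sub _ _ _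
      calc ‖w - γ 0‖ ≤ κ * ‖G n w - G n (γ 0)‖ := hanti n le_rfl _ _
        _ ≤ κ * (‖G n w - γ T‖ + T * κ * (Λ * M) * h n) := by gcongr; linarith
        _ < κ * (δ / (2 * κ) + T * κ * (Λ * M) * h n) := by gcongr
        _ = δ / 2 + κ * (T * κ * (Λ * M)) * h n := by field_simp
        _ < δ := by linarith
    have hWo : IsOpen W := hVo.preimage (hcont n)
    have hWΩ : W ⊆ Ω := hWball.trans hball
    have hWt : volume W ≠ ⊤ := ne_top_of_le_ne_top hΩ (measure_mono hWΩ)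
    have hvol : volume.real V ≤ κ ^ N * volume.real W := by
      have h3 : volume V ≤ (κ.toNNReal : ℝ≥0∞) ^ N * volume W := by
        rw [← Set.image_preimage_eq V (surjective_eulerFlow hY hθ hhn.le h1 n)]
        exact volume_image_le_of_lipschitzWith hlip' _
      have h4 := ENNReal.toReal_mono (ENNReal.mul_lt_top (by simp) hWt.lt_top).ne h3
      rwa [ENNReal.toReal_mul, ENNReal.toReal_pow, ENNReal.coe_toReal,
        Real.coe_toNNReal _ hκ0.le] at h4
    have hpt : ∀ w ∈ W, |φ w| ≤ h n * (∑ k ∈ Finset.range n, ‖gradX X φ (G k w)‖) +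
        n * (L * h n ^ 2 * S ^ 2) := by
      intro w hw
      have h0 : φ (G n w) = 0 := hφ.eq_zero_of_notMem (Set.disjoint_left.1 hVΩ hw)
      have := hφ.abs_sub_eulerFlow_le hXY hθ hhn.le hL0 hL (x := w) (n := n) (S := S) ?_
      · rwa [← hG, h0, zero_sub, abs_neg] at this
      intro k hk
      have hkT : γ (k * h n) ∈ Ω := by
        refine hγ.2.1 _ ⟨by positivity, ?_⟩
        rw [← hnh]; gcongr
      have hwb := hWball hw
      rw [mem_ball_iff_norm] at hwb
      have h3 : ‖control Y (θ k) (γ (k * h n))‖ ≤ M := by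
        refine (norm_sum_smul_le (hθ k) _).trans (le_trans (le_of_eq ?_) (hM _ hkT))
        exact Finset.sum_congr rfl fun j _ => by rw [hXY j hkT]
      have h4 := norm_control_sub_le hY (hθ k) (G k w) (γ (k * h n))
      have h5 : ‖G k w - γ (k * h n)‖ ≤ κ * δ + T * κ * (Λ * M) * h n :=
        (norm_sub_le_norm_sub_add_norm_sub _ (G k (γ 0)) _).trans
          (add_le_add ((hlip k hk.le _ _).trans (by gcongr)) (hclose' k hk.le))
      have h6 : T * κ * (Λ * M) * h n ≤ κ * δ := by
        have h7 : 0 ≤ T * κ * (Λ * M) * h n := by positivity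
        have h8 : T * κ * (Λ * M) * h n ≤ κ * (T * κ * (Λ * M) * h n) :=
          le_mul_of_one_le_left h7 hκ1
        have h9 : δ ≤ κ * δ := le_mul_of_one_le_left hδ.le hκ1
        nlinarith
      calc ‖control Y (θ k) (G k w)‖
          ≤ ‖control Y (θ k) (G k w) - control Y (θ k) (γ (k * h n))‖ +
            ‖control Y (θ k) (γ (k * h n))‖ := by
              simpa using norm_add_le (control Y (θ k) (G k w) - control Y (θ k) (γ (k * h n)))
                (control Y (θ k) (γ (k * h n)))
        _ ≤ Λ * (κ * δ + κ * δ) + M := by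
            refine add_le_add (h4.trans ?_) h3
            rw [← hΛ]
            gcongr
            linarith
        _ = S := by rw [hS]; ring
    -- The antilipschitz bound replaces the change of variables, uniformly in `k` and `n`.
    have hcomp : ∀ k ≤ n, Integrable (fun w => ‖gradX X φ (G k w)‖) ∧
        ∫ w, ‖gradX X φ (G k w)‖ ≤ κ ^ N * I := by
      intro k hk
      have := integrable_and_integral_comp_le (hanti' k hk) (hcont k)
        (hφ.integrable_norm_gradX hX) (fun _ => norm_nonneg _)
      rwa [Real.coe_toNNReal _ hκ0.le] at this
    have hintW : ∫ w in W, |φ w| ≤ D * κ ^ N * I + T * (L * h n * S ^ 2) * volume.real Ω := by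
      have hi1 : IntegrableOn (fun w => h n * ∑ k ∈ Finset.range n, ‖gradX X φ (G k w)‖) W :=
        ((integrable_finsetSum _ fun k hk =>
          (hcomp k (Finset.mem_range.1 hk).le).1).integrableOn).const_mul _
      have hi2 : IntegrableOn (fun _ => n * (L * h n ^ 2 * S ^ 2)) W (volume : Measure (E N)) :=
        integrableOn_const hWt
      calc ∫ w in W, |φ w| ≤ ∫ w in W, (h n * (∑ k ∈ Finset.range n, ‖gradX X φ (G k w)‖) +
            n * (L * h n ^ 2 * S ^ 2)) :=
            setIntegral_mono_on hφ.integrable.integrableOn.abs (IntegrableOn.fun_add hi1 hi2) hWo.measurableSet hpt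
        _ = h n * (∑ k ∈ Finset.range n, ∫ w in W, ‖gradX X φ (G k w)‖) +
            volume.real W * (n * (L * h n ^ 2 * S ^ 2)) := by
            rw [integral_add hi1 hi2, integral_const_mul, integral_finsetSum, setIntegral_const,
              smul_eq_mul]
            exact fun k hk => (hcomp k (Finset.mem_range.1 hk).le).1.integrableOn
        _ ≤ h n * (∑ k ∈ Finset.range n, κ ^ N * I) +
            volume.real Ω * (n * (L * h n ^ 2 * S ^ 2)) := by
            gcongr with k hk
            · have hk' := hcomp k (Finset.mem_range.1 hk).le
              exact (integral_mono_measure Measure.restrict_le_self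
                (ae_of_all _ fun _ => norm_nonneg _) hk'.1).trans hk'.2
        _ = (n * h n) * κ ^ N * I + (n * h n) * (L * h n * S ^ 2) * volume.real Ω := by
            rw [Finset.sum_const, Finset.card_range, nsmul_eq_mul]; ring
        _ ≤ _ := by
            rw [hnh]
            have : 0 ≤ I := integral_nonneg fun _ => norm_nonneg _
            gcongr
    calc |c| * volume.real V ≤ |c| * (κ ^ N * volume.real W) := by gcongr
      _ = κ ^ N * (|c| * volume.real W) := by ring
      _ ≤ κ ^ N * ((∫ y in W, |φ y|) + J) := by
          gcongr
          exact Admissible.abs_average_mul_le hφ.integrable hΩ hWΩ c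
      _ ≤ _ := by gcongr
  refine ge_of_tendsto ?_ key
  have h3 : Tendsto (fun n => κ ^ N * ((D * κ ^ N * I + T * (L * h n * S ^ 2) * volume.real Ω) + J))
      atTop (𝓝 (κ ^ N * ((D * κ ^ N * I + T * (L * 0 * S ^ 2) * volume.real Ω) + J))) :=
    (((((hh0.const_mul L).mul_const _).const_mul T).mul_const _).const_add _).add_const _
      |>.const_mul _
  simpa using h3

/-- No control ball of `Ω` reaches the exterior, so the vanishing of `φ` there is transported back
into a fixed ball along a subunit path, and Poincaré on `Ω` itself, a control ball, does the rest.
-/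
lemma Admissible.friedrichs_self (hX : Admissible X Ω Q) (hΩo : IsOpen Ω) (hN : N ≠ 0)
    (hΩ : Bornology.IsBounded Ω) {x : E N} (hx : x ∈ Ω) :
    ∃ C ≥ 0, ∀ φ : E N → ℝ, IsTest Ω φ → ∫ y, |φ y| ≤ C * ∫ y, ‖gradX X φ y‖ := by
  have : Nonempty (Fin N) := ⟨⟨0, Nat.pos_of_ne_zero hN⟩⟩
  have hcpt : IsCompact (closure Ω) := hΩ.isCompact_closure
  have hΩt : volume Ω ≠ ⊤ := hΩ.measure_lt_top.ne
  obtain ⟨D, hD, hDΩ⟩ := hX.exists_dX_lt_of_volume_lt_top hΩo hΩt.lt_top hx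
  obtain ⟨δ, hδ, hball⟩ := Metric.isOpen_iff.1 hΩo x hx
  -- Euler orbits may leave `Ω`, so the scheme needs fields that are Lipschitz on all of `ℝ^N`.
  have hext : ∀ j, ∃ (K : ℝ≥0) (Z : E N → E N), LipschitzWith K Z ∧ Set.EqOn (X j) Z Ω := by
    intro j
    obtain ⟨K, hK⟩ := ((hX.lipschitz j).locallyLipschitzOn
      (s := closure Ω)).exists_lipschitzOnWith_of_compact hcpt
    obtain ⟨Z, hZ, hXZ⟩ := (hK.mono subset_closure).extend_finite_dimension
    exact ⟨_, Z, hZ, hXZ⟩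
  choose K' Y hY' hXY using hext
  set K : ℝ≥0 := ∑ j, K' j
  have hY : ∀ j, LipschitzWith K (Y j) := fun j =>
    (hY' j).weaken (Finset.single_le_sum (fun _ _ => zero_le) (Finset.mem_univ j))
  obtain ⟨M, hM⟩ := hcpt.bddAbove_image (continuous_sum_norm hX.lipschitz).continuousOn
  have hM' : ∀ y ∈ Ω, ∑ j, ‖X j y‖ ≤ M := fun y hy => hM ⟨y, subset_closure hy, rfl⟩
  -- `κ` depends on the time bound `D` and not on the path, so `ε` can be fixed before the endpoint
  -- `y` is chosen.
  set κ : ℝ := Real.exp (2 * D * (m * K)) with hκ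
  have hκ0 : 0 < κ := Real.exp_pos _
  set ε : ℝ := δ / (4 * κ) with hε
  have hε0 : 0 < ε := by positivity
  -- The frontier of the closure, not of `Ω`: near `z` the complement of `closure Ω` is nonempty and
  -- open, hence of positive measure.
  obtain ⟨z, hz⟩ : (frontier (closure Ω)).Nonempty := by
    refine nonempty_frontier_iff.2 ⟨⟨x, subset_closure hx⟩, fun h => ?_⟩
    exact NoncompactSpace.noncompact_univ (X := E N) (h ▸ hcpt)
  rw [frontier_eq_closure_inter_closure, closure_closure] at hz
  obtain ⟨y, hy, hyz⟩ := Metric.mem_closure_iff.1 hz.1 ε hε0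
  obtain ⟨v, hv, hvz⟩ := Metric.mem_closure_iff.1 hz.2 ε hε0
  set V : Set (E N) := Metric.ball z ε \ closure Ω with hVdef
  have hVo : IsOpen V := Metric.isOpen_ball.sdiff isClosed_closure
  have hVball : V ⊆ Metric.ball y (δ / (2 * κ)) := fun w hw => by
    have : δ / (2 * κ) = ε + ε := by rw [hε]; field_simp; norm_num
    rw [this]
    exact (dist_triangle w z y).trans_lt (add_lt_add hw.1 hyz)
  have hVΩ : Disjoint V Ω := Set.disjoint_left.2 fun w hw hwΩ => hw.2 (subset_closure hwΩ)
  have hV0 : 0 < volume.real V := ENNReal.toReal_pos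
    (hVo.measure_pos volume ⟨v, by rwa [Metric.mem_ball, dist_comm], hv⟩).ne'
    (ne_top_of_le_ne_top measure_ball_lt_top.ne (measure_mono Set.sdiff_subset))
  obtain ⟨T, ⟨hT, γ, hγ, h0, h1⟩, hTD⟩ := exists_lt_of_csInf_lt (hX.connected x hx y hy) (hDΩ y hy)
  obtain ⟨C₁, hC₁, H₁⟩ := hX.exists_integral_sub_average_le (Ω := Ω) hx hD
  have hBΩ : ballX X Ω x D = Ω := Set.Subset.antisymm (fun _ h => h.1) fun w hw => ⟨hw, hDΩ w hw⟩
  refine hX.friedrichs_of_average hx hBΩ.ge hC₁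
    (C₂ := κ ^ N * (D * κ ^ N + C₁) / volume.real V) (by positivity) H₁ fun φ hφ => ?_
  have h2 := hγ.abs_mul_volume_le hY hXY hM' hX.lipschitz hΩt hT hTD.le hκ hδ (by rwa [h0]) hVo
    (by rwa [h1]) hVΩ hφ (⨍ w in ballX X Ω x D, φ w)
  have h3 := H₁ φ hφ
  rw [hBΩ] at h2 h3 ⊢
  rw [div_mul_eq_mul_div, le_div_iff₀ hV0]
  refine h2.trans ?_
  rw [mul_assoc (κ ^ N) (_ + _), add_mul]
  gcongr

/-- The Friedrichs inequality. -/
lemma Admissible.friedrichs (hX : Admissible X U Q) (hU : IsOpen U) (hN : N ≠ 0)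
    (hΩ : Bornology.IsBounded Ω) (hΩU : U = Ω ∨ closure Ω ⊆ U) {x : E N} (hx : x ∈ Ω) :
    ∃ C ≥ 0, ∀ φ : E N → ℝ, IsTest Ω φ → ∫ y, |φ y| ≤ C * ∫ y, ‖gradX X φ y‖ := by
  rcases hΩU with rfl | h
  · exact hX.friedrichs_self hU hN hΩ hx
  · exact hX.friedrichs_of_closure_subset hU hN hΩ h hx

end XElliptic

namespace XElliptic

/-! ### Hedberg's summation argument -/

/-- Sums over dyadic scales of numbers bounded both by `M` and by `a 2^{kQ/2}`. -/
lemma exists_hedberg_sum_le {Q : ℝ} (hQ : 2 < Q) : ∃ C ≥ 0, ∀ (M a : ℝ) (A : ℕ → ℝ), 0 ≤ a →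
    (∀ k, 0 ≤ A k) → (∀ k, A k ≤ M) → (∀ k, A k ≤ a * ((2 : ℝ) ^ (Q / 2)) ^ k) →
    ∀ n, ∑ k ∈ Finset.range n, (1 / 2 : ℝ) ^ k * A k ≤ C * (M ^ (1 - 2 / Q) * a ^ (2 / Q)) := by
  set q : ℝ := (2 : ℝ) ^ (Q / 2 - 1) with hq
  have hq1 : 1 < q := Real.one_lt_rpow one_lt_two (by linarith)
  have hQ0 : 0 < Q := by linarith
  have hQ2 : 2 / Q < 1 := by rw [div_lt_one hQ0]; exact hQ
  refine ⟨q / (q - 1) + 2, by have : 0 < q - 1 := by linarith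
                              positivity, fun M a A ha hA0 hAM hAa n => ?_⟩
  have hM0 : 0 ≤ M := (hA0 0).trans (hAM 0)
  have hgeo : ∀ n, ∑ k ∈ Finset.range n, (1 / 2 : ℝ) ^ k * A k ≤ 2 * M := fun n => by
    calc ∑ k ∈ Finset.range n, (1 / 2 : ℝ) ^ k * A k
        ≤ ∑ k ∈ Finset.range n, (1 / 2 : ℝ) ^ k * M :=
          Finset.sum_le_sum fun k _ => mul_le_mul_of_nonneg_left (hAM k) (by positivity)
      _ = (∑ k ∈ Finset.range n, (1 / 2 : ℝ) ^ k) * M := by rw [Finset.sum_mul]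
      _ ≤ 2 * M := mul_le_mul_of_nonneg_right (sum_geometric_two_le n) hM0
  have hqq : 0 ≤ q / (q - 1) := div_nonneg (by linarith) (by linarith)
  rcases ha.eq_or_lt with rfl | ha
  · have hA : ∀ k, A k = 0 := fun k => le_antisymm (by simpa using hAa k) (hA0 k)
    simp only [hA, mul_zero, Finset.sum_const_zero]
    positivity
  -- If `M ≤ a`, the geometric bound `2M` is already of the required form.
  rcases le_or_gt M a with hMa | haM
  · have h1 : M ≤ M ^ (1 - 2 / Q) * a ^ (2 / Q) := by
      calc M = M ^ (1 - 2 / Q) * M ^ (2 / Q) := by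
            rw [← Real.rpow_add_of_nonneg hM0 (by linarith) (by positivity)]; simp
        _ ≤ _ := by gcongr
    have h2 : 0 ≤ M ^ (1 - 2 / Q) * a ^ (2 / Q) := by positivity
    nlinarith [hgeo n]
  have hMpos : 0 < M := ha.trans haM
  set t := M ^ (1 - 2 / Q) * a ^ (2 / Q) with ht
  -- The bounds `M` and `a 2^{kQ/2}` balance at `2^k = s`. Up to the index `j` with `2^j ≤ s <
  -- 2^{j+1}` the second is summed, with ratio `q > 1`; beyond it the first, with ratio `1/2`.
  set s : ℝ := (M / a) ^ (2 / Q) with hs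
  have hs1 : 1 ≤ s := Real.one_le_rpow (by rw [one_le_div ha]; exact haM.le) (by positivity)
  have hs0 : 0 < s := by linarith
  obtain ⟨j, hj1, hj2⟩ := exists_nat_pow_near hs1 one_lt_two
  have hsq : a * s ^ (Q / 2 - 1) = t := by
    rw [hs, ← Real.rpow_mul (by positivity), ht]
    have : 2 / Q * (Q / 2 - 1) = 1 - 2 / Q := by field_simp
    rw [this, Real.div_rpow hM0 ha.le, mul_div_assoc', mul_comm a, mul_div_assoc]
    congr 1
    nth_rewrite 1 [← Real.rpow_one a]
    rw [← Real.rpow_sub ha]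
    congr 1; ring
  have hsM : M / s = t := by
    rw [hs, Real.div_rpow hM0 ha.le, ht, div_div_eq_mul_div, mul_comm M, mul_div_assoc, mul_comm]
    congr 1
    nth_rewrite 1 [← Real.rpow_one M]
    rw [← Real.rpow_sub hMpos]
  have hqk : ∀ k, (1 / 2 : ℝ) ^ k * (a * ((2 : ℝ) ^ (Q / 2)) ^ k) = a * q ^ k := fun k => by
    have : q = (1 / 2) * (2 : ℝ) ^ (Q / 2) := by
      rw [hq, Real.rpow_sub two_pos, Real.rpow_one]; ring
    rw [this, mul_pow]; ring
  have h1 : ∑ k ∈ Finset.range (j + 1), (1 / 2 : ℝ) ^ k * A k ≤ q / (q - 1) * t := by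
    calc ∑ k ∈ Finset.range (j + 1), (1 / 2 : ℝ) ^ k * A k
        ≤ ∑ k ∈ Finset.range (j + 1), a * q ^ k := Finset.sum_le_sum fun k _ => by
          rw [← hqk]; exact mul_le_mul_of_nonneg_left (hAa k) (by positivity)
      _ = a * ((q ^ (j + 1) - 1) / (q - 1)) := by rw [← Finset.mul_sum, geom_sum_eq hq1.ne']
      _ ≤ a * (q ^ (j + 1) / (q - 1)) := by
          have : 0 < q - 1 := by linarith
          gcongr; linarith
      _ = q / (q - 1) * (a * q ^ j) := by rw [pow_succ]; ring
      _ ≤ q / (q - 1) * t := by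
          rw [← hsq]
          gcongr
          calc q ^ j = ((2 : ℝ) ^ j) ^ (Q / 2 - 1) := by
                rw [hq, ← Real.rpow_natCast, ← Real.rpow_natCast, ← Real.rpow_mul two_pos.le,
                  ← Real.rpow_mul two_pos.le, mul_comm]
            _ ≤ s ^ (Q / 2 - 1) := Real.rpow_le_rpow (by positivity) hj1 (by linarith)
  have h2 : ∑ k ∈ Finset.range n, (1 / 2 : ℝ) ^ (j + 1 + k) * A (j + 1 + k) ≤ 2 * t := by
    calc ∑ k ∈ Finset.range n, (1 / 2 : ℝ) ^ (j + 1 + k) * A (j + 1 + k)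
        ≤ ∑ k ∈ Finset.range n, (1 / 2 : ℝ) ^ (j + 1 + k) * M :=
          Finset.sum_le_sum fun k _ => mul_le_mul_of_nonneg_left (hAM _) (by positivity)
      _ = (∑ k ∈ Finset.range n, (1 / 2 : ℝ) ^ k) * ((1 / 2 : ℝ) ^ (j + 1) * M) := by
          rw [Finset.sum_mul]
          exact Finset.sum_congr rfl fun k _ => by rw [pow_add]; ring
      _ ≤ 2 * ((1 / 2 : ℝ) ^ (j + 1) * M) := by
          gcongr; exact sum_geometric_two_le n
      _ ≤ 2 * t := by
          rw [← hsM, one_div, inv_pow, ← div_eq_inv_mul]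
          gcongr
  calc ∑ k ∈ Finset.range n, (1 / 2 : ℝ) ^ k * A k
      ≤ ∑ k ∈ Finset.range (j + 1 + n), (1 / 2 : ℝ) ^ k * A k :=
        Finset.sum_le_sum_of_subset_of_nonneg (Finset.range_mono (by omega)) fun k _ _ =>
          mul_nonneg (by positivity) (hA0 k)
    _ ≤ q / (q - 1) * t + 2 * t := by rw [Finset.sum_range_add]; exact add_le_add h1 h2
    _ = _ := by ring

/-! ### The Sobolev inequality -/

variable {N m : ℕ} {X : Fields N m} {U Ω : Set (E N)} {Q : ℝ}

namespace IsTest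

variable {φ : E N → ℝ}

lemma memLp_gradX (hX : ∀ j, LocallyLipschitz (X j)) (h : IsTest Ω φ) (q : ℝ≥0∞)
    (μ : Measure (E N)) [IsFiniteMeasureOnCompacts μ] : MemLp (gradX X φ) q μ :=
  (continuous_gradX hX h.contDiff_one).memLp_of_hasCompactSupport h.hasCompactSupport_gradX

lemma integral_norm_gradX_le (hX : ∀ j, LocallyLipschitz (X j)) (h : IsTest Ω φ) {B : Set (E N)}
    (hB : volume B ≠ ⊤) : ∫ y in B, ‖gradX X φ y‖ ≤
      (eLpNorm (gradX X φ) 2 (volume.restrict Ω)).toReal * volume.real B ^ (1 / 2 : ℝ) := by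
  have hc := continuous_gradX hX h.contDiff_one
  have hsupp : Function.support (gradX X φ) ⊆ Ω := fun y hy => by
    by_contra hyΩ
    exact hy (h.gradX_eq_zero_of_notMem hyΩ)
  rw [eLpNorm_restrict_eq_of_support_subset hsupp,
    integral_norm_eq_lintegral_enorm hc.aestronglyMeasurable, ← eLpNorm_one_eq_lintegral_enorm,
    Measure.real, ENNReal.toReal_rpow, ← ENNReal.toReal_mul]
  refine ENNReal.toReal_mono (ENNReal.mul_lt_top (h.memLp_gradX hX 2 volume).eLpNorm_lt_top
    (ENNReal.rpow_lt_top_of_nonneg (by norm_num) hB)).ne ?_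
  have := eLpNorm_le_eLpNorm_mul_rpow_measure_univ (μ := volume.restrict B) (f := gradX X φ)
    (p := 1) (q := 2) (by norm_num) hc.aestronglyMeasurable
  rw [Measure.restrict_apply_univ] at this
  refine this.trans ?_
  norm_num
  gcongr
  exact Measure.restrict_le_self

lemma integral_norm_gradX_le_volume (hX : ∀ j, LocallyLipschitz (X j)) (h : IsTest Ω φ)
    (hΩ : volume Ω ≠ ⊤) : ∫ y, ‖gradX X φ y‖ ≤
      (eLpNorm (gradX X φ) 2 (volume.restrict Ω)).toReal * volume.real Ω ^ (1 / 2 : ℝ) := by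
  rw [← setIntegral_eq_integral_of_forall_compl_eq_zero (s := Ω) fun y hy => by
    rw [h.gradX_eq_zero_of_notMem hy, norm_zero]]
  exact h.integral_norm_gradX_le hX hΩ

end IsTest

namespace Admissible

/-- Control balls shrink to their centre in the Euclidean sense, so continuity of `φ` suffices. -/
lemma tendsto_average_ballX (hX : Admissible X U Q) (hU : IsOpen U) {φ : E N → ℝ} (hφ : IsTest Ω φ) {x : E N}
    (hx : x ∈ U) :
    Tendsto (fun k : ℕ => ⨍ y in ballX X U x ((1 / 2) ^ k), φ y) atTop (𝓝 (φ x)) := by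
  rw [Metric.tendsto_atTop]
  intro ε hε
  obtain ⟨δ, hδ, hδφ⟩ := Metric.continuousAt_iff.1 (hφ.1.continuous.continuousAt (x := x)) (ε / 2)
    (half_pos hε)
  obtain ⟨r, hr, hsub⟩ := exists_ballX_subset_ball hX.lipschitz hX.connected hx hδ
  obtain ⟨n, hn⟩ := exists_pow_lt_of_lt_one hr (by norm_num : (1 / 2 : ℝ) < 1)
  refine ⟨n, fun k hk => ?_⟩
  set B := ballX X U x ((1 / 2) ^ k)
  have hBr : B ⊆ Metric.ball x δ := (ballX_mono
    ((pow_le_pow_of_le_one (by norm_num) (by norm_num) hk).trans hn.le)).trans hsub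
  have hBt := hX.volume_ballX_lt_top hx ((1 / 2) ^ k)
  have hB0 := hX.volume_ballX_pos hx (by positivity : (0 : ℝ) < (1 / 2) ^ k)
  have := (convex_closedBall (φ x) (ε / 2)).set_average_mem Metric.isClosed_closedBall hB0.ne'
    hBt.ne (f := φ) (ae_restrict_of_forall_mem (hX.measurableSet_ballX hU hx _)
      fun y hy => Metric.mem_closedBall.2 (hδφ (hBr hy)).le) hφ.integrable.integrableOn
  exact (Metric.mem_closedBall.1 this).trans_lt (half_lt_self hε)

/-- The telescoping argument along the control balls of dyadic radii. -/
lemma exists_abs_le_of_sum_le (hX : Admissible X U Q) (hU : IsOpen U) : ∃ C ν : ℝ, 0 ≤ C ∧ 0 < ν ∧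
    ∀ φ : E N → ℝ, IsTest Ω φ → ∀ x ∈ U, ∀ S : ℝ,
      (∀ n, ∑ k ∈ Finset.range n,
        (1 / 2 : ℝ) ^ k * ⨍ y in ballX X U x (ν * (1 / 2) ^ k), ‖gradX X φ y‖ ≤ S) →
      |φ x| ≤ |⨍ y in ballX X U x 1, φ y| + C * S := by
  obtain ⟨CP, ν, hCP, hν, H⟩ := hX.poincare
  set a : ℝ := (2 : ℝ) ^ Q
  refine ⟨a * CP, ν, by positivity, hν, fun φ hφ x hx S hS => ?_⟩
  set u : ℕ → ℝ := fun k => ⨍ y in ballX X U x ((1 / 2) ^ k), φ y with hu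
  set A : ℕ → ℝ := fun k => ⨍ y in ballX X U x (ν * (1 / 2) ^ k), ‖gradX X φ y‖ with hA
  have hstep : ∀ k, |u (k + 1) - u k| ≤ a * CP * ((1 / 2 : ℝ) ^ k * A k) := by
    intro k
    have hk0 : (0 : ℝ) < (1 / 2) ^ k := by positivity
    have hk1 : (0 : ℝ) < (1 / 2) ^ (k + 1) := by positivity
    set B := ballX X U x ((1 / 2) ^ k) with hB
    set B' := ballX X U x ((1 / 2) ^ (k + 1)) with hB'
    have hv := hX.volume_real_ballX_pos hx hk0
    have hv' := hX.volume_real_ballX_pos hx hk1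
    have hsub : B' ⊆ B := ballX_mono (by rw [pow_succ]; linarith)
    have hBt := (hX.volume_ballX_lt_top hx ((1 / 2) ^ k)).ne
    have hBt' := (hX.volume_ballX_lt_top hx ((1 / 2) ^ (k + 1))).ne
    have hdbl : volume.real B ≤ a * volume.real B' := by
      have := hX.volume_real_ballX_two_pow_mul_le hx hk1 1
      rwa [pow_one, pow_one, show (2 : ℝ) * (1 / 2) ^ (k + 1) = (1 / 2) ^ k by
        rw [pow_succ]; ring] at this
    have hint : IntegrableOn (fun y => |φ y - u k|) B :=
      (hφ.integrable.integrableOn.sub (integrableOn_const hBt)).abs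
    have hP := H x hx _ hk0 φ hφ.contDiff_one hφ.2.1
    rw [setAverage_eq volume _ (ballX X U x ((1 / 2) ^ k)), smul_eq_mul, inv_mul_le_iff₀ hv] at hP
    -- The difference of consecutive means is the mean over `B'` of `φ - u k`; enlarging `B'` to `B`
    -- costs one doubling constant.
    have h2 : |u (k + 1) - u k| * volume.real B' ≤ ∫ y in B', |φ y - u k| := by
      have h3 : (u (k + 1) - u k) * volume.real B' = ∫ y in B', (φ y - u k) := by
        rw [integral_sub hφ.integrable.integrableOn (integrableOn_const hBt'), setIntegral_const,
          hu]
        simp only [setAverage_eq, smul_eq_mul, ← hB']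
        rw [sub_mul, inv_mul_eq_div, div_mul_cancel₀ _ hv'.ne']
        ring
      rw [← abs_of_pos hv', ← abs_mul, ← hB', h3]
      exact abs_integral_le_integral_abs
    have h3 : ∫ y in B', |φ y - u k| ≤ ∫ y in B, |φ y - u k| :=
      setIntegral_mono_set hint (ae_of_all _ fun _ => abs_nonneg _) hsub.eventuallyLE
    have hA0 : 0 ≤ A k := by
      rw [hA]; simp only [setAverage_eq, smul_eq_mul]
      exact mul_nonneg (by positivity) (integral_nonneg fun _ => norm_nonneg _)
    have h4 : |u (k + 1) - u k| * volume.real B' ≤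
        (a * CP * ((1 / 2 : ℝ) ^ k * A k)) * volume.real B' := by
      calc |u (k + 1) - u k| * volume.real B' ≤ volume.real B * (CP * (1 / 2) ^ k * A k) :=
            h2.trans (h3.trans hP)
        _ ≤ (a * volume.real B') * (CP * (1 / 2) ^ k * A k) := by gcongr
        _ = _ := by ring
    exact le_of_mul_le_mul_right h4 hv'
  have hsum : ∀ n, |u n| ≤ |u 0| + a * CP * S := by
    intro n
    have h1 : |u n - u 0| ≤ ∑ k ∈ Finset.range n, |u (k + 1) - u k| := by
      rw [← Finset.sum_range_sub]; exact Finset.abs_sum_le_sum_abs _ _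
    have h2 : ∑ k ∈ Finset.range n, |u (k + 1) - u k| ≤ a * CP * S := by
      refine (Finset.sum_le_sum fun k _ => hstep k).trans ?_
      rw [← Finset.mul_sum]
      gcongr
      exact hS n
    have h3 := abs_sub_abs_le_abs_sub (u n) (u 0)
    linarith
  have hlim := (hX.tendsto_average_ballX hU hφ hx).abs
  have := le_of_tendsto hlim (.of_forall hsum)
  simpa [hu] using this

/-- `Ω` has finite control diameter, so `B_{2^k r}(x)` contains it for one `k` valid at every
centre; doubling brings the volume bound down to radius `r`. -/
lemma exists_le_volume_ballX (hX : Admissible X U Q) (hU : IsOpen U) (hΩo : IsOpen Ω)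
    (hΩ : Bornology.IsBounded Ω) (hΩU : U = Ω ∨ closure Ω ⊆ U) {x₀ : E N} (hx₀ : x₀ ∈ Ω)
    {r : ℝ} (hr : 0 < r) : ∃ b > 0, ∀ x ∈ Ω, b ≤ volume.real (ballX X U x r) := by
  have hsub : Ω ⊆ U := by
    rcases hΩU with rfl | h
    · exact subset_rfl
    · exact subset_closure.trans h
  obtain ⟨D, hD, hDΩ⟩ := hX.exists_dX_lt hU hΩ hΩU (hsub hx₀)
  obtain ⟨k, hk⟩ := pow_unbounded_of_one_lt (2 * D / r) one_lt_two
  rw [div_lt_iff₀ hr] at hk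
  have hΩ0 : 0 < volume.real Ω :=
    ENNReal.toReal_pos (hΩo.measure_pos volume ⟨x₀, hx₀⟩).ne' hΩ.measure_lt_top.ne
  refine ⟨volume.real Ω / ((2 : ℝ) ^ Q) ^ k, by positivity, fun x hx => ?_⟩
  rw [div_le_iff₀ (by positivity), mul_comm]
  refine le_trans ?_ (hX.volume_real_ballX_two_pow_mul_le (hsub hx) hr k)
  refine measureReal_mono (fun y hy => ⟨hsub hy, ?_⟩) (hX.volume_ballX_lt_top (hsub hx) _).ne
  have := dX_triangle hX.lipschitz hX.connected (hsub hx) (hsub hx₀) (hsub hy)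
  rw [dX_comm hX.lipschitz x x₀] at this
  linarith [hDΩ x hx, hDΩ y hy]

/-- The pointwise estimate of a test function by the maximal function of its gradient. -/
lemma exists_abs_le_maximal (hX : Admissible X U Q) (hU : IsOpen U) (hN : N ≠ 0) (hΩo : IsOpen Ω)
    (hΩ : Bornology.IsBounded Ω) (hΩU : U = Ω ∨ closure Ω ⊆ U) {x₀ : E N} (hx₀ : x₀ ∈ Ω) :
    ∃ C₁ C₂ ν : ℝ, 0 ≤ C₁ ∧ 0 ≤ C₂ ∧ 0 < ν ∧ ∀ φ : E N → ℝ, IsTest Ω φ → ∀ x ∈ Ω,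
      |φ x| ≤ C₁ * (eLpNorm (gradX X φ) 2 (volume.restrict Ω)).toReal +
        C₂ * (eLpNorm (gradX X φ) 2 (volume.restrict Ω)).toReal ^ (2 / Q) *
          (maximal X U (fun k => ν * (1 / 2) ^ k) (fun y => ‖gradX X φ y‖ₑ) x).toReal ^
            (1 - 2 / Q) := by
  have hsub : Ω ⊆ U := by
    rcases hΩU with rfl | h
    · exact subset_rfl
    · exact subset_closure.trans h
  have hΩt : volume Ω ≠ ⊤ := hΩ.measure_lt_top.ne
  have hQ0 : 0 < Q := by linarith [hX.two_lt]
  obtain ⟨CF, hCF, HF⟩ := hX.friedrichs hU hN hΩ hΩU hx₀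
  obtain ⟨CT, ν, hCT, hν, HT⟩ := hX.exists_abs_le_of_sum_le (Ω := Ω) hU
  obtain ⟨CH, hCH, HH⟩ := exists_hedberg_sum_le hX.two_lt
  obtain ⟨b₁, hb₁, Hb₁⟩ := hX.exists_le_volume_ballX hU hΩo hΩ hΩU hx₀ one_pos
  obtain ⟨b, hb, Hb⟩ := hX.exists_le_volume_ballX hU hΩo hΩ hΩU hx₀ hν
  refine ⟨CF * volume.real Ω ^ (1 / 2 : ℝ) / b₁, CT * (CH * (b ^ (-(1 / 2) : ℝ)) ^ (2 / Q)), ν,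
    by positivity, by positivity, hν, fun φ hφ x hx => ?_⟩
  set G := (eLpNorm (gradX X φ) 2 (volume.restrict Ω)).toReal with hG
  have hG0 : 0 ≤ G := ENNReal.toReal_nonneg
  set Mx := maximal X U (fun k => ν * (1 / 2) ^ k) (fun y => ‖gradX X φ y‖ₑ) x with hMx
  have hxU := hsub hx
  have hc := continuous_gradX hX.lipschitz hφ.contDiff_one
  have hMt : Mx ≠ ⊤ := by
    obtain ⟨c, hc⟩ := (hφ.hasCompactSupport_gradX (X := X)).exists_bound_of_continuous hc
    refine ne_top_of_le_ne_top (ENNReal.ofReal_ne_top (r := c)) (iSup_le fun k =>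
      ballAverage_le_of_le (fun y => ?_) _ _)
    rw [← ofReal_norm]
    exact ENNReal.ofReal_le_ofReal (hc y)
  have hmean : |⨍ y in ballX X U x 1, φ y| ≤ CF * volume.real Ω ^ (1 / 2 : ℝ) / b₁ * G := by
    have hv := hX.volume_real_ballX_pos hxU one_pos
    rw [setAverage_eq, smul_eq_mul, abs_mul, abs_inv, abs_of_pos hv, inv_mul_le_iff₀ hv]
    calc |∫ y in ballX X U x 1, φ y| ≤ ∫ y in ballX X U x 1, |φ y| := abs_integral_le_integral_abs
      _ ≤ ∫ y, |φ y| := integral_mono_measure Measure.restrict_le_self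
          (ae_of_all _ fun _ => abs_nonneg _) hφ.integrable.abs
      _ ≤ CF * ∫ y, ‖gradX X φ y‖ := HF φ hφ
      _ ≤ CF * (G * volume.real Ω ^ (1 / 2 : ℝ)) := by
          gcongr; exact hφ.integral_norm_gradX_le_volume hX.lipschitz hΩt
      _ = b₁ * (CF * volume.real Ω ^ (1 / 2 : ℝ) / b₁ * G) := by field_simp
      _ ≤ _ := by gcongr; exact Hb₁ x hx
  refine (HT φ hφ x hxU _ (HH Mx.toReal (G * b ^ (-(1 / 2) : ℝ)) _ (by positivity) ?_ ?_ ?_)).trans ?_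
  · intro k
    rw [setAverage_eq, smul_eq_mul]
    exact mul_nonneg (by positivity) (integral_nonneg fun _ => norm_nonneg _)
  · intro k
    rw [setAverage_eq, smul_eq_mul, integral_norm_eq_lintegral_enorm hc.aestronglyMeasurable,
      Measure.real, ← ENNReal.toReal_inv, ← ENNReal.toReal_mul, mul_comm, ← div_eq_mul_inv]
    exact ENNReal.toReal_mono hMt (le_iSup (fun k : ℕ =>
      ballAverage X U (fun y => ‖gradX X φ y‖ₑ) (ν * (1 / 2) ^ k) x) k)
  -- Cauchy–Schwarz bounds the mean by `G v^{-1/2}`, and doubling down from radius `ν` gives `v ≥ b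
  -- / 2^{kQ}`.
  · intro k
    have hk : 0 < ν * (1 / 2) ^ k := by positivity
    set v := volume.real (ballX X U x (ν * (1 / 2) ^ k)) with hv
    have hv0 : 0 < v := hX.volume_real_ballX_pos hxU hk
    have hbv : b ≤ ((2 : ℝ) ^ Q) ^ k * v := by
      refine (Hb x hx).trans ?_
      have := hX.volume_real_ballX_two_pow_mul_le hxU hk k
      rwa [show (2 : ℝ) ^ k * (ν * (1 / 2) ^ k) = ν by
        rw [mul_left_comm, ← mul_pow]; norm_num] at this
    rw [setAverage_eq, smul_eq_mul, ← hv]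
    calc v⁻¹ * ∫ y in ballX X U x (ν * (1 / 2) ^ k), ‖gradX X φ y‖
        ≤ v⁻¹ * (G * v ^ (1 / 2 : ℝ)) := by
          gcongr
          exact hφ.integral_norm_gradX_le hX.lipschitz (hX.volume_ballX_lt_top hxU _).ne
      _ = G * v ^ (-(1 / 2) : ℝ) := by
          rw [mul_left_comm, ← Real.rpow_neg_one v, ← Real.rpow_add hv0]; norm_num
      _ ≤ G * (b / ((2 : ℝ) ^ Q) ^ k) ^ (-(1 / 2) : ℝ) := by
          refine mul_le_mul_of_nonneg_left ?_ hG0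
          refine Real.rpow_le_rpow_of_nonpos (by positivity) ?_ (by norm_num)
          rw [div_le_iff₀ (by positivity), mul_comm]; exact hbv
      _ = _ := by
          rw [Real.div_rpow hb.le (by positivity), div_eq_mul_inv, ← Real.rpow_neg (by positivity),
            ← mul_assoc, neg_neg]
          congr 1
          rw [← Real.rpow_natCast, ← Real.rpow_natCast, ← Real.rpow_mul two_pos.le,
            ← Real.rpow_mul two_pos.le, ← Real.rpow_mul two_pos.le]
          congr 1; ring
  · rw [Real.mul_rpow hG0 (by positivity)]
    refine (add_le_add_left hmean _).trans (le_of_eq ?_)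
    ring

/-- The Sobolev inequality for test functions. -/
lemma exists_eLpNorm_le (hX : Admissible X U Q) (hU : IsOpen U) (hN : N ≠ 0) (hΩo : IsOpen Ω)
    (hΩ : Bornology.IsBounded Ω) (hΩU : U = Ω ∨ closure Ω ⊆ U) :
    ∃ S : ℝ≥0, ∀ φ : E N → ℝ, IsTest Ω φ →
      eLpNorm φ (ENNReal.ofReal (2 * Q / (Q - 2))) (volume.restrict Ω) ≤
        S * eLpNorm (gradX X φ) 2 (volume.restrict Ω) := by
  rcases Ω.eq_empty_or_nonempty with rfl | ⟨x₀, hx₀⟩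
  · exact ⟨0, fun φ _ => by simp⟩
  have hsub : Ω ⊆ U := by
    rcases hΩU with rfl | h
    · exact subset_rfl
    · exact subset_closure.trans h
  have hΩt : volume Ω ≠ ⊤ := hΩ.measure_lt_top.ne
  have hQ := hX.two_lt
  have hQ0 : 0 < Q := by linarith
  have hQ2 : 0 < Q - 2 := by linarith
  obtain ⟨C₁, C₂, ν, hC₁, hC₂, hν, H⟩ := hX.exists_abs_le_maximal hU hN hΩo hΩ hΩU hx₀
  set ρ : ℕ → ℝ := fun k => ν * (1 / 2) ^ k with hρ
  have hρ0 : ∀ k, 0 < ρ k := fun k => by positivity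
  have hρν : ∀ k, ρ k ≤ ν := fun k =>
    mul_le_of_le_one_right hν.le (pow_le_one₀ (by norm_num) (by norm_num))
  set t : ℝ := 1 - 2 / Q with ht
  have ht0 : 0 < t := by rw [ht, sub_pos, div_lt_one hQ0]; exact hQ
  set q : ℝ≥0∞ := ENNReal.ofReal (2 * Q / (Q - 2)) with hq
  have hqpos : 0 < 2 * Q / (Q - 2) := by positivity
  have hq1 : 1 ≤ q := by
    rw [hq, ENNReal.one_le_ofReal, one_le_div hQ2]; linarith
  -- This identity turns the `L^q` norm of `M^t` into the power `t` of its `L²` norm; `2 / Q + t =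
  -- 1` then restores homogeneity in the gradient.
  have hqt : q * ENNReal.ofReal t = 2 := by
    rw [hq, ← ENNReal.ofReal_mul hqpos.le,
      show 2 * Q / (Q - 2) * t = 2 by rw [ht]; field_simp]
    simp
  set A : ℝ≥0∞ := 8 * ENNReal.ofReal ((2 : ℝ) ^ Q) ^ 3 with hA
  have hAt : A ≠ ⊤ := by simp [hA, ENNReal.mul_eq_top]
  set S : ℝ≥0∞ := ENNReal.ofReal C₁ * volume Ω ^ (1 / q.toReal) +
    ENNReal.ofReal C₂ * (A ^ (1 / 2 : ℝ)) ^ t with hS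
  have hSt : S ≠ ⊤ := by
    refine ENNReal.add_ne_top.2 ⟨ENNReal.mul_ne_top ENNReal.ofReal_ne_top
      (ENNReal.rpow_ne_top_of_nonneg (by positivity) hΩt),
      ENNReal.mul_ne_top ENNReal.ofReal_ne_top (ENNReal.rpow_ne_top_of_nonneg ht0.le
        (ENNReal.rpow_ne_top_of_nonneg (by norm_num) hAt))⟩
  refine ⟨S.toNNReal, fun φ hφ => ?_⟩
  rw [ENNReal.coe_toNNReal hSt]
  set Γ := eLpNorm (gradX X φ) 2 (volume.restrict Ω) with hΓ
  have hΓt : Γ ≠ ⊤ := (hφ.memLp_gradX hX.lipschitz 2 _).eLpNorm_ne_top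
  set M := maximal X U ρ (fun y => ‖gradX X φ y‖ₑ) with hM
  have hc := continuous_gradX hX.lipschitz hφ.contDiff_one
  have hgm : Measurable fun y => ‖gradX X φ y‖ₑ := hc.enorm.measurable
  have hMm : AEMeasurable (fun x => (M x).toReal) (volume.restrict Ω) :=
    ((hX.aemeasurable_maximal hU hgm ρ).mono_measure
      (Measure.restrict_mono_set _ hsub)).ennreal_toReal
  have hM2 : eLpNorm (fun x => (M x).toReal) 2 (volume.restrict Ω) ≤ A ^ (1 / 2 : ℝ) * Γ := by
    obtain ⟨c, hcb⟩ := (hφ.hasCompactSupport_gradX (X := X)).exists_bound_of_continuous hc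
    have h1 := hX.lintegral_maximal_sq_le hU hρ0 hρν hgm (c := ENNReal.ofReal c)
      ENNReal.ofReal_ne_top fun y => by
        rw [← ofReal_norm]
        exact ENNReal.ofReal_le_ofReal (hcb y)
    have h2 : ∫⁻ x in U, ‖gradX X φ x‖ₑ ^ 2 = ∫⁻ x in Ω, ‖gradX X φ x‖ₑ ^ 2 := by
      have : (fun x => ‖gradX X φ x‖ₑ ^ 2) = Ω.indicator fun x => ‖gradX X φ x‖ₑ ^ 2 := by
        refine (Set.indicator_eq_self.2 fun y hy => ?_).symm
        by_contra hyΩ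
        exact hy (by simp [hφ.gradX_eq_zero_of_notMem hyΩ])
      rw [this, setLIntegral_indicator hΩo.measurableSet, Set.inter_eq_left.2 hsub, ← this]
    have h3 : ∀ (f : E N → ℝ), eLpNorm f 2 (volume.restrict Ω) =
        (∫⁻ x in Ω, ‖f x‖ₑ ^ 2) ^ (1 / 2 : ℝ) := fun f => by
      rw [eLpNorm_eq_lintegral_rpow_enorm_toReal two_ne_zero ENNReal.ofNat_ne_top]
      simp
    have h4 : Γ = (∫⁻ x in Ω, ‖gradX X φ x‖ₑ ^ 2) ^ (1 / 2 : ℝ) := by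
      rw [hΓ, eLpNorm_eq_lintegral_rpow_enorm_toReal two_ne_zero ENNReal.ofNat_ne_top]
      simp
    rw [h3, h4, ← ENNReal.mul_rpow_of_nonneg _ _ (by norm_num)]
    refine ENNReal.rpow_le_rpow ?_ (by norm_num)
    calc ∫⁻ x in Ω, ‖(M x).toReal‖ₑ ^ 2 ≤ ∫⁻ x in U, M x ^ 2 := by
          refine (lintegral_mono fun x => ?_).trans (lintegral_mono_set hsub)
          gcongr
          rw [← ofReal_norm, Real.norm_of_nonneg ENNReal.toReal_nonneg]
          exact ENNReal.ofReal_toReal_le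
      _ ≤ A * ∫⁻ x in U, ‖gradX X φ x‖ₑ ^ 2 := h1
      _ = _ := by rw [h2]
  set G := Γ.toReal with hG
  have hGΓ : ENNReal.ofReal G = Γ := ENNReal.ofReal_toReal hΓt
  have hG0 : 0 ≤ G := ENNReal.toReal_nonneg
  have hpt : ∀ᵐ x ∂volume.restrict Ω, ‖φ x‖ ≤
      C₁ * G + (C₂ * G ^ (2 / Q)) * ‖(M x).toReal‖ ^ t := by
    refine (ae_restrict_iff' hΩo.measurableSet).2 (ae_of_all _ fun x hx => ?_)
    rw [Real.norm_eq_abs, Real.norm_of_nonneg ENNReal.toReal_nonneg]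
    exact H φ hφ x hx
  have hmt : AEStronglyMeasurable (fun x => (C₂ * G ^ (2 / Q)) * ‖(M x).toReal‖ ^ t)
      (volume.restrict Ω) := ((hMm.norm.pow_const t).const_mul _).aestronglyMeasurable
  calc eLpNorm φ q (volume.restrict Ω)
      ≤ eLpNorm (fun x => C₁ * G + (C₂ * G ^ (2 / Q)) * ‖(M x).toReal‖ ^ t) q
          (volume.restrict Ω) := eLpNorm_mono_ae_real hpt
    _ ≤ eLpNorm (fun _ => C₁ * G) q (volume.restrict Ω) +
        eLpNorm (fun x => (C₂ * G ^ (2 / Q)) * ‖(M x).toReal‖ ^ t) q (volume.restrict Ω) :=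
        eLpNorm_add_le aestronglyMeasurable_const hmt hq1
    _ ≤ ENNReal.ofReal C₁ * Γ * volume Ω ^ (1 / q.toReal) +
        ENNReal.ofReal C₂ * Γ ^ (2 / Q) * (A ^ (1 / 2 : ℝ) * Γ) ^ t := by
        gcongr
        · rw [eLpNorm_const' _ (by positivity) ENNReal.ofReal_ne_top, Measure.restrict_apply_univ,
            Real.enorm_of_nonneg (by positivity), ENNReal.ofReal_mul hC₁, hGΓ]
        · have h5 := eLpNorm_const_smul (C₂ * G ^ (2 / Q)) (fun x => ‖(M x).toReal‖ ^ t) q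
            (volume.restrict Ω)
          have h6 : ((C₂ * G ^ (2 / Q)) • fun x => ‖(M x).toReal‖ ^ t) =
            fun x => (C₂ * G ^ (2 / Q)) * ‖(M x).toReal‖ ^ t := rfl
          rw [h6] at h5
          rw [h5, eLpNorm_norm_rpow _ ht0, hqt, Real.enorm_of_nonneg (by positivity),
            ENNReal.ofReal_mul hC₂, ← ENNReal.ofReal_rpow_of_nonneg hG0 (by positivity), hGΓ]
          gcongr
    _ = S * Γ := by
        rw [ENNReal.mul_rpow_of_nonneg _ _ ht0.le, hS, add_mul]
        congr 1
        · ring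
        · rw [show ENNReal.ofReal C₂ * Γ ^ (2 / Q) * ((A ^ (1 / 2 : ℝ)) ^ t * Γ ^ t) =
            ENNReal.ofReal C₂ * (A ^ (1 / 2 : ℝ)) ^ t * (Γ ^ (2 / Q) * Γ ^ t) by ring,
            ← ENNReal.rpow_add_of_nonneg _ _ (by positivity) ht0.le,
            show 2 / Q + t = 1 by rw [ht]; ring, ENNReal.rpow_one]

end Admissible

end XElliptic

namespace XElliptic

/-! ### The spaces `W_0^{1,2}` -/

variable {N m : ℕ} {X : Fields N m} {U Ω : Set (E N)} {Q : ℝ}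

/-- The approximating test functions can be chosen to converge almost everywhere. -/
lemma IsW0.exists_seq_tendsto_ae {u : E N → ℝ} {g : E N → E m} (h : IsW0 X Ω 2 u g) :
    ∃ φ : ℕ → E N → ℝ, (∀ n, IsTest Ω (φ n)) ∧
      Tendsto (fun n => eLpNorm (fun x => φ n x - u x) 2 (volume.restrict Ω)) atTop (𝓝 0) ∧
      Tendsto (fun n => eLpNorm (fun x => gradX X (φ n) x - g x) 2 (volume.restrict Ω)) atTop
        (𝓝 0) ∧
      ∀ᵐ x ∂volume.restrict Ω, Tendsto (fun n => φ n x) atTop (𝓝 (u x)) := by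
  obtain ⟨hu, -, φ, hφ, h1, h2⟩ := h
  have hm : TendstoInMeasure (volume.restrict Ω) φ atTop u :=
    tendstoInMeasure_of_tendsto_eLpNorm two_ne_zero
      (fun n => (hφ n).1.continuous.aestronglyMeasurable) hu.1 h1
  obtain ⟨ns, hns, hae⟩ := hm.exists_seq_tendsto_ae
  exact ⟨fun n => φ (ns n), fun n => hφ _, h1.comp hns.tendsto_atTop, h2.comp hns.tendsto_atTop,
    hae⟩

/-- The Sobolev inequality extends from test functions to `W_0^{1,2}`. -/
lemma IsW0.eLpNorm_le (hX : ∀ j, LocallyLipschitz (X j)) {q : ℝ≥0∞} {S : ℝ≥0}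
    (hS : ∀ φ : E N → ℝ, IsTest Ω φ → eLpNorm φ q (volume.restrict Ω) ≤
      S * eLpNorm (gradX X φ) 2 (volume.restrict Ω)) {u : E N → ℝ} {g : E N → E m}
    (h : IsW0 X Ω 2 u g) :
    eLpNorm u q (volume.restrict Ω) ≤ S * eLpNorm g 2 (volume.restrict Ω) := by
  obtain ⟨φ, hφ, -, h2, hae⟩ := h.exists_seq_tendsto_ae
  -- Fatou's lemma: no convergence in `L^q` is known, only almost everywhere.
  refine (Lp.eLpNorm_lim_le_liminf_eLpNorm
    (fun n => (hφ n).1.continuous.aestronglyMeasurable) u hae).trans ?_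
  have hle : ∀ n, eLpNorm (φ n) q (volume.restrict Ω) ≤
      S * (eLpNorm (fun x => gradX X (φ n) x - g x) 2 (volume.restrict Ω) +
        eLpNorm g 2 (volume.restrict Ω)) := fun n => by
    refine (hS _ (hφ n)).trans ?_
    gcongr
    have := eLpNorm_add_le (p := 2) (μ := volume.restrict Ω)
      (((continuous_gradX hX (hφ n).contDiff_one).aestronglyMeasurable).sub h.2.1.1) h.2.1.1
      (by norm_num)
    rw [sub_add_cancel] at this
    exact this
  have hlim : Tendsto (fun n => S * (eLpNorm (fun x => gradX X (φ n) x - g x) 2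
      (volume.restrict Ω) + eLpNorm g 2 (volume.restrict Ω))) atTop
      (𝓝 (S * (0 + eLpNorm g 2 (volume.restrict Ω)))) :=
    ENNReal.Tendsto.const_mul (h2.add_const _) (.inr ENNReal.coe_ne_top)
  rw [zero_add] at hlim
  exact (liminf_le_liminf (.of_forall hle)).trans hlim.liminf_eq.le

lemma gradX_comp {G : ℝ → ℝ} (hG : Differentiable ℝ G) {φ : E N → ℝ} (hφ : Differentiable ℝ φ)
    (x : E N) : gradX X (fun y => G (φ y)) x = deriv G (φ x) • gradX X φ x := by
  have : fderiv ℝ (fun y => G (φ y)) x = deriv G (φ x) • fderiv ℝ φ x :=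
    ((hG (φ x)).hasDerivAt.comp_hasFDerivAt x (hφ x).hasFDerivAt).fderiv
  ext j
  simp [gradX, this]

lemma IsTest.comp {G : ℝ → ℝ} (hG : ContDiff ℝ ∞ G) (hG0 : G 0 = 0) {φ : E N → ℝ}
    (hφ : IsTest Ω φ) : IsTest Ω fun x => G (φ x) :=
  ⟨hG.comp hφ.1, hφ.2.1.comp_left hG0, (tsupport_comp_subset hG0 φ).trans hφ.2.2⟩

/-- The chain rule in `W_0^{1,2}`. -/
lemma IsW0.comp (hX : ∀ j, LocallyLipschitz (X j)) {G : ℝ → ℝ} (hG : ContDiff ℝ ∞ G)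
    (hG0 : G 0 = 0) {M : ℝ≥0} (hM : ∀ s, ‖deriv G s‖₊ ≤ M) {u : E N → ℝ} {g : E N → E m}
    (h : IsW0 X Ω 2 u g) :
    IsW0 X Ω 2 (fun x => G (u x)) fun x => deriv G (u x) • g x := by
  obtain ⟨φ, hφ, h1, h2, hae⟩ := h.exists_seq_tendsto_ae
  have hu := h.1
  have hg := h.2.1
  have hGd : Differentiable ℝ G := hG.differentiable (by simp)
  have hG' : Continuous (deriv G) := hG.continuous_deriv (by simp)
  have hLip : LipschitzWith M G := lipschitzWith_of_nnnorm_deriv_le hGd hM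
  have hM' : ∀ s, ‖deriv G s‖ ≤ M := fun s => by exact_mod_cast hM s
  have hGum : AEStronglyMeasurable (fun x => deriv G (u x)) (volume.restrict Ω) :=
    hG'.comp_aestronglyMeasurable hu.1
  refine ⟨MemLp.of_le_mul hu (hLip.continuous.comp_aestronglyMeasurable hu.1) (c := M)
    (ae_of_all _ fun x => ?_), MemLp.of_le_mul hg (hGum.smul hg.1) (c := M)
    (ae_of_all _ fun x => ?_), fun n x => G (φ n x), fun n => (hφ n).comp hG hG0, ?_, ?_⟩
  · simpa [hG0] using hLip.norm_sub_le (u x) 0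
  · rw [norm_smul]; gcongr; exact hM' _
  · have hlim : Tendsto (fun n => M * eLpNorm (fun x => φ n x - u x) 2 (volume.restrict Ω)) atTop
        (𝓝 (M * 0)) := ENNReal.Tendsto.const_mul h1 (.inr ENNReal.coe_ne_top)
    rw [mul_zero] at hlim
    refine tendsto_of_tendsto_of_tendsto_of_le_of_le tendsto_const_nhds hlim (fun _ => zero_le)
      fun n => ?_
    refine eLpNorm_le_nnreal_smul_eLpNorm_of_ae_le_mul (ae_of_all _ fun x => ?_) 2
    exact_mod_cast hLip.norm_sub_le (φ n x) (u x)
  · have hgc : ∀ n, Continuous (gradX X (φ n)) := fun n => continuous_gradX hX (hφ n).contDiff_one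
    have hDm : ∀ n, AEStronglyMeasurable (fun x => (deriv G (φ n x) - deriv G (u x)) • g x)
        (volume.restrict Ω) := fun n =>
      ((hG'.comp (hφ n).1.continuous).aestronglyMeasurable.sub hGum).smul hg.1
    have hlim1 : Tendsto (fun n => M * eLpNorm (fun x => gradX X (φ n) x - g x) 2
        (volume.restrict Ω)) atTop (𝓝 (M * 0)) :=
      ENNReal.Tendsto.const_mul h2 (.inr ENNReal.coe_ne_top)
    -- Dominated convergence with majorant `(2M)² |g|²`, since `deriv G` is continuous and bounded
    -- by `M`.
    have hlim2 : Tendsto (fun n => eLpNorm (fun x => (deriv G (φ n x) - deriv G (u x)) • g x) 2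
        (volume.restrict Ω)) atTop (𝓝 0) := by
      have hnorm : ∀ f : E N → E m, eLpNorm f 2 (volume.restrict Ω) =
          (∫⁻ x in Ω, ‖f x‖ₑ ^ 2) ^ (1 / 2 : ℝ) := fun f => by
        rw [eLpNorm_eq_lintegral_rpow_enorm_toReal two_ne_zero ENNReal.ofNat_ne_top]
        simp
      have hgfin : ∫⁻ x in Ω, ‖g x‖ₑ ^ 2 ≠ ⊤ := by
        have := hg.2.ne
        rw [hnorm] at this
        intro htop
        rw [htop] at this
        exact this (ENNReal.top_rpow_of_pos (by norm_num))
      have hdct := tendsto_lintegral_of_dominated_convergence' (μ := volume.restrict Ω)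
        (F := fun n x => ‖(deriv G (φ n x) - deriv G (u x)) • g x‖ₑ ^ 2) (f := fun _ => 0)
        (fun x => (2 * M : ℝ≥0∞) ^ 2 * ‖g x‖ₑ ^ 2) (fun n => (hDm n).enorm.pow_const 2)
        (fun n => ae_of_all _ fun x => ?_) ?_ ?_
      · simp_rw [hnorm]
        have := (ENNReal.continuous_rpow_const (y := (1 / 2 : ℝ))).tendsto _ |>.comp hdct
        simpa [Function.comp_def] using this
      · dsimp only
        rw [← mul_pow, enorm_smul]
        gcongr
        have h3 : ‖deriv G (φ n x) - deriv G (u x)‖ₑ ≤ ‖deriv G (φ n x)‖ₑ + ‖deriv G (u x)‖ₑ := by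
          rw [sub_eq_add_neg]
          exact (enorm_add_le _ _).trans (by rw [enorm_neg])
        refine h3.trans ?_
        rw [two_mul]
        exact add_le_add (ENNReal.coe_le_coe.2 (hM _)) (ENNReal.coe_le_coe.2 (hM _))
      · rw [lintegral_const_mul' _ _ (by simp [ENNReal.mul_eq_top])]
        exact ENNReal.mul_ne_top (by simp [ENNReal.mul_eq_top]) hgfin
      · filter_upwards [hae] with x hx
        have h4 : Tendsto (fun n => (deriv G (φ n x) - deriv G (u x)) • g x) atTop
            (𝓝 ((deriv G (u x) - deriv G (u x)) • g x)) :=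
          (((hG'.tendsto _).comp hx).sub_const _).smul_const _
        have h5 := (continuous_enorm.tendsto _).comp h4
        have h6 := ((ENNReal.continuous_pow 2).tendsto _).comp h5
        simpa [Function.comp_def] using h6
    rw [mul_zero] at hlim1
    have hlim := hlim1.add hlim2
    rw [add_zero] at hlim
    refine tendsto_of_tendsto_of_tendsto_of_le_of_le tendsto_const_nhds hlim (fun _ => zero_le)
      fun n => ?_
    have hsplit : (fun x => gradX X (fun y => G (φ n y)) x - deriv G (u x) • g x) =
        fun x => deriv G (φ n x) • (gradX X (φ n) x - g x) +
          (deriv G (φ n x) - deriv G (u x)) • g x := by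
      funext x
      rw [gradX_comp hGd ((hφ n).contDiff_one.differentiable one_ne_zero), smul_sub, sub_smul]
      abel
    dsimp only
    rw [hsplit]
    refine (eLpNorm_add_le (((hG'.comp (hφ n).1.continuous).aestronglyMeasurable).smul
      ((hgc n).aestronglyMeasurable.sub hg.1)) (hDm n) (by norm_num)).trans ?_
    gcongr
    refine eLpNorm_le_nnreal_smul_eLpNorm_of_ae_le_mul (ae_of_all _ fun x => ?_) 2
    change ‖deriv G (φ n x) • (gradX X (φ n) x - g x)‖₊ ≤ _
    rw [nnnorm_smul]
    gcongr
    exact hM _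

end XElliptic

namespace XElliptic

/-! ### Smooth bounded substitutes for powers -/

/-- A smooth truncation of `s ^ 2` at height `k ^ 2`. -/
noncomputable def sqTrunc (k ε s : ℝ) : ℝ := k ^ 2 * (s ^ 2 + ε) / (k ^ 2 + s ^ 2)

/-- A truncation of `s |s| ^ (2σ)` of linear growth. -/
noncomputable def powTrunc (σ k ε s : ℝ) : ℝ := s * sqTrunc k ε s ^ σ

/-- The logarithmic derivative of `sqTrunc k ε`, multiplied by `s`. -/
noncomputable def logSlope (k ε s : ℝ) : ℝ :=
  2 * s ^ 2 * (k ^ 2 - ε) / ((s ^ 2 + ε) * (k ^ 2 + s ^ 2))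

section Trunc

variable {σ k ε : ℝ}

lemma sqTrunc_pos (hk : 0 < k) (hε : 0 < ε) (s : ℝ) : 0 < sqTrunc k ε s := by
  unfold sqTrunc; positivity

lemma sqTrunc_nonneg (hε : 0 ≤ ε) (s : ℝ) : 0 ≤ sqTrunc k ε s := by
  unfold sqTrunc; positivity

lemma sqTrunc_le (hk : 0 < k) (hεk : ε ≤ k ^ 2) (s : ℝ) : sqTrunc k ε s ≤ k ^ 2 := by
  unfold sqTrunc
  rw [div_le_iff₀ (by positivity)]
  gcongr 1
  linarith

lemma sqTrunc_mono {ε' : ℝ} (h : ε ≤ ε') (s : ℝ) : sqTrunc k ε s ≤ sqTrunc k ε' s := by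
  unfold sqTrunc; gcongr

lemma sqTrunc_zero_le_sq (hk : 0 < k) (s : ℝ) : sqTrunc k 0 s ≤ s ^ 2 := by
  unfold sqTrunc
  rw [add_zero, div_le_iff₀ (by positivity)]
  nlinarith [sq_nonneg s, mul_self_nonneg (s ^ 2)]

lemma abs_powTrunc (hε : 0 ≤ ε) (s : ℝ) : |powTrunc σ k ε s| = |s| * sqTrunc k ε s ^ σ := by
  rw [powTrunc, abs_mul, abs_of_nonneg (Real.rpow_nonneg (sqTrunc_nonneg hε s) σ)]

lemma abs_powTrunc_le (hσ : 0 ≤ σ) (hk : 0 < k) (hε : 0 ≤ ε) (hεk : ε ≤ k ^ 2) (s : ℝ) :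
    |powTrunc σ k ε s| ≤ (k ^ 2) ^ σ * |s| := by
  rw [abs_powTrunc hε, mul_comm]
  gcongr
  · exact sqTrunc_nonneg hε s
  · exact sqTrunc_le hk hεk s

/-- This allows `ε = 0` on the left of the energy estimate before the limit is taken on the right.
-/
lemma abs_powTrunc_zero_le (hσ : 0 ≤ σ) (hε : 0 ≤ ε) (s : ℝ) :
    |powTrunc σ k 0 s| ≤ |powTrunc σ k ε s| := by
  rw [abs_powTrunc hε, abs_powTrunc le_rfl]
  gcongr
  · exact sqTrunc_nonneg le_rfl s
  · exact sqTrunc_mono hε s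

lemma logSlope_nonneg (hε : 0 ≤ ε) (hεk : ε ≤ k ^ 2) (s : ℝ) : 0 ≤ logSlope k ε s := by
  unfold logSlope
  have : 0 ≤ k ^ 2 - ε := by linarith
  positivity

lemma logSlope_le (hk : 0 < k) (hε : 0 < ε) (s : ℝ) : logSlope k ε s ≤ 2 := by
  unfold logSlope
  rw [div_le_iff₀ (by positivity)]
  nlinarith [mul_nonneg hε.le (sq_nonneg k), mul_nonneg hε.le (sq_nonneg s), sq_nonneg (s ^ 2)]

lemma hasDerivAt_sqTrunc (hk : 0 < k) (s : ℝ) :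
    HasDerivAt (sqTrunc k ε) (2 * s * k ^ 2 * (k ^ 2 - ε) / (k ^ 2 + s ^ 2) ^ 2) s := by
  have h1 : HasDerivAt (fun s : ℝ => k ^ 2 * (s ^ 2 + ε)) (k ^ 2 * (2 * s)) s := by
    simpa using (((hasDerivAt_id s).pow 2).add_const ε).const_mul (k ^ 2)
  have h2 : HasDerivAt (fun s : ℝ => k ^ 2 + s ^ 2) (2 * s) s := by
    simpa using ((hasDerivAt_id s).pow 2).const_add (k ^ 2)
  refine HasDerivAt.congr_deriv (h1.div h2 (by positivity)) ?_
  congr 1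
  ring

/-- The form through the logarithmic derivative isolates the factor `sqTrunc k ε s ^ σ`, so that
derivatives for `σ` and `2σ` can be compared. -/
lemma hasDerivAt_powTrunc (hk : 0 < k) (hε : 0 < ε) (s : ℝ) :
    HasDerivAt (powTrunc σ k ε) (sqTrunc k ε s ^ σ * (1 + σ * logSlope k ε s)) s := by
  have hw := sqTrunc_pos hk hε s
  have h1 := (hasDerivAt_id s).mul ((hasDerivAt_sqTrunc hk s).rpow_const (p := σ) (.inl hw.ne'))
  refine HasDerivAt.congr_deriv h1 ?_
  rw [Real.rpow_sub_one hw.ne', id, one_mul, mul_add, mul_one]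
  congr 1
  unfold logSlope sqTrunc
  field_simp

lemma deriv_powTrunc (hk : 0 < k) (hε : 0 < ε) (s : ℝ) :
    deriv (powTrunc σ k ε) s = sqTrunc k ε s ^ σ * (1 + σ * logSlope k ε s) :=
  (hasDerivAt_powTrunc hk hε s).deriv

/-- For `ε > 0` the base of the real power never vanishes; smoothness at `s = 0` is what `ε` is for.
-/
lemma contDiff_powTrunc (hk : 0 < k) (hε : 0 < ε) : ContDiff ℝ ∞ (powTrunc σ k ε) := by
  have h1 : ContDiff ℝ ∞ (sqTrunc k ε) := by
    unfold sqTrunc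
    refine ContDiff.div (by fun_prop) (by fun_prop) fun s => by positivity
  exact contDiff_id.mul (h1.rpow_const_of_ne fun s => (sqTrunc_pos hk hε s).ne')

lemma powTrunc_zero_right : powTrunc σ k ε 0 = 0 := by simp [powTrunc]

lemma deriv_powTrunc_nonneg (hσ : 0 ≤ σ) (hk : 0 < k) (hε : 0 < ε) (hεk : ε ≤ k ^ 2) (s : ℝ) :
    0 ≤ deriv (powTrunc σ k ε) s := by
  rw [deriv_powTrunc hk hε]
  have := sqTrunc_pos hk hε s
  have := logSlope_nonneg hε.le hεk s
  positivity

lemma nnnorm_deriv_powTrunc_le (hσ : 0 ≤ σ) (hk : 0 < k) (hε : 0 < ε) (hεk : ε ≤ k ^ 2) (s : ℝ) :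
    ‖deriv (powTrunc σ k ε) s‖₊ ≤ ((k ^ 2) ^ σ * (1 + σ * 2)).toNNReal := by
  rw [← NNReal.coe_le_coe, Real.coe_toNNReal _ (by positivity), coe_nnnorm,
    Real.norm_of_nonneg (deriv_powTrunc_nonneg hσ hk hε hεk s), deriv_powTrunc hk hε]
  have h1 := sqTrunc_pos hk hε s
  have h2 := logSlope_nonneg hε.le hεk s
  have h3 := sqTrunc_le hk hεk s
  have h4 := logSlope_le hk hε s
  gcongr

/-- Comparison of the derivatives of the truncations of `s |s| ^ (2σ)` and `s |s| ^ (4σ)`. -/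
lemma deriv_powTrunc_sq_le (hσ : 0 ≤ σ) (hk : 0 < k) (hε : 0 < ε) (hεk : ε ≤ k ^ 2) (s : ℝ) :
    deriv (powTrunc σ k ε) s ^ 2 ≤ (1 + 2 * σ) * deriv (powTrunc (2 * σ) k ε) s := by
  rw [deriv_powTrunc hk hε, deriv_powTrunc hk hε, mul_pow, mul_comm 2 σ,
    Real.rpow_mul (sqTrunc_nonneg hε.le s), Real.rpow_two, mul_left_comm]
  have h2 := logSlope_nonneg hε.le hεk s
  have h4 := logSlope_le hk hε s
  gcongr
  -- With `x = σ * logSlope k ε s` in `[0, 2σ]`, `(1 + x)² ≤ (1 + 2σ)(1 + 2x)`.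
  have h5 : 0 ≤ σ * logSlope k ε s := by positivity
  have h6 : σ * logSlope k ε s ≤ σ * 2 := by gcongr
  nlinarith

/-- The power relation between the two truncations. -/
lemma abs_powTrunc_rpow_le (hk : 0 < k) {p' q : ℝ} (hp' : 0 < p') (hpq : p' ≤ q)
    (h : (1 + 4 * σ) * p' = (1 + 2 * σ) * q) (s : ℝ) :
    |powTrunc (2 * σ) k 0 s| ^ p' ≤ |powTrunc σ k 0 s| ^ q := by
  have hq : 0 < q := hp'.trans_le hpq
  rcases eq_or_ne s 0 with rfl | hs
  · simp [powTrunc, hp'.ne', hq.ne']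
  have hw : 0 < sqTrunc k 0 s := by unfold sqTrunc; positivity
  have hs0 : 0 < |s| := abs_pos.2 hs
  have hws : sqTrunc k 0 s ≤ |s| ^ 2 := by rw [sq_abs]; exact sqTrunc_zero_le_sq hk s
  rw [abs_powTrunc le_rfl, abs_powTrunc le_rfl, Real.mul_rpow hs0.le (by positivity),
    Real.mul_rpow hs0.le (by positivity), ← Real.rpow_mul hw.le, ← Real.rpow_mul hw.le]
  set w := sqTrunc k 0 s
  -- The exponent relation says `2σp' = (q - p')/2 + σq`; the first part is traded for a power of
  -- `|s|` using `w ≤ |s|²`.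
  calc |s| ^ p' * w ^ (2 * σ * p') = |s| ^ p' * (w ^ ((q - p') / 2) * w ^ (σ * q)) := by
        rw [← Real.rpow_add hw]; congr 2; linarith
    _ ≤ |s| ^ p' * ((|s| ^ 2) ^ ((q - p') / 2) * w ^ (σ * q)) := by
        gcongr
    _ = |s| ^ p' * (|s| ^ (q - p') * w ^ (σ * q)) := by
        rw [← Real.rpow_natCast, ← Real.rpow_mul hs0.le]
        congr 3; push_cast; ring
    _ = |s| ^ q * w ^ (σ * q) := by
        rw [← mul_assoc, ← Real.rpow_add hs0]; congr 2; ring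

lemma continuous_powTrunc (hσ : 0 ≤ σ) (hk : 0 < k) : Continuous (powTrunc σ k ε) := by
  have h1 : Continuous (sqTrunc k ε) := by
    unfold sqTrunc
    exact Continuous.div (by fun_prop) (by fun_prop) fun s => by positivity
  exact continuous_id.mul (h1.rpow_const fun s => .inr hσ)

lemma tendsto_powTrunc_zero (hσ : 0 ≤ σ) {ι : Type*} {l : Filter ι} {e : ι → ℝ}
    (he : Tendsto e l (𝓝 0)) (s : ℝ) :
    Tendsto (fun i => powTrunc σ k (e i) s) l (𝓝 (powTrunc σ k 0 s)) := by
  have h1 : Continuous fun e : ℝ => powTrunc σ k e s := by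
    unfold powTrunc sqTrunc
    refine continuous_const.mul (Continuous.rpow_const (by fun_prop) fun _ => .inr hσ)
  exact (h1.tendsto 0).comp he

lemma tendsto_abs_powTrunc_atTop (hσ : 0 ≤ σ) (s : ℝ) :
    Tendsto (fun n : ℕ => |powTrunc σ (n + 1) 0 s|) atTop (𝓝 (|s| * (s ^ 2) ^ σ)) := by
  have h1 : Tendsto (fun n : ℕ => sqTrunc (n + 1) 0 s) atTop (𝓝 (s ^ 2)) := by
    have h2 : ∀ n : ℕ, sqTrunc (n + 1) 0 s = s ^ 2 / (1 + (s / (n + 1)) ^ 2) := fun n => by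
      have : (n : ℝ) + 1 ≠ 0 := by positivity
      unfold sqTrunc
      field_simp
      ring
    simp_rw [h2]
    have h3 : Tendsto (fun n : ℕ => s / ((n : ℝ) + 1)) atTop (𝓝 0) := by
      have := (tendsto_const_div_atTop_nhds_zero_nat s).comp (tendsto_add_atTop_nat 1)
      simpa [Function.comp_def] using this
    have h4 : Tendsto (fun n : ℕ => s ^ 2 / (1 + (s / ((n : ℝ) + 1)) ^ 2)) atTop
        (𝓝 (s ^ 2 / (1 + 0 ^ 2))) :=
      tendsto_const_nhds.div ((h3.pow 2).const_add 1) (by norm_num)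
    simpa using h4
  simp_rw [abs_powTrunc le_rfl]
  exact (h1.rpow_const (.inr hσ)).const_mul _

end Trunc

/-! ### Weak solutions -/

variable {N m : ℕ} {X : Fields N m} {U Ω : Set (E N)} {Q : ℝ}

lemma bilin_smul (M : Matrix (Fin m) (Fin m) ℝ) (ξ η : E m) (c : ℝ) :
    bilin M ξ (c • η) = c * bilin M ξ η := by
  rw [bilin, bilin, Finset.mul_sum]
  simp only [PiLp.smul_apply, smul_eq_mul]
  exact Finset.sum_congr rfl fun i _ => by ring

/-- The energy estimate with a regularised power of the solution as a test function. -/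
lemma IsWeakSolution.eLpNorm_powTrunc_sq_le (hX : ∀ j, LocallyLipschitz (X j)) {q : ℝ≥0∞}
    {S : ℝ≥0} (hS : ∀ φ : E N → ℝ, IsTest Ω φ → eLpNorm φ q (volume.restrict Ω) ≤
      S * eLpNorm (gradX X φ) 2 (volume.restrict Ω)) {α β : ℝ} (hα : 0 < α)
    {A : E N → Matrix (Fin m) (Fin m) ℝ} (hA : IsElliptic Ω α β A) {f u : E N → ℝ}
    (hu : IsWeakSolution X Ω A f u) {σ k ε : ℝ} (hσ : 0 ≤ σ) (hk : 0 < k) (hε : 0 < ε)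
    (hεk : ε ≤ k ^ 2) :
    eLpNorm (fun x => powTrunc σ k 0 (u x)) q (volume.restrict Ω) ^ 2 ≤
      S ^ 2 * ENNReal.ofReal ((1 + 2 * σ) / α) *
        ∫⁻ x in Ω, ‖f x‖ₑ * ‖powTrunc (2 * σ) k ε (u x)‖ₑ := by
  obtain ⟨g, hug, hw⟩ := hu
  have h2σ : 0 ≤ 2 * σ := by positivity
  have hH := hug.comp hX (contDiff_powTrunc hk hε) powTrunc_zero_right
    (nnnorm_deriv_powTrunc_le hσ hk hε hεk)
  have hG := hug.comp hX (contDiff_powTrunc hk hε) powTrunc_zero_right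
    (nnnorm_deriv_powTrunc_le h2σ hk hε hεk)
  obtain ⟨hint, heq⟩ := hw _ _ hG
  set H' : ℝ → ℝ := deriv (powTrunc σ k ε)
  set G' : ℝ → ℝ := deriv (powTrunc (2 * σ) k ε)
  have hsq : Integrable (fun x => ‖H' (u x) • g x‖ ^ 2) (volume.restrict Ω) := hH.2.1.integrable_norm_pow
    two_ne_zero
  -- The gradient of the test function is `G'(u) g`, so only `A g · g` occurs, and ellipticity
  -- bounds it below.
  have henergy : ∫ x in Ω, ‖H' (u x) • g x‖ ^ 2 ≤ (1 + 2 * σ) / α *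
      ∫ x in Ω, f x * powTrunc (2 * σ) k ε (u x) := by
    rw [← heq, ← integral_const_mul]
    refine integral_mono_ae hsq (hint.const_mul _) ?_
    filter_upwards [hA.2] with x hx
    rw [bilin_smul, norm_smul, mul_pow, Real.norm_eq_abs, sq_abs]
    have h1 := deriv_powTrunc_sq_le hσ hk hε hεk (u x)
    have h2 := deriv_powTrunc_nonneg h2σ hk hε hεk (u x)
    have h3 := (hx (g x)).1
    calc H' (u x) ^ 2 * ‖g x‖ ^ 2 ≤ ((1 + 2 * σ) * G' (u x)) * ‖g x‖ ^ 2 := by gcongr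
      _ = (1 + 2 * σ) / α * (G' (u x) * (α * ‖g x‖ ^ 2)) := by field_simp
      _ ≤ _ := by gcongr
  have hnorm : eLpNorm (fun x => H' (u x) • g x) 2 (volume.restrict Ω) ^ 2 =
      ENNReal.ofReal (∫ x in Ω, ‖H' (u x) • g x‖ ^ 2) := by
    rw [ofReal_integral_eq_lintegral_ofReal hsq (ae_of_all _ fun x => by positivity)]
    have := eLpNorm_nnreal_pow_eq_lintegral (μ := volume.restrict Ω)
      (f := fun x => H' (u x) • g x) (p := 2) two_ne_zero
    simp only [ENNReal.coe_ofNat, NNReal.coe_ofNat, ENNReal.rpow_two] at this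
    rw [this]
    refine lintegral_congr fun x => ?_
    rw [← ofReal_norm, ENNReal.ofReal_pow (norm_nonneg _)]
  calc eLpNorm (fun x => powTrunc σ k 0 (u x)) q (volume.restrict Ω) ^ 2
      ≤ eLpNorm (fun x => powTrunc σ k ε (u x)) q (volume.restrict Ω) ^ 2 := by
        gcongr
        exact eLpNorm_mono fun x => abs_powTrunc_zero_le hσ hε.le (u x)
    _ ≤ (S * eLpNorm (fun x => H' (u x) • g x) 2 (volume.restrict Ω)) ^ 2 := by
        gcongr
        exact hH.eLpNorm_le hX hS
    _ = S ^ 2 * ENNReal.ofReal (∫ x in Ω, ‖H' (u x) • g x‖ ^ 2) := by rw [mul_pow, hnorm]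
    _ ≤ S ^ 2 * (ENNReal.ofReal ((1 + 2 * σ) / α) *
          ∫⁻ x in Ω, ‖f x‖ₑ * ‖powTrunc (2 * σ) k ε (u x)‖ₑ) := by
        gcongr
        refine (ENNReal.ofReal_le_ofReal henergy).trans ?_
        rw [ENNReal.ofReal_mul (by positivity)]
        gcongr
        refine (ENNReal.ofReal_le_ofReal (le_abs_self _)).trans ?_
        rw [← Real.norm_eq_abs, ofReal_norm]
        refine (enorm_integral_le_lintegral_enorm _).trans_eq ?_
        simp_rw [enorm_mul]
    _ = _ := by rw [mul_assoc]

/-- The energy estimate after the regularisation at the zero set of the solution is removed. -/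
lemma IsWeakSolution.eLpNorm_powTrunc_zero_sq_le (hX : ∀ j, LocallyLipschitz (X j)) {q : ℝ≥0∞}
    {S : ℝ≥0} (hS : ∀ φ : E N → ℝ, IsTest Ω φ → eLpNorm φ q (volume.restrict Ω) ≤
      S * eLpNorm (gradX X φ) 2 (volume.restrict Ω)) {α β : ℝ} (hα : 0 < α)
    {A : E N → Matrix (Fin m) (Fin m) ℝ} (hA : IsElliptic Ω α β A) {f u : E N → ℝ}
    (hu : IsWeakSolution X Ω A f u) (hf : AEStronglyMeasurable f (volume.restrict Ω))
    (hfu : ∫⁻ x in Ω, ‖f x‖ₑ * ‖u x‖ₑ ≠ ⊤) {σ k : ℝ} (hσ : 0 ≤ σ) (hk : 0 < k) :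
    eLpNorm (fun x => powTrunc σ k 0 (u x)) q (volume.restrict Ω) ^ 2 ≤
      S ^ 2 * ENNReal.ofReal ((1 + 2 * σ) / α) *
        ∫⁻ x in Ω, ‖f x‖ₑ * ‖powTrunc (2 * σ) k 0 (u x)‖ₑ := by
  have h2σ : 0 ≤ 2 * σ := by positivity
  have hum : AEStronglyMeasurable u (volume.restrict Ω) := by
    obtain ⟨g, hug, -⟩ := hu
    exact hug.1.1
  set e : ℕ → ℝ := fun n => k ^ 2 / (n + 1) with he
  have he0 : ∀ n, 0 < e n := fun n => by positivity
  have hek : ∀ n, e n ≤ k ^ 2 := fun n => div_le_self (by positivity) (by simp)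
  have helim : Tendsto e atTop (𝓝 0) := by
    have := (tendsto_const_div_atTop_nhds_zero_nat (k ^ 2)).comp (tendsto_add_atTop_nat 1)
    simpa [Function.comp_def] using this
  have hlim : Tendsto (fun n => ∫⁻ x in Ω, ‖f x‖ₑ * ‖powTrunc (2 * σ) k (e n) (u x)‖ₑ) atTop
      (𝓝 (∫⁻ x in Ω, ‖f x‖ₑ * ‖powTrunc (2 * σ) k 0 (u x)‖ₑ)) := by
    -- For fixed `k` the truncation grows linearly, uniformly in `ε ≤ k²`, so a multiple of `|f||u|`
    -- dominates.
    refine tendsto_lintegral_of_dominated_convergence'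
      (fun x => ENNReal.ofReal ((k ^ 2) ^ (2 * σ)) * (‖f x‖ₑ * ‖u x‖ₑ)) (fun n => ?_)
      (fun n => ae_of_all _ fun x => ?_) ?_ (ae_of_all _ fun x => ?_)
    · exact hf.enorm.mul ((continuous_powTrunc h2σ hk).comp_aestronglyMeasurable hum).enorm
    · dsimp only
      rw [mul_left_comm]
      gcongr
      rw [← ofReal_norm, ← ofReal_norm, ← ENNReal.ofReal_mul (by positivity)]
      exact ENNReal.ofReal_le_ofReal (abs_powTrunc_le h2σ hk (he0 n).le (hek n) (u x))
    · rw [lintegral_const_mul' _ _ ENNReal.ofReal_ne_top]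
      exact ENNReal.mul_ne_top ENNReal.ofReal_ne_top hfu
    · refine ENNReal.Tendsto.const_mul ?_ (.inr enorm_ne_top)
      exact (continuous_enorm.tendsto _).comp (tendsto_powTrunc_zero h2σ helim (u x))
  refine ge_of_tendsto (ENNReal.Tendsto.const_mul hlim (.inr ?_)) (.of_forall fun n =>
    hu.eLpNorm_powTrunc_sq_le hX hS hα hA hσ hk (he0 n) (hek n))
  exact ENNReal.mul_ne_top (by simp) ENNReal.ofReal_ne_top

/-- An absorption step: `I ^ (a + b) ≤ c I ^ b` implies `I ^ a ≤ c`. -/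
lemma rpow_le_of_rpow_add_le_mul {I c : ℝ≥0∞} (hI : I ≠ ⊤) {a b : ℝ} (ha : 0 < a) (hb : 0 < b)
    (h : I ^ (a + b) ≤ c * I ^ b) : I ^ a ≤ c := by
  rcases eq_or_ne I 0 with rfl | hI0
  · simp [ha]
  rw [ENNReal.rpow_add _ _ hI0 hI] at h
  exact (ENNReal.mul_le_mul_iff_left (ENNReal.rpow_pos (pos_iff_ne_zero.2 hI0) hI).ne'
    (ENNReal.rpow_ne_top_of_nonneg hb.le hI)).1 h

/-- The integrability of weak solutions, given the Sobolev inequality. -/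
lemma IsWeakSolution.memLp_and_eLpNorm_le (hX : ∀ j, LocallyLipschitz (X j))
    (hΩ : volume Ω ≠ ⊤) (hQ : 2 < Q) {S : ℝ≥0}
    (hS : ∀ φ : E N → ℝ, IsTest Ω φ →
      eLpNorm φ (ENNReal.ofReal (2 * Q / (Q - 2))) (volume.restrict Ω) ≤
        S * eLpNorm (gradX X φ) 2 (volume.restrict Ω))
    {p : ℝ} (hp : 2 * Q / (Q + 2) ≤ p) (hpQ : p < Q / 2) {α β : ℝ} (hα : 0 < α)
    {A : E N → Matrix (Fin m) (Fin m) ℝ} (hA : IsElliptic Ω α β A) {f u : E N → ℝ}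
    (hf : MemLp f (ENNReal.ofReal p) (volume.restrict Ω)) (hu : IsWeakSolution X Ω A f u) :
    MemLp u (ENNReal.ofReal (p * Q / (Q - 2 * p))) (volume.restrict Ω) ∧
      eLpNorm u (ENNReal.ofReal (p * Q / (Q - 2 * p))) (volume.restrict Ω) ≤
        (S ^ 2 * ((p * (Q - 2) / (2 * (Q - 2 * p))) / α).toNNReal : ℝ≥0) *
          eLpNorm f (ENNReal.ofReal p) (volume.restrict Ω) := by
  have hQ0 : 0 < Q := by linarith
  have hQ2 : 0 < Q - 2 := by linarith
  have hQp : 0 < Q - 2 * p := by linarith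
  rw [div_le_iff₀ (by linarith)] at hp
  have hp1 : 1 < p := by nlinarith
  have hp0 : 0 < p := by linarith
  set q : ℝ := 2 * Q / (Q - 2) with hq
  set r : ℝ := p * Q / (Q - 2 * p) with hr
  set p' : ℝ := p / (p - 1) with hp'
  -- Chosen so that `(1 + 2σ) q = r`. The lower bound on `p` is exactly `σ ≥ 0`, and equally `p' ≤
  -- q`.
  set σ : ℝ := (p * (Q - 2) / (2 * (Q - 2 * p)) - 1) / 2 with hσdef
  have hp1' : 0 < p - 1 := by linarith
  have hq0 : 0 < q := by positivity
  have hr0 : 0 < r := by positivity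
  have hp'0 : 0 < p' := by positivity
  have hσ : 0 ≤ σ := by
    have : 1 ≤ p * (Q - 2) / (2 * (Q - 2 * p)) := by
      rw [one_le_div (by positivity)]; linarith
    rw [hσdef]; linarith
  have hpq' : p' ≤ q := by
    rw [hp', hq, div_le_div_iff₀ hp1' hQ2]; linarith
  have hσ2 : 1 + 2 * σ = p * (Q - 2) / (2 * (Q - 2 * p)) := by rw [hσdef]; ring
  have hrq : (1 + 2 * σ) * q = r := by rw [hσ2, hq, hr]; field_simp
  have hrel : (1 + 4 * σ) * p' = (1 + 2 * σ) * q := by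
    rw [hrq, show 1 + 4 * σ = 2 * (1 + 2 * σ) - 1 by ring, hσ2, hp', hr]
    field_simp
    ring
  have hexp : 1 / q * 2 = 1 / r + 1 / p' := by
    rw [hq, hr, hp']; field_simp; ring
  have hconj : p.HolderConjugate p' := Real.HolderConjugate.conjExponent hp1
  rw [← hσ2]
  have hum : AEStronglyMeasurable u (volume.restrict Ω) := by
    obtain ⟨g, hug, -⟩ := hu
    exact hug.1.1
  -- Sobolev for `u` itself gives qualitative integrability: `f u` is integrable and the truncated
  -- integrals below are finite.
  have huq : eLpNorm u (ENNReal.ofReal q) (volume.restrict Ω) ≠ ⊤ := by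
    obtain ⟨g, hug, -⟩ := hu
    exact ne_top_of_le_ne_top (ENNReal.mul_ne_top ENNReal.coe_ne_top hug.2.1.eLpNorm_ne_top)
      (hug.eLpNorm_le hX hS)
  have hnorm : ∀ (t : ℝ), 0 < t → ∀ v : E N → ℝ, eLpNorm v (ENNReal.ofReal t) (volume.restrict Ω) =
      (∫⁻ x in Ω, ‖v x‖ₑ ^ t) ^ (1 / t) := fun t ht v => by
    rw [eLpNorm_eq_lintegral_rpow_enorm_toReal (by simpa using ht) ENNReal.ofReal_ne_top,
      ENNReal.toReal_ofReal ht.le]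
  set F := eLpNorm f (ENNReal.ofReal p) (volume.restrict Ω) with hF
  have hHolder : ∀ v : E N → ℝ, AEStronglyMeasurable v (volume.restrict Ω) →
      ∫⁻ x in Ω, ‖f x‖ₑ * ‖v x‖ₑ ≤ F * (∫⁻ x in Ω, ‖v x‖ₑ ^ p') ^ (1 / p') := fun v hv => by
    rw [hF, hnorm p hp0]
    exact ENNReal.lintegral_mul_le_Lp_mul_Lq _ hconj hf.1.enorm hv.enorm
  have hfu : ∫⁻ x in Ω, ‖f x‖ₑ * ‖u x‖ₑ ≠ ⊤ := by
    refine ne_top_of_le_ne_top (ENNReal.mul_ne_top hf.eLpNorm_ne_top ?_) (hHolder u hum)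
    rw [← hnorm p' hp'0]
    have : IsFiniteMeasure (volume.restrict Ω) := ⟨by simpa using hΩ.lt_top⟩
    exact (MemLp.mono_exponent (⟨hum, huq.lt_top⟩ : MemLp u (ENNReal.ofReal q) (volume.restrict Ω))
      (ENNReal.ofReal_le_ofReal hpq')).eLpNorm_ne_top
  set C₀ : ℝ≥0 := S ^ 2 * ((1 + 2 * σ) / α).toNNReal with hC₀
  have hkey : ∀ k : ℝ, 0 < k → ∫⁻ x in Ω, ‖powTrunc σ k 0 (u x)‖ₑ ^ q ≤ (C₀ * F) ^ r := by
    intro k hk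
    set I := ∫⁻ x in Ω, ‖powTrunc σ k 0 (u x)‖ₑ ^ q with hI
    -- Finiteness is what permits cancelling `I ^ (1 / p')`; it follows from the linear growth of
    -- the truncation.
    have hIt : I ≠ ⊤ := by
      have h1 : eLpNorm (fun x => powTrunc σ k 0 (u x)) (ENNReal.ofReal q) (volume.restrict Ω) ≠ ⊤ := by
        refine ne_top_of_le_ne_top (ENNReal.mul_ne_top (ENNReal.ofReal_ne_top
          (r := (k ^ 2) ^ σ)) huq) (eLpNorm_le_mul_eLpNorm_of_ae_le_mul (ae_of_all _ fun x => ?_) _)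
        exact abs_powTrunc_le hσ hk le_rfl (by positivity) (u x)
      rw [hnorm q hq0] at h1
      intro htop
      rw [← hI, htop] at h1
      exact h1 (ENNReal.top_rpow_of_pos (by positivity))
    have h1 := hu.eLpNorm_powTrunc_zero_sq_le hX hS hα hA hf.1 hfu hσ hk
    rw [hnorm q hq0, ← hI, ← ENNReal.rpow_two, ← ENNReal.rpow_mul, hexp] at h1
    have h2 : ∫⁻ x in Ω, ‖f x‖ₑ * ‖powTrunc (2 * σ) k 0 (u x)‖ₑ ≤ F * I ^ (1 / p') := by
      refine (hHolder _ ((continuous_powTrunc (by positivity) hk).comp_aestronglyMeasurable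
        hum)).trans ?_
      gcongr
      rw [hI]
      refine lintegral_mono fun x => ?_
      rw [← ofReal_norm, ← ofReal_norm, ENNReal.ofReal_rpow_of_nonneg (norm_nonneg _) hp'0.le,
        ENNReal.ofReal_rpow_of_nonneg (norm_nonneg _) hq0.le]
      exact ENNReal.ofReal_le_ofReal (abs_powTrunc_rpow_le hk hp'0 hpq' hrel (u x))
    have h3 : I ^ (1 / r + 1 / p') ≤ C₀ * F * I ^ (1 / p') := by
      refine h1.trans ?_
      rw [mul_assoc (C₀ : ℝ≥0∞), hC₀]
      push_cast
      gcongr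
      exact le_rfl
    have h4 := rpow_le_of_rpow_add_le_mul hIt (by positivity) (by positivity) h3
    rwa [one_div, ENNReal.rpow_inv_le_iff hr0] at h4
  -- The bound in `hkey` does not depend on `k`. As `k → ∞` the truncations tend to `|u|^{1+2σ}`,
  -- whose power `q` is `|u|^r`.
  have hfatou : ∫⁻ x in Ω, ‖u x‖ₑ ^ r ≤ (C₀ * F) ^ r := by
    have hpt : ∀ x, ‖u x‖ₑ ^ r =
        liminf (fun n : ℕ => ‖powTrunc σ (n + 1) 0 (u x)‖ₑ ^ q) atTop := by
      intro x
      have h1 : Tendsto (fun n : ℕ => ‖powTrunc σ (n + 1) 0 (u x)‖ₑ ^ q) atTop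
          (𝓝 (ENNReal.ofReal (|u x| * (u x ^ 2) ^ σ) ^ q)) := by
        have h2 := (ENNReal.continuous_ofReal.tendsto _).comp (tendsto_abs_powTrunc_atTop hσ (u x))
        have h3 := ((ENNReal.continuous_rpow_const (y := q)).tendsto _).comp h2
        refine h3.congr fun n => ?_
        simp only [Function.comp_apply]
        rw [← Real.norm_eq_abs, ofReal_norm]
      rw [h1.liminf_eq, ← ofReal_norm, ENNReal.ofReal_rpow_of_nonneg (norm_nonneg _) hr0.le,
        ENNReal.ofReal_rpow_of_nonneg (by positivity) hq0.le, ← hrq, ← sq_abs, Real.norm_eq_abs,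
        ← Real.rpow_natCast, ← Real.rpow_mul (abs_nonneg _), Real.rpow_mul (abs_nonneg _)]
      congr 2
      rw [Real.rpow_add_of_nonneg (abs_nonneg _) zero_le_one (by positivity), Real.rpow_one]
      norm_num
    simp_rw [hpt]
    refine (lintegral_liminf_le' fun n => ?_).trans ?_
    · exact ((continuous_powTrunc (k := (n : ℝ) + 1) hσ (by positivity)).comp_aestronglyMeasurable
        hum).enorm.pow_const q
    · refine (liminf_le_liminf (.of_forall fun n : ℕ => hkey ((n : ℝ) + 1) (by positivity))).trans ?_
      simp
  have hfinal : eLpNorm u (ENNReal.ofReal r) (volume.restrict Ω) ≤ C₀ * F := by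
    rw [hnorm r hr0, one_div, ENNReal.rpow_inv_le_iff hr0]
    exact hfatou
  exact ⟨⟨hum, hfinal.trans_lt (ENNReal.mul_lt_top ENNReal.coe_lt_top hf.eLpNorm_lt_top)⟩, hfinal⟩

end XElliptic

theorem theorem4p3 {N m : ℕ} (hN : 2 ≤ N)
    (X : XElliptic.Fields N m) (Ω U : Set (XElliptic.E N))
    (hΩo : IsOpen Ω) (hΩb : Bornology.IsBounded Ω)
    (hUo : IsOpen U) (hΩU : U = Ω ∨ closure Ω ⊆ U)
    (Q : ℝ) (hX : XElliptic.Admissible X U Q)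
    (p : ℝ) (hp : 2 * Q / (Q + 2) ≤ p) (hpQ : p < Q / 2)
    (α : ℝ) (hα : 0 < α) :
    ∃ C : ℝ≥0, ∀ (β : ℝ) (A : XElliptic.E N → Matrix (Fin m) (Fin m) ℝ) (f u : XElliptic.E N → ℝ),
      α < β → XElliptic.IsElliptic Ω α β A →
      MemLp f (ENNReal.ofReal p) (volume.restrict Ω) →
      XElliptic.IsWeakSolution X Ω A f u →
      MemLp u (ENNReal.ofReal (p * Q / (Q - 2 * p))) (volume.restrict Ω) ∧
      eLpNorm u (ENNReal.ofReal (p * Q / (Q - 2 * p))) (volume.restrict Ω) ≤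
        C * eLpNorm f (ENNReal.ofReal p) (volume.restrict Ω) := by
  obtain ⟨S, hS⟩ := hX.exists_eLpNorm_le hUo (by omega) hΩo hΩb hΩU
  exact ⟨_, fun β A f u _ hA hf hu => hu.memLp_and_eLpNorm_le hX.lipschitz
    hΩb.measure_lt_top.ne hX.two_lt hS hp hpQ hα hA hf⟩
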